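/- **Even singularities $X_{e,\mu}$.** Write $k=(x,y,z)$ with $x=k_1$, $y=k_2$, $z=(k_3,\dots,k_\nu)$, $\nu\ge2$. Let $f:\mathbb R^\nu\to\mathbb R$ be a smooth even function such that the kernel of its second differential at $0$ is the coordinate plane $Ok_1k_2$. Write $f_{x^ay^bz^c}$ for the array of partial derivatives of $f$ at $0$, and $f_{z^2}^{-1}$ for the inverse of the matrix $\big(\partial^2f(0)/\partial k_i\partial k_j\big)_{i,j=3}^{\nu}$. *Equivalence and classes.* Two germs at $0$ are $R_O$-equivalent if one is carried to the other by a germ of an odd diffeomorphism. The even germ of $f$ has a singularity of class $X_{e,\mu}^{s,t}$ ($s,t=\pm1$) if it is $R_O$-equivalent to $d+g(\tilde k_1,\tilde k_2)+Q(\tilde k_3,\dots,\tilde k_\nu)$ with $d$ a constant, $Q$ a nondegenerate quadratic form, and $g=s\tilde k_1^4+a\tilde k_1^2\tilde k_2^2+t\tilde k_2^4$ with $a\in\mathbb R$, $a^2\ne4$ in case $s=t$ (if $\mu=5$), or $g=s\tilde k_1^4+t\tilde k_1^2\tilde k_2^2+a\tilde k_2^{2\mu-6}$ with $a\neq0$ (if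 $\mu\ge6$). *Normalization.* Suppose that for some $\varepsilon,\eta\in\{1,-1\}$ $$f_{x^3y}=f_{xy^3}=0,\quad f_{x^4}=24\varepsilon,\quad f_{x^2y^2}=4\eta,\quad f_{y^4}\ne6\varepsilon.\qquad(\ast)$$ (If $(\ast)$ is not assumed, it can be achieved, for some $\varepsilon,\eta$, by an invertible linear change of $k_1,k_2$ provided that the degree-$4$ homogeneous part of the Taylor series of $f(k_1,k_2,0,\dots,0)$ at $0$ does not vanish, is not plus or minus the square of a quadratic form, and is linearly equivalent either to $\pm x^4+ax^2y^2\pm y^4$ with $a\neq0$ or to $x^2(\pm x^2\pm y^2)$, all signs being independent.) *Claim.* For every $\nu,\varepsilon,\eta$ there are polynomials $P_\mu$, $\mu\ge5$, the same for all $f$ satisfying $(\ast)$, such that the numbers $x_{e,\mu}=x_{e,\mu}^{\varepsilon,\eta}=\dfrac{\partial^{2\mu-6}f(0)}{\partial k_2^{2\mu-6}}+P_\mu$ have the following properties. 1. $P_\mu$ is a polynomial with rational coefficients and zero free term in the partial derivatives of $f$ at $0$ of order between $4$ and $2\mu-8$, other than those with respect to $k_2$ only, and in the components of $f_{z^2}^{-1}$.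 Moreover $$x_{e,5}=f_{y^4},\quad x_{e,6}=a_{0,6},\quad x_{e,7}=a_{0,8}-\tfrac{7\eta}{10}a_{1,5}^2,\quad x_{e,8}=a_{0,10}-3\eta\,a_{1,5}a_{1,7}+\tfrac{21}{16}a_{1,5}^2a_{2,4},$$ where, products denoting contraction of the $z$-indices and $w=f_{z^2}^{-1}f_{y^3z}$, $$a_{0,6}=f_{y^6}-10f_{y^3z}w,\qquad a_{0,8}=f_{y^8}-56\,w\,(f_{y^5z}-5f_{y^2z^2}w),\qquad a_{1,5}=f_{xy^5}-10\,w f_{xy^2z},$$ $$a_{0,10}=f_{y^{10}}-120\,w\big(f_{y^7z}-21f_{y^2z^2}f_{z^2}^{-1}f_{y^5z}+105f_{y^2z^2}f_{z^2}^{-1}f_{y^2z^2}w\big)-126f_{y^5z}f_{z^2}^{-1}f_{y^5z}+2100f_{y^4z^2}[w]^2-2800f_{yz^3}[w]^3,$$ $$a_{1,7}=f_{xy^7}-35f_{xy^4z}w-21f_{xy^2z}f_{z^2}^{-1}\big(f_{y^5z}-10f_{y^2z^2}w\big)+70f_{xyz^2}[w]^2,$$ $$a_{2,4}=f_{x^2y^4}-4f_{x^2yz}w-6f_{xy^2z}f_{z^2}^{-1}f_{xy^2z}.$$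 2. For $\mu\ge5$, the even germ of $f$ at $0$ has a singularity of class $X_{e,\mu}^{s,t}$ for some signs $s,t$ if and only if $$x_{e,5}=\dots=x_{e,\mu-1}=0,\qquad x_{e,\mu}\ne0;\qquad(\ast\ast)$$ for $\mu\ge6$ the same holds for the class $X_{e,\mu}^{\varepsilon,\eta}$. If $(\ast\ast)$ holds then, in a neighbourhood of the origin, a regular odd change of variables $k\to\tilde k$ reduces $f$ to $$f=d+\varepsilon\tilde k_1^4+\eta\tilde k_1^2\tilde k_2^2+\frac{x_{e,\mu}}{(2\mu-6)!}\tilde k_2^{2\mu-6}+Q(\tilde k_3,\dots,\tilde k_\nu)$$ with $d$ a constant and $Q$ a nondegenerate quadratic form. If moreover $\mu\ge6$, then $x_{e,\mu}/(2\mu-6)!$ is the even modulus: whenever $f$ is $R_O$-equivalent to $d'+\varepsilon\tilde k_1^4+\eta\tilde k_1^2\tilde k_2^2+a\tilde k_2^{2\mu-6}+Q'(\tilde k_3,\dots,\tilde k_\nu)$ with $a\ne0$ and $Q'$ nondegenerate, then $a=x_{e,\mu}/(2\mu-6)!$. -/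

import Mathlib

open scoped ContDiff Matrix

noncomputable section

/-- The space `ℝ^ν` with `ν = n + 2`. The coordinates are `k₁ = k 0`, `k₂ = k 1`
and `(k₃, …, k_ν)`, that is `k i.succ.succ` for `i : Fin n`. -/
abbrev Coord (n : ℕ) : Type := Fin (n + 2) → ℝ

/-- A sign, as a real number. -/
def IsSign (s : ℝ) : Prop := s = 1 ∨ s = -1

/-! ### Partial derivatives at the origin -/

/-- The first partial derivative `∂g/∂k_i`, as a function. -/
def pderivCoord {n : ℕ} (i : Fin (n + 2)) (g : Coord n → ℝ) : Coord n → ℝ :=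
  fun x => fderiv ℝ g x (Pi.single i 1)

/-- The partial derivative `∂^{|α|} f / ∂k_1^{α_1} ⋯ ∂k_ν^{α_ν}` at the origin. -/
def pd {n : ℕ} (f : Coord n → ℝ) (α : Fin (n + 2) → ℕ) : ℝ :=
  (List.finRange (n + 2)).foldr (fun i g => (pderivCoord i)^[α i] g) f 0

/-- The multi-index of the differentiation `∂k_1^a ∂k_2^b ∂z_{i_1} ⋯ ∂z_{i_c}`,
where `z = (k_3, …, k_ν)` and `l = [i_1, …, i_c]`. -/
def multiIdx {n : ℕ} (a b : ℕ) (l : List (Fin n)) : Fin (n + 2) → ℕ :=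
  Matrix.vecCons a (Matrix.vecCons b (fun i => l.count i))

/-- The partial derivative of `f` at the origin, `a` times in `k_1`, `b` times in `k_2`, and once
for every entry of `l` in the corresponding `z`-variable. -/
def jet {n : ℕ} (f : Coord n → ℝ) (a b : ℕ) (l : List (Fin n)) : ℝ := pd f (multiIdx a b l)

/-! ### Odd changes of variables, normal forms, singularity classes -/

/-- Right-odd equivalence of the germs at `0`: `f = g ∘ h` near `0` for a germ `h` of a smooth
odd diffeomorphism. -/
def OddEquiv {n : ℕ} (f g : Coord n → ℝ) : Prop :=
  ∃ h : OpenPartialHomeomorph (Coord n) (Coord n),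
    (0 : Coord n) ∈ h.source ∧
    (∀ x ∈ h.source, -x ∈ h.source ∧ h (-x) = -h x) ∧
    ContDiffOn ℝ ∞ h h.source ∧
    ContDiffOn ℝ ∞ h.symm h.target ∧
    ∀ x ∈ h.source, f x = g (h x)

/-- The function `d + g(k_1, k_2) + Q(k_3, …, k_ν)`. -/
def splitForm {n : ℕ} (d : ℝ) (g : ℝ → ℝ → ℝ) (Q : QuadraticForm ℝ (Fin n → ℝ)) :
    Coord n → ℝ :=
  fun k => d + g (k 0) (k 1) + Q (fun i => k i.succ.succ)

/-- The even germ of `f` at `0` has a singularity of class `X_{e,μ}^{s,t}`. Up to a constant,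
a nondegenerate quadratic form in the other variables and an odd change of variables it is
`s x⁴ + a x² y² + t y⁴` (with `a² ≠ 4` if `s = t`) for `μ = 5`, and
`s x⁴ + t x² y² + a y^{2μ-6}` (with `a ≠ 0`) for `μ ≥ 6`. -/
def IsClassXe {n : ℕ} (μ : ℕ) (s t : ℝ) (f : Coord n → ℝ) : Prop :=
  IsSign s ∧ IsSign t ∧
  ∃ (d : ℝ) (Q : QuadraticForm ℝ (Fin n → ℝ)), Q.Nondegenerate ∧
    ((μ = 5 ∧ ∃ a : ℝ, (s = t → a ^ 2 ≠ 4) ∧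
        OddEquiv f (splitForm d (fun x y => s * x ^ 4 + a * x ^ 2 * y ^ 2 + t * y ^ 4) Q)) ∨
     (6 ≤ μ ∧ ∃ a : ℝ, a ≠ 0 ∧
        OddEquiv f
          (splitForm d (fun x y => s * x ^ 4 + t * x ^ 2 * y ^ 2 + a * y ^ (2 * μ - 6)) Q)))

/-! ### The hypotheses on the function -/

/-- `f` is a smooth even function on `ℝ^ν`, and the kernel of its second differential at the
origin is the coordinate plane `Ok_1k_2`. -/
structure EvenCorankTwo {n : ℕ} (f : Coord n → ℝ) : Prop where
  smooth : ContDiff ℝ ∞ f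
  even : ∀ k, f (-k) = f k
  kernel : ∀ v : Coord n,
    (∀ w, fderiv ℝ (fderiv ℝ f) 0 v w = 0) ↔ ∀ i : Fin n, v i.succ.succ = 0

/-- The normalization of the fourth-order derivatives. -/
structure Normalized {n : ℕ} (ε η : ℝ) (f : Coord n → ℝ) : Prop extends EvenCorankTwo f where
  d31 : jet f 3 1 [] = 0
  d13 : jet f 1 3 [] = 0
  d40 : jet f 4 0 [] = 24 * ε
  d22 : jet f 2 2 [] = 4 * η
  d04 : jet f 0 4 [] ≠ 6 * ε

/-- The homogeneous part of degree four of the Taylor series at the origin of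
`f(k_1, k_2, 0, …, 0)`. -/
def quarticForm {n : ℕ} (f : Coord n → ℝ) (x y : ℝ) : ℝ :=
  jet f 4 0 [] / 24 * x ^ 4 + jet f 3 1 [] / 6 * x ^ 3 * y + jet f 2 2 [] / 4 * x ^ 2 * y ^ 2
    + jet f 1 3 [] / 6 * x * y ^ 3 + jet f 0 4 [] / 24 * y ^ 4

/-- `q` is, up to sign, the square of a quadratic form in two variables. -/
def IsSquareUpToSign (q : ℝ → ℝ → ℝ) : Prop :=
  ∃ s a b c : ℝ, IsSign s ∧ ∀ x y, q x y = s * (a * x ^ 2 + b * x * y + c * y ^ 2) ^ 2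

/-- `q` is carried to `p` by an invertible linear change of the two variables. -/
def LinReduces (q p : ℝ → ℝ → ℝ) : Prop :=
  ∃ M : Matrix (Fin 2) (Fin 2) ℝ, M.det ≠ 0 ∧
    ∀ x y, q (M 0 0 * x + M 0 1 * y) (M 1 0 * x + M 1 1 * y) = p x y

/-- The linear map of `ℝ^ν` that transforms `(k_1, k_2)` by the matrix `M` and fixes
`k_3, …, k_ν`. -/
def planeChange {n : ℕ} (M : Matrix (Fin 2) (Fin 2) ℝ) : Coord n → Coord n :=
  fun k => Matrix.vecCons (M 0 0 * k 0 + M 0 1 * k 1)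
    (Matrix.vecCons (M 1 0 * k 0 + M 1 1 * k 1) (fun i => k i.succ.succ))

/-! ### The numbers `x_{e,μ}` -/

/-- The inverse of the matrix `∂²f(0)/∂k_i∂k_j`, `i, j = 3, …, ν`. -/
def hessInv {n : ℕ} (f : Coord n → ℝ) : Matrix (Fin n) (Fin n) ℝ :=
  (Matrix.of fun i j => jet f 0 0 [i, j])⁻¹

/-- The indeterminates of the correction polynomials: one for every partial derivative and one for
every component of the inverse of the Hessian block. -/
abbrev JetVar (n : ℕ) : Type := (Fin (n + 2) → ℕ) ⊕ (Fin n × Fin n)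

/-- The indeterminates that are allowed in the correction of `x_{e,μ}`: the partial derivatives of
order between `4` and `2μ - 8`, other than those with respect to `k_2` only, and all components of
the inverse matrix. -/
def JetVar.Allowed {n : ℕ} (μ : ℕ) : JetVar n → Prop
  | Sum.inl α => 4 ≤ ∑ i, α i ∧ ∑ i, α i + 8 ≤ 2 * μ ∧ ∃ i, i ≠ 1 ∧ α i ≠ 0
  | Sum.inr _ => True

/-- The value of a correction polynomial at the jet of `f`. -/
def evalJet {n : ℕ} (f : Coord n → ℝ) (P : MvPolynomial (JetVar n) ℚ) : ℝ :=
  MvPolynomial.aeval (Sum.elim (fun α => pd f α) (fun p => hessInv f p.1 p.2)) P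

/-- `x_{e,μ} = ∂^{2μ-6} f(0) / ∂k_2^{2μ-6} + (correction)`. -/
def xe {n : ℕ} (P : ℕ → MvPolynomial (JetVar n) ℚ) (f : Coord n → ℝ) (μ : ℕ) : ℝ :=
  jet f 0 (2 * μ - 6) [] + evalJet f (P μ)

/-- `x_{e,5} = ⋯ = x_{e,μ-1} = 0` and `x_{e,μ} ≠ 0`. -/
def XeCriterion (x : ℕ → ℝ) (μ : ℕ) : Prop := (∀ j, 5 ≤ j → j < μ → x j = 0) ∧ x μ ≠ 0

/-! ### The tabulated values, for even functions -/

/-- `f_{x^a y^b z}`, a vector. -/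
def jetZ {n : ℕ} (f : Coord n → ℝ) (a b : ℕ) : Fin n → ℝ := fun i => jet f a b [i]

/-- `f_{x^a y^b z²}`, a symmetric matrix. -/
def jetZZ {n : ℕ} (f : Coord n → ℝ) (a b : ℕ) : Matrix (Fin n) (Fin n) ℝ :=
  Matrix.of fun i j => jet f a b [i, j]

/-- The vector `f_{z²}^{-1} f_{y³z}`. -/
def wVec {n : ℕ} (f : Coord n → ℝ) : Fin n → ℝ := hessInv f *ᵥ jetZ f 0 3

def a06 {n : ℕ} (f : Coord n → ℝ) : ℝ := jet f 0 6 [] - 10 * (jetZ f 0 3 ⬝ᵥ wVec f)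

def a08 {n : ℕ} (f : Coord n → ℝ) : ℝ :=
  jet f 0 8 [] - 56 * (wVec f ⬝ᵥ (jetZ f 0 5 - (5 : ℝ) • (jetZZ f 0 2 *ᵥ wVec f)))

def a15 {n : ℕ} (f : Coord n → ℝ) : ℝ := jet f 1 5 [] - 10 * (wVec f ⬝ᵥ jetZ f 1 2)

def a010 {n : ℕ} (f : Coord n → ℝ) : ℝ :=
  jet f 0 10 []
    - 120 * (wVec f ⬝ᵥ (jetZ f 0 7
        - (21 : ℝ) • (jetZZ f 0 2 *ᵥ (hessInv f *ᵥ jetZ f 0 5))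
        + (105 : ℝ) • (jetZZ f 0 2 *ᵥ (hessInv f *ᵥ (jetZZ f 0 2 *ᵥ wVec f)))))
    - 126 * (jetZ f 0 5 ⬝ᵥ (hessInv f *ᵥ jetZ f 0 5))
    + 2100 * (wVec f ⬝ᵥ (jetZZ f 0 4 *ᵥ wVec f))
    - 2800 * ∑ i, ∑ j, ∑ k, jet f 0 1 [i, j, k] * wVec f i * wVec f j * wVec f k

def a17 {n : ℕ} (f : Coord n → ℝ) : ℝ :=
  jet f 1 7 [] - 35 * (jetZ f 1 4 ⬝ᵥ wVec f)
    - 21 * (jetZ f 1 2 ⬝ᵥ (hessInv f *ᵥ (jetZ f 0 5 - (10 : ℝ) • (jetZZ f 0 2 *ᵥ wVec f))))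
    + 70 * (wVec f ⬝ᵥ (jetZZ f 1 1 *ᵥ wVec f))

def a24 {n : ℕ} (f : Coord n → ℝ) : ℝ :=
  jet f 2 4 [] - 4 * (jetZ f 2 1 ⬝ᵥ wVec f) - 6 * (jetZ f 1 2 ⬝ᵥ (hessInv f *ᵥ jetZ f 1 2))

end

/-!
An even function `f` of `(x, y, z)` whose Hessian at the origin has the plane `z = 0` as its kernel,
normalized so that its quartic part on that plane is `εx⁴ + ηx²y² + cy⁴`, is studied along its
*critical curve* (`IsCritCurve`): the equations `f_x = 0`, `f_z = 0` have an odd solution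
`γ(t) = (X(t), t, Z(t))` with `X`, `Z` of order `t³`, because `f_z = 0` can be solved for `z`, and
then `f_x = 0`, whose part linear in `x` is `2ηxy²`, for `x/y³`. Everything is read off from the
leading Taylor term of the even function `φ = f ∘ γ - f(0)` of one variable.

*Normal form.* The splitting lemma with parity (`EvenCorankTwo.oddGerm_split`) separates a
nondegenerate quadratic form in `z`, and moving the critical curve to the `y`-axis leaves
a function of `x` and `y` that is the sum of `φ(y)` and of `x²` times a smooth even function. If
`φ` has the leading term `a t^{2m}`, where `m = μ - 3`, this function differs from
`εx⁴ + ηx²y² + ay^{2m}` by terms which a coordinate change with six unknown even coefficient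
functions absorbs. The six equations for them are solvable by the implicit function theorem, and
the uniqueness of the solution makes the coefficients even (`planar_normal_form`,
`Normalized.exists_oddGerm`).

*Uniqueness.* The linear part of an equivalence with a normal form relates the quartic forms
(`IsGermEquiv.exists_linear`). For `μ = 5` this gives `c ≠ 0`, since the quartic form of the normal
form has no multiple root (`coeff_ne_zero_of_linear_change`). For `μ ≥ 6` it shows that the signs
agree, that `c = 0` and that the `y`-axis is preserved up to sign. The equivalence then carries the
critical curve of `f` to a curve which, by an induction on the order of `φ`, is so close to the
`y`-axis that the value there is `ay^{2m}` up to higher order, and so `at^{2m}` is the leading term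
of `φ` (`Normalized.isBigO_of_equiv`).

*Universality.* The critical curve is approximated by a formal Picard iteration whose steps are
polynomial, over the rationals, in the derivatives of `f` and in the entries of the inverse Hessian
(`FormalCurve.step`). Since `f_x` and `f_z` vanish along the curve, an error in the curve affects
the value of `f` to second order only; hence finitely many steps and finitely many derivatives
determine the coefficient of `t^{2m}` in `φ`, and this is
`(∂^{2m}f/∂y^{2m} + P_μ)/(2m)!` with a universal polynomial `P_μ`
(`correction`, `Normalized.exists_taylor_critCurve`). For the same reason an explicit approximation
to the critical curve suffices for the coefficients up to order ten (`Normalized.isBigO_tabulated`).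

The normalization itself is a matter of real binary quartic forms
(`EvenCorankTwo.exists_normalized`).
-/

noncomputable section

open Filter Topology Set

/-! ### Smooth functions: Hadamard's lemma and the implicit function theorem -/

/-- The integral over `[0, 1]` of a smooth function of `(x, t)` is smooth in `x`. -/
theorem contDiff_integral_zero_one {E G : Type} [NormedAddCommGroup E] [NormedSpace ℝ E]
    [FiniteDimensional ℝ E] [NormedAddCommGroup G] [NormedSpace ℝ G] [CompleteSpace G]
    {F : E × ℝ → G} (hF : ContDiff ℝ ∞ F) :
    ContDiff ℝ ∞ (fun x => ∫ t in (0 : ℝ)..1, F (x, t)) := by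
  have key : ∀ n : ℕ, ∀ {G : Type} [NormedAddCommGroup G] [NormedSpace ℝ G] [CompleteSpace G]
      {F : E × ℝ → G}, ContDiff ℝ ∞ F →
      ContDiff ℝ n (fun x => ∫ t in (0 : ℝ)..1, F (x, t)) := by
    intro n
    induction n with
    | zero =>
      intro G _ _ _ F hF
      have hc : Continuous (Function.uncurry fun (x : E) (t : ℝ) => F (x, t)) := hF.continuous
      exact contDiff_zero.2 (intervalIntegral.continuous_parametric_intervalIntegral_of_continuous'
        hc 0 1)
    | succ n ih =>
      intro G _ _ _ F hF
      let F' : E × ℝ → (E →L[ℝ] G) := fun p =>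
        (fderiv ℝ F p).comp (ContinuousLinearMap.inl ℝ E ℝ)
      have hF' : ContDiff ℝ ∞ F' :=
        (hF.fderiv_right (m := ∞) (by simp)).clm_comp contDiff_const
      have hd : ∀ x, HasFDerivAt (fun x => ∫ t in (0 : ℝ)..1, F (x, t))
          (∫ t in (0 : ℝ)..1, F' (x, t)) x := by
        intro x
        have hK : IsCompact (Metric.closedBall x 1 ×ˢ Icc (0 : ℝ) 1) :=
          (isCompact_closedBall x 1).prod isCompact_Icc
        obtain ⟨C, hC⟩ := hK.exists_bound_of_continuousOn hF'.continuous.continuousOn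
        refine intervalIntegral.hasFDerivAt_integral_of_dominated_of_fderiv_le
          (F := fun x t => F (x, t)) (F' := fun x t => F' (x, t)) (bound := fun _ => C)
          (Metric.closedBall_mem_nhds x one_pos) ?_ ?_ ?_ ?_ ?_ ?_
        · exact Eventually.of_forall fun y =>
            (hF.continuous.comp (by fun_prop : Continuous fun t : ℝ => (y, t))).aestronglyMeasurable
        · exact (hF.continuous.comp
            (by fun_prop : Continuous fun t : ℝ => (x, t))).intervalIntegrable _ _
        · exact (hF'.continuous.comp
            (by fun_prop : Continuous fun t : ℝ => (x, t))).aestronglyMeasurable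
        · refine Eventually.of_forall fun t ht y hy => hC (y, t) ⟨hy, ?_⟩
          rw [uIoc_of_le zero_le_one] at ht
          exact ⟨ht.1.le, ht.2⟩
        · exact intervalIntegrable_const
        · refine Eventually.of_forall fun t _ y _ => ?_
          have h1 : HasFDerivAt F (fderiv ℝ F (y, t)) (y, t) :=
            (hF.differentiable (by simp) _).hasFDerivAt
          have h2 : HasFDerivAt (fun y : E => (y, t)) (ContinuousLinearMap.inl ℝ E ℝ) y :=
            hasFDerivAt_prodMk_left y t
          exact h1.comp y h2
      have : ((n + 1 : ℕ) : ℕ∞ω) = (n : ℕ∞ω) + 1 := by norm_cast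
      rw [this, contDiff_succ_iff_fderiv]
      refine ⟨fun x => (hd x).differentiableAt, by simp, ?_⟩
      have : fderiv ℝ (fun x => ∫ t in (0 : ℝ)..1, F (x, t)) =
          fun x => ∫ t in (0 : ℝ)..1, F' (x, t) := funext fun x => (hd x).fderiv
      rw [this]
      exact ih hF'
  exact contDiff_infty.2 fun n => key n hF

/-- Hadamard's lemma relative to a projection `P`: the difference `f k - f (P k)` is divisible by
`k - P k`, with a smooth quotient. -/
theorem exists_hadamard {E G : Type} [NormedAddCommGroup E] [NormedSpace ℝ E]
    [FiniteDimensional ℝ E] [NormedAddCommGroup G] [NormedSpace ℝ G] [CompleteSpace G]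
    {f : E → G} (hf : ContDiff ℝ ∞ f) (P : E →L[ℝ] E) (hP : ∀ k, P (P k) = P k) :
    ∃ L : E → (E →L[ℝ] G), ContDiff ℝ ∞ L ∧ (∀ k, f k = f (P k) + L k (k - P k)) ∧
      ∀ k, L (P k) = fderiv ℝ f (P k) := by
  have hf' : ContDiff ℝ ∞ (fderiv ℝ f) := hf.fderiv_right (m := ∞) (by simp)
  refine ⟨fun k => ∫ t in (0 : ℝ)..1, fderiv ℝ f (P k + t • (k - P k)), ?_, ?_, ?_⟩
  · exact contDiff_integral_zero_one (F := fun p : E × ℝ => fderiv ℝ f (P p.1 + p.2 • (p.1 - P p.1)))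
      (hf'.comp (by fun_prop))
  · intro k
    have hcont : Continuous fun t : ℝ => fderiv ℝ f (P k + t • (k - P k)) :=
      hf'.continuous.comp (by fun_prop)
    beta_reduce
    rw [ContinuousLinearMap.intervalIntegral_apply (hcont.intervalIntegrable _ _)]
    have hd : ∀ t : ℝ, HasDerivAt (fun t : ℝ => f (P k + t • (k - P k)))
        (fderiv ℝ f (P k + t • (k - P k)) (k - P k)) t := by
      intro t
      have h1 : HasFDerivAt f (fderiv ℝ f (P k + t • (k - P k))) (P k + t • (k - P k)) :=
        (hf.differentiable (by simp) _).hasFDerivAt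
      have h2 : HasDerivAt (fun t : ℝ => P k + t • (k - P k)) (k - P k) t := by
        simpa using ((hasDerivAt_id t).smul_const (k - P k)).const_add (P k)
      exact h1.comp_hasDerivAt t h2
    rw [intervalIntegral.integral_eq_sub_of_hasDerivAt (fun t _ => hd t)
      ((hcont.clm_apply continuous_const).intervalIntegrable _ _)]
    simp
  · intro k
    simp [hP]

/-- A smooth self-map with invertible derivative at `a` is, near `a`, a diffeomorphism whose
inverse is smooth on one common neighbourhood. -/
theorem exists_smooth_localInverse {E : Type*} [NormedAddCommGroup E] [NormedSpace ℝ E]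
    [CompleteSpace E] {Φ : E → E} (hΦ : ContDiff ℝ ∞ Φ) {a : E} (L : E ≃L[ℝ] E)
    (hL : HasFDerivAt Φ (L : E →L[ℝ] E) a) :
    ∃ e : OpenPartialHomeomorph E E, ⇑e = Φ ∧ a ∈ e.source ∧ ContDiffOn ℝ ∞ e.symm e.target := by
  let e₀ := hΦ.contDiffAt.toOpenPartialHomeomorph Φ hL (by simp)
  have hcoe : ⇑e₀ = Φ := hΦ.contDiffAt.toOpenPartialHomeomorph_coe hL (by simp)
  have hfd : Continuous (fderiv ℝ Φ) := hΦ.continuous_fderiv (by simp)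
  let U : Set E := fderiv ℝ Φ ⁻¹' range ((↑) : (E ≃L[ℝ] E) → E →L[ℝ] E)
  have hU : IsOpen U := ContinuousLinearEquiv.isOpen.preimage hfd
  refine ⟨e₀.restrOpen U hU, hcoe, ?_, ?_⟩
  · rw [OpenPartialHomeomorph.restrOpen_source]
    exact ⟨hΦ.contDiffAt.mem_toOpenPartialHomeomorph_source hL (by simp), L, hL.fderiv.symm⟩
  · intro y hy
    have hs := (e₀.restrOpen U hU).map_target hy
    rw [OpenPartialHomeomorph.restrOpen_source] at hs
    obtain ⟨M, hM⟩ := hs.2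
    refine ContDiffAt.contDiffWithinAt ?_
    refine OpenPartialHomeomorph.contDiffAt_symm (e₀.restrOpen U hU) hy (f₀' := M) ?_ ?_
    · rw [hM]
      exact (hΦ.differentiable (by simp) _).hasFDerivAt
    · exact hΦ.contDiffAt

/-- A function that is smooth near `0` agrees near `0` with a globally smooth function. -/
theorem exists_contDiff_eventuallyEq {E G : Type*} [NormedAddCommGroup E] [NormedSpace ℝ E]
    [FiniteDimensional ℝ E] [NormedAddCommGroup G] [NormedSpace ℝ G] {f : E → G} {s : Set E}
    (hs : s ∈ 𝓝 (0 : E)) (hso : IsOpen s) (hf : ContDiffOn ℝ ∞ f s) :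
    ∃ g : E → G, ContDiff ℝ ∞ g ∧ g =ᶠ[𝓝 0] f := by
  obtain ⟨r, hr, hrs⟩ := Metric.nhds_basis_closedBall.mem_iff.1 hs
  let χ : ContDiffBump (0 : E) := ⟨r / 2, r, by positivity, by linarith⟩
  refine ⟨fun x => χ x • f x, ?_, ?_⟩
  · refine contDiff_iff_contDiffAt.2 fun x => ?_
    by_cases hx : x ∈ s
    · exact (χ.contDiff.contDiffAt).smul (hf.contDiffAt (hso.mem_nhds hx))
    · have : x ∉ tsupport χ := fun h => hx (hrs (by rwa [χ.tsupport_eq] at h))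
      have h0 : (fun y => χ y • f y) =ᶠ[𝓝 x] fun _ => 0 := by
        filter_upwards [notMem_tsupport_iff_eventuallyEq.1 this] with y hy
        simp [hy]
      exact contDiffAt_const.congr_of_eventuallyEq h0
  · filter_upwards [χ.eventuallyEq_one] with x hx
    simp [hx]

/-- The implicit function theorem for an equation `F (u, k) = 0` whose zero set is invariant under
`(u, k) ↦ (σ u, -k)`, `σ = ±1`. The solution has the corresponding parity and is extended to a
smooth function on the whole space. -/
theorem exists_implicit_parity {U V : Type*} [NormedAddCommGroup U] [NormedSpace ℝ U]
    [FiniteDimensional ℝ U] [NormedAddCommGroup V] [NormedSpace ℝ V] [FiniteDimensional ℝ V]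
    {F : U × V → U} (hF : ContDiff ℝ ∞ F) {u₀ : U} (h0 : F (u₀, 0) = 0) (L : U ≃L[ℝ] U)
    (hL : HasFDerivAt (fun u => F (u, 0)) (L : U →L[ℝ] U) u₀) {σ : ℝ} (hσ : σ = 1 ∨ σ = -1)
    (hσu : σ • u₀ = u₀) (hsym : ∀ u k, F (u, k) = 0 → F (σ • u, -k) = 0) :
    ∃ ψ : V → U, ContDiff ℝ ∞ ψ ∧ (∀ k, ψ (-k) = σ • ψ k) ∧ ψ 0 = u₀ ∧
      ∀ᶠ k in 𝓝 0, F (ψ k, k) = 0 := by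
  have := FiniteDimensional.complete ℝ U
  have := FiniteDimensional.complete ℝ V
  let Φ : U × V → U × V := fun p => (F p, p.2)
  have hΦ : ContDiff ℝ ∞ Φ := hF.prodMk contDiff_snd
  -- the derivative of `(u, k) ↦ (F (u, k), k)` is block triangular
  let D := fderiv ℝ F (u₀, 0)
  have hD : HasFDerivAt F D (u₀, 0) := (hF.differentiable (by simp) _).hasFDerivAt
  have hDL : D.comp (ContinuousLinearMap.inl ℝ U V) = L :=
    (hD.comp u₀ (hasFDerivAt_prodMk_left u₀ (0 : V))).unique hL
  have hDu : ∀ u, D (u, 0) = L u := fun u => by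
    have := congrArg (fun T : U →L[ℝ] U => T u) hDL
    simpa using this
  let T : U × V →ₗ[ℝ] U × V := (D.prod (ContinuousLinearMap.snd ℝ U V) : U × V →L[ℝ] U × V)
  have hTinj : Function.Injective T := by
    rw [← LinearMap.ker_eq_bot, LinearMap.ker_eq_bot']
    rintro ⟨u, v⟩ h
    have h1 : v = 0 := congrArg Prod.snd h
    subst h1
    have h2 : D (u, 0) = 0 := congrArg Prod.fst h
    rw [hDu] at h2
    simpa using h2
  let Te : (U × V) ≃L[ℝ] (U × V) := (LinearEquiv.ofInjectiveEndo T hTinj).toContinuousLinearEquiv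
  have hTe : (Te : U × V →L[ℝ] U × V) = D.prod (ContinuousLinearMap.snd ℝ U V) := by
    ext x <;> rfl
  obtain ⟨e, heΦ, hmem, hsymm⟩ := exists_smooth_localInverse hΦ Te (a := (u₀, 0)) (by
    rw [hTe]; exact hD.prodMk hasFDerivAt_snd)
  have hΦ0 : Φ (u₀, 0) = (0, 0) := by simp [Φ, h0]
  have hopen : IsOpen {k : V | ((0 : U), k) ∈ e.target} :=
    e.open_target.preimage (by fun_prop : Continuous fun k : V => ((0 : U), k))
  have h0t : ((0 : U), (0 : V)) ∈ e.target := by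
    have := e.map_source hmem
    rwa [heΦ, hΦ0] at this
  obtain ⟨ψ, hψ, hψe⟩ := exists_contDiff_eventuallyEq (f := fun k : V => (e.symm (0, k)).1)
    (hopen.mem_nhds h0t) hopen
    (contDiff_fst.comp_contDiffOn (hsymm.comp (contDiff_const.prodMk contDiff_id).contDiffOn
      fun k hk => hk))
  have hsol : ∀ᶠ k in 𝓝 (0 : V), F (ψ k, k) = 0 := by
    filter_upwards [hψe, hopen.mem_nhds h0t] with k hk hkt
    have h1 : Φ (e.symm (0, k)) = (0, k) := by rw [← heΦ]; exact e.right_inv hkt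
    have h2 : (e.symm (0, k)).2 = k := congrArg Prod.snd h1
    have h3 : e.symm (0, k) = (ψ k, k) := Prod.ext (by rw [hk]) h2
    have := congrArg Prod.fst h1
    rw [h3] at this
    exact this
  have hψ0 : ψ 0 = u₀ := by
    rw [hψe.eq_of_nhds]
    have : e.symm (0, 0) = (u₀, 0) := by
      rw [← hΦ0, ← heΦ]; exact e.left_inv hmem
    simp [this]
  -- local uniqueness gives the parity near `0`
  have hpar : ∀ᶠ k in 𝓝 (0 : V), ψ (-k) = σ • ψ k := by
    have hneg : Tendsto (fun k : V => -k) (𝓝 0) (𝓝 0) := by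
      simpa using (continuous_neg (G := V)).tendsto 0
    have c1 : Tendsto (fun k : V => (ψ (-k), -k)) (𝓝 0) (𝓝 (u₀, 0)) := by
      have : Continuous fun k : V => (ψ (-k), -k) := by
        have := hψ.continuous; fun_prop
      simpa [hψ0] using this.tendsto 0
    have c2 : Tendsto (fun k : V => (σ • ψ k, -k)) (𝓝 0) (𝓝 (u₀, 0)) := by
      have : Continuous fun k : V => (σ • ψ k, -k) := by
        have := hψ.continuous; fun_prop
      simpa [hψ0, hσu] using this.tendsto 0
    filter_upwards [hsol, hneg.eventually hsol, c1.eventually (e.open_source.mem_nhds hmem),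
      c2.eventually (e.open_source.mem_nhds hmem)] with k h1 h2 h3 h4
    have : e (ψ (-k), -k) = e (σ • ψ k, -k) := by
      rw [heΦ]
      simp [Φ, h2, hsym _ _ h1]
    exact congrArg Prod.fst (e.injOn h3 h4 this)
  have hσσ : σ * σ = 1 := by rcases hσ with rfl | rfl <;> norm_num
  have heq : ∀ᶠ k in 𝓝 (0 : V), (1 / 2 : ℝ) • (ψ k + σ • ψ (-k)) = ψ k := by
    filter_upwards [hpar] with k hk
    rw [hk, smul_smul, hσσ, one_smul, ← two_smul ℝ, smul_smul]
    norm_num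
  refine ⟨fun k => (1 / 2 : ℝ) • (ψ k + σ • ψ (-k)), ?_, ?_, ?_, ?_⟩
  · fun_prop
  · intro k
    simp only [neg_neg, smul_add, smul_smul]
    rw [show σ * (1 / 2 * σ) = 1 / 2 by linear_combination (1 / 2) * hσσ, mul_comm σ, add_comm]
  · exact heq.self_of_nhds.trans hψ0
  · filter_upwards [heq, hsol] with k h1 h2
    rw [h1, h2]

/-! ### Germs related by odd coordinate changes -/

/-- The germs at `0` of `f` and `g` differ by the substitution of a smooth odd map with invertible
derivative at `0`. In contrast to `OddEquiv`, the map is defined on the whole space. -/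
def OddGerm {n : ℕ} (f g : Coord n → ℝ) : Prop :=
  ∃ Φ : Coord n → Coord n, ContDiff ℝ ∞ Φ ∧ (∀ k, Φ (-k) = -Φ k) ∧
    (∃ L : Coord n ≃L[ℝ] Coord n, HasFDerivAt Φ (L : Coord n →L[ℝ] Coord n) 0) ∧
    f =ᶠ[𝓝 0] g ∘ Φ

theorem map_zero_of_odd {E G : Type*} [AddCommGroup E] [AddCommGroup G] [Module ℝ G] {Φ : E → G}
    (h : ∀ k, Φ (-k) = -Φ k) : Φ 0 = 0 := by
  have h1 : Φ 0 = -Φ 0 := by simpa using h 0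
  have h2 : (2 : ℝ) • Φ 0 = 0 := by
    rw [two_smul]
    nth_rewrite 2 [h1]
    exact add_neg_cancel _
  exact (smul_eq_zero.1 h2).resolve_left two_ne_zero

theorem OddGerm.trans {n : ℕ} {f g h : Coord n → ℝ} (hfg : OddGerm f g) (hgh : OddGerm g h) :
    OddGerm f h := by
  obtain ⟨Φ, hΦ, hΦo, ⟨L, hL⟩, he⟩ := hfg
  obtain ⟨Ψ, hΨ, hΨo, ⟨M, hM⟩, he'⟩ := hgh
  have h0 : Φ 0 = 0 := map_zero_of_odd hΦo
  refine ⟨Ψ ∘ Φ, hΨ.comp hΦ, fun k => by simp [hΦo, hΨo], ⟨L.trans M, ?_⟩, ?_⟩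
  · exact HasFDerivAt.comp (0 : Coord n) (by rw [h0]; exact hM) hL
  · have ht : Tendsto Φ (𝓝 0) (𝓝 0) := by
      simpa [h0] using hΦ.continuous.tendsto 0
    filter_upwards [he, ht.eventually he'] with k h1 h2
    rw [h1, Function.comp_apply, h2]
    rfl

theorem OddGerm.oddEquiv {n : ℕ} {f g : Coord n → ℝ} (hfg : OddGerm f g) : OddEquiv f g := by
  obtain ⟨Φ, hΦ, hΦo, ⟨L, hL⟩, he⟩ := hfg
  obtain ⟨e, rfl, hmem, hsymm⟩ := exists_smooth_localInverse hΦ L hL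
  obtain ⟨r, hr, hball⟩ := Metric.eventually_nhds_iff_ball.1
    (he.and (e.open_source.mem_nhds hmem))
  refine ⟨e.restrOpen (Metric.ball 0 r) Metric.isOpen_ball, ?_, ?_, hΦ.contDiffOn, ?_, ?_⟩
  · exact ⟨hmem, Metric.mem_ball_self hr⟩
  · rintro x ⟨-, hx⟩
    have hx' : -x ∈ Metric.ball (0 : Coord n) r := by simpa using hx
    exact ⟨⟨(hball _ hx').2, hx'⟩, hΦo x⟩
  · refine hsymm.mono fun y hy => ?_
    exact hy.1
  · rintro x ⟨-, hx⟩
    exact (hball x hx).1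

/-! ### Division of even and odd functions of two variables -/

/-- An odd smooth function of two variables lies in the ideal `(x, y)`, with even coefficients. -/
theorem exists_division_odd {h : ℝ × ℝ → ℝ} (hh : ContDiff ℝ ∞ h) (ho : ∀ p, h (-p) = -h p) :
    ∃ a b : ℝ × ℝ → ℝ, ContDiff ℝ ∞ a ∧ ContDiff ℝ ∞ b ∧ (∀ p, a (-p) = a p) ∧
      (∀ p, b (-p) = b p) ∧ ∀ p, h p = p.1 * a p + p.2 * b p := by
  obtain ⟨L, hL, hLe, -⟩ := exists_hadamard hh 0 (by simp)
  have h0 : h 0 = 0 := map_zero_of_odd ho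
  have key : ∀ p, h p = p.1 * L p (1, 0) + p.2 * L p (0, 1) := by
    intro p
    rw [hLe p]
    have : p = p.1 • ((1 : ℝ), (0 : ℝ)) + p.2 • ((0 : ℝ), (1 : ℝ)) := by ext <;> simp
    simp only [zero_apply, sub_zero, h0, zero_add]
    nth_rewrite 2 [this]
    simp only [map_add, map_smul, smul_eq_mul]
  refine ⟨fun p => (L p (1, 0) + L (-p) (1, 0)) / 2, fun p => (L p (0, 1) + L (-p) (0, 1)) / 2,
    by fun_prop, by fun_prop, fun p => by simp [add_comm], fun p => by simp [add_comm],
    fun p => ?_⟩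
  have h1 := key p
  have h2 := key (-p)
  rw [ho p] at h2
  simp only [Prod.fst_neg, Prod.snd_neg] at h2
  linear_combination h1 / 2 - h2 / 2

/-- An even smooth function of two variables that vanishes at `0` lies in the ideal `(x, y)²`,
with even coefficients. -/
theorem exists_division_even {h : ℝ × ℝ → ℝ} (hh : ContDiff ℝ ∞ h) (he : ∀ p, h (-p) = h p)
    (h0 : h 0 = 0) :
    ∃ a b c : ℝ × ℝ → ℝ, ContDiff ℝ ∞ a ∧ ContDiff ℝ ∞ b ∧ ContDiff ℝ ∞ c ∧
      (∀ p, a (-p) = a p) ∧ (∀ p, b (-p) = b p) ∧ (∀ p, c (-p) = c p) ∧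
      ∀ p, h p = p.1 ^ 2 * a p + p.1 * p.2 * b p + p.2 ^ 2 * c p := by
  obtain ⟨L, hL, hLe, -⟩ := exists_hadamard hh 0 (by simp)
  have key : ∀ p, h p = p.1 * L p (1, 0) + p.2 * L p (0, 1) := by
    intro p
    rw [hLe p]
    have : p = p.1 • ((1 : ℝ), (0 : ℝ)) + p.2 • ((0 : ℝ), (1 : ℝ)) := by ext <;> simp
    simp only [zero_apply, sub_zero, h0, zero_add]
    nth_rewrite 2 [this]
    simp only [map_add, map_smul, smul_eq_mul]
  obtain ⟨a, b, ha, hb, hae, hbe, hab⟩ := exists_division_odd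
    (h := fun p => (L p (1, 0) - L (-p) (1, 0)) / 2) (by fun_prop)
    (fun p => by simp only [neg_neg]; ring)
  obtain ⟨c, d, hc, hd, hce, hde, hcd⟩ := exists_division_odd
    (h := fun p => (L p (0, 1) - L (-p) (0, 1)) / 2) (by fun_prop)
    (fun p => by simp only [neg_neg]; ring)
  refine ⟨a, fun p => b p + c p, d, ha, by fun_prop, hd, hae, fun p => by simp [hbe, hce], hde,
    fun p => ?_⟩
  have h1 := key p
  have h2 := key (-p)
  rw [he p] at h2
  simp only [Prod.fst_neg, Prod.snd_neg] at h2
  have h3 := hab p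
  have h4 := hcd p
  linear_combination h1 / 2 + h2 / 2 + p.1 * h3 + p.2 * h4

/-! ### Partial derivatives at the origin -/

theorem contDiff_pderivCoord {n : ℕ} {f : Coord n → ℝ} (hf : ContDiff ℝ ∞ f) (i : Fin (n + 2)) :
    ContDiff ℝ ∞ (pderivCoord i f) :=
  (hf.fderiv_right (m := ∞) (by simp)).clm_apply contDiff_const

theorem pderivCoord_pderivCoord {n : ℕ} {f : Coord n → ℝ} (hf : ContDiff ℝ ∞ f)
    (i j : Fin (n + 2)) (x : Coord n) :
    pderivCoord i (pderivCoord j f) x =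
      fderiv ℝ (fderiv ℝ f) x (Pi.single i 1) (Pi.single j 1) := by
  have h1 : DifferentiableAt ℝ (fderiv ℝ f) x :=
    (hf.fderiv_right (m := ∞) (by simp)).differentiable (by simp) _
  have h2 := (h1.hasFDerivAt.clm_apply
    (hasFDerivAt_const (Pi.single j (1 : ℝ) : Coord n) x)).fderiv
  change fderiv ℝ (fun y => fderiv ℝ f y (Pi.single j 1)) x (Pi.single i 1) = _
  rw [h2]
  simp

theorem pderivCoord_comm {n : ℕ} {f : Coord n → ℝ} (hf : ContDiff ℝ ∞ f) (i j : Fin (n + 2)) :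
    pderivCoord i (pderivCoord j f) = pderivCoord j (pderivCoord i f) := by
  ext x
  rw [pderivCoord_pderivCoord hf, pderivCoord_pderivCoord hf]
  exact (hf.contDiffAt.isSymmSndFDerivAt (by
    simpa using (WithTop.coe_le_coe.2 (le_top : (2 : ℕ∞) ≤ ⊤) : ((2 : ℕ∞) : ℕ∞ω) ≤ _))) _ _

theorem contDiff_iterate_pderivCoord {n : ℕ} {f : Coord n → ℝ} (hf : ContDiff ℝ ∞ f)
    (i : Fin (n + 2)) (m : ℕ) : ContDiff ℝ ∞ ((pderivCoord i)^[m] f) := by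
  induction m generalizing f with
  | zero => exact hf
  | succ m ih => exact ih (contDiff_pderivCoord hf i)

theorem iterate_pderivCoord_comm {n : ℕ} {f : Coord n → ℝ} (hf : ContDiff ℝ ∞ f)
    (i j : Fin (n + 2)) (m : ℕ) :
    (pderivCoord i)^[m] (pderivCoord j f) = pderivCoord j ((pderivCoord i)^[m] f) := by
  induction m generalizing f with
  | zero => rfl
  | succ m ih =>
    rw [Function.iterate_succ_apply, Function.iterate_succ_apply, pderivCoord_comm hf,
      ih (contDiff_pderivCoord hf i)]

/-- The iterated derivative along a list of coordinates, with multiplicities `α`. -/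
def pdList {n : ℕ} (α : Fin (n + 2) → ℕ) (l : List (Fin (n + 2))) (f : Coord n → ℝ) :
    Coord n → ℝ :=
  l.foldr (fun i g => (pderivCoord i)^[α i] g) f

theorem contDiff_pdList {n : ℕ} {f : Coord n → ℝ} (hf : ContDiff ℝ ∞ f)
    (α : Fin (n + 2) → ℕ) (l : List (Fin (n + 2))) : ContDiff ℝ ∞ (pdList α l f) := by
  induction l with
  | nil => exact hf
  | cons i l ih => exact contDiff_iterate_pderivCoord ih i _

theorem pdList_pderivCoord {n : ℕ} {f : Coord n → ℝ} (hf : ContDiff ℝ ∞ f)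
    (α : Fin (n + 2) → ℕ) (l : List (Fin (n + 2))) (j : Fin (n + 2)) :
    pdList α l (pderivCoord j f) = pderivCoord j (pdList α l f) := by
  induction l with
  | nil => rfl
  | cons i l ih =>
    change (pderivCoord i)^[α i] (pdList α l (pderivCoord j f)) = _
    rw [ih, iterate_pderivCoord_comm (contDiff_pdList hf α l)]
    rfl

theorem pdList_congr {n : ℕ} {f : Coord n → ℝ} {α β : Fin (n + 2) → ℕ} {l : List (Fin (n + 2))}
    (h : ∀ i ∈ l, α i = β i) : pdList α l f = pdList β l f := by
  induction l with
  | nil => rfl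
  | cons i l ih =>
    change (pderivCoord i)^[α i] (pdList α l f) = (pderivCoord i)^[β i] (pdList β l f)
    rw [ih fun k hk => h k (List.mem_cons_of_mem _ hk), h i List.mem_cons_self]

theorem pdList_add_single {n : ℕ} {f : Coord n → ℝ} (hf : ContDiff ℝ ∞ f)
    (α : Fin (n + 2) → ℕ) {l : List (Fin (n + 2))} (hl : l.Nodup) {j : Fin (n + 2)}
    (hj : j ∈ l) : pdList (α + Pi.single j 1) l f = pdList α l (pderivCoord j f) := by
  induction l with
  | nil => simp at hj
  | cons i l ih =>
    rw [List.nodup_cons] at hl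
    change (pderivCoord i)^[(α + Pi.single j 1 : Fin (n + 2) → ℕ) i] (pdList (α + Pi.single j 1) l f) =
      (pderivCoord i)^[α i] (pdList α l (pderivCoord j f))
    by_cases hij : j = i
    · subst hij
      rw [pdList_congr (β := α), pdList_pderivCoord hf]
      · simp
      · intro k hk
        have : k ≠ j := fun h => hl.1 (h ▸ hk)
        simp [this]
    · rw [ih hl.2 ((List.mem_cons.1 hj).resolve_left hij)]
      have : i ≠ j := fun h => hij h.symm
      simp [this]

theorem pd_pderivCoord {n : ℕ} {f : Coord n → ℝ} (hf : ContDiff ℝ ∞ f) (j : Fin (n + 2))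
    (α : Fin (n + 2) → ℕ) : pd (pderivCoord j f) α = pd f (α + Pi.single j 1) :=
  congrFun (pdList_add_single hf α (List.nodup_finRange _) (List.mem_finRange j)).symm 0

theorem jet_pderiv_x {n : ℕ} {f : Coord n → ℝ} (hf : ContDiff ℝ ∞ f) (a b : ℕ)
    (l : List (Fin n)) : jet (pderivCoord 0 f) a b l = jet f (a + 1) b l := by
  rw [jet, pd_pderivCoord hf, jet]
  congr 1
  ext i
  refine Fin.cases ?_ (fun i => Fin.cases ?_ (fun i => ?_) i) i <;> simp [multiIdx, Fin.succ_ne_zero]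

theorem jet_pderiv_y {n : ℕ} {f : Coord n → ℝ} (hf : ContDiff ℝ ∞ f) (a b : ℕ)
    (l : List (Fin n)) : jet (pderivCoord 1 f) a b l = jet f a (b + 1) l := by
  rw [jet, pd_pderivCoord hf, jet]
  congr 1
  ext i
  refine Fin.cases ?_ (fun i => Fin.cases ?_ (fun i => ?_) i) i
  · simp [multiIdx]
  · simp [multiIdx]
  · have : (i.succ.succ : Fin (n + 2)) ≠ 1 := fun h => by
      rw [← Fin.succ_zero_eq_one] at h
      exact Fin.succ_ne_zero _ (Fin.succ_injective _ h)
    simp [multiIdx, this]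

theorem jet_pderiv_z {n : ℕ} {f : Coord n → ℝ} (hf : ContDiff ℝ ∞ f) (a b : ℕ) (j : Fin n)
    (l : List (Fin n)) : jet (pderivCoord j.succ.succ f) a b l = jet f a b (j :: l) := by
  rw [jet, pd_pderivCoord hf, jet]
  congr 1
  ext i
  refine Fin.cases ?_ (fun i => Fin.cases ?_ (fun i => ?_) i) i
  · simp [multiIdx, (Fin.succ_ne_zero _).symm]
  · have : (1 : Fin (n + 2)) ≠ j.succ.succ := fun h => by
      rw [← Fin.succ_zero_eq_one] at h
      exact Fin.succ_ne_zero _ (Fin.succ_injective _ h.symm)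
    simp [multiIdx, this]
  · by_cases hij : i = j
    · subst hij; simp [multiIdx]
    · have : i.succ.succ ≠ j.succ.succ := by simpa using hij
      simp [multiIdx, this, List.count_cons, Ne.symm hij]

theorem jet_zero {n : ℕ} (f : Coord n → ℝ) : jet f 0 0 [] = f 0 := by
  have h : ∀ l : List (Fin (n + 2)), pdList (multiIdx 0 0 []) l f = f := by
    intro l
    induction l with
    | nil => rfl
    | cons i l ih =>
      change (pderivCoord i)^[multiIdx 0 0 [] i] (pdList (multiIdx 0 0 []) l f) = f
      rw [ih]
      have : multiIdx (n := n) 0 0 [] i = 0 := by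
        refine Fin.cases ?_ (fun i => Fin.cases ?_ (fun i => ?_) i) i <;> simp [multiIdx]
      rw [this]; rfl
  exact congrFun (h _) 0

theorem jet_perm {n : ℕ} (f : Coord n → ℝ) (a b : ℕ) {l l' : List (Fin n)} (h : l.Perm l') :
    jet f a b l = jet f a b l' := by
  have : multiIdx a b l = multiIdx a b l' := by
    simp only [multiIdx, h.count_eq]
  rw [jet, this, jet]

theorem pderivCoord_neg {n : ℕ} {f : Coord n → ℝ} {σ : ℝ} (hf : ContDiff ℝ ∞ f)
    (h : ∀ k, f (-k) = σ * f k) (i : Fin (n + 2)) (k : Coord n) :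
    pderivCoord i f (-k) = -σ * pderivCoord i f k := by
  have h1 : fderiv ℝ (fun k => f (-k)) k = -fderiv ℝ f (-k) := by
    have h3 : HasFDerivAt f (fderiv ℝ f (-k)) (-k) := (hf.differentiable (by simp) _).hasFDerivAt
    have h4 := (h3.comp k (hasFDerivAt_id k).neg).fderiv
    ext v
    simpa [Function.comp_def] using congrArg (fun T : Coord n →L[ℝ] ℝ => T v) h4
  have h2 : (fun k => f (-k)) = fun k => σ * f k := funext h
  rw [h2, fderiv_const_mul (hf.differentiable (by simp) _)] at h1
  have := congrArg (fun T : Coord n →L[ℝ] ℝ => T (Pi.single i 1)) h1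
  simp only [smul_apply, neg_apply, smul_eq_mul] at this
  simp only [pderivCoord]
  linarith

/-- The partial derivatives at the origin of an odd or even function vanish when their order has the
opposite parity. -/
theorem jet_eq_zero_of_parity {n : ℕ} (l : List (Fin n)) : ∀ (a b : ℕ) {f : Coord n → ℝ} {σ : ℝ},
    ContDiff ℝ ∞ f → (∀ k, f (-k) = σ * f k) → (-1) ^ (a + b + l.length) * σ = -1 →
    jet f a b l = 0 := by
  induction l with
  | nil =>
    intro a
    induction a with
    | zero =>
      intro b
      induction b with
      | zero =>
        intro f σ hf h hσ
        have h0 := h 0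
        simp only [add_zero, List.length_nil, pow_zero, one_mul] at hσ
        rw [hσ, neg_zero] at h0
        rw [jet_zero]
        linarith
      | succ b ih =>
        intro f σ hf h hσ
        rw [← jet_pderiv_y hf]
        refine ih (contDiff_pderivCoord hf 1) (σ := -σ) (pderivCoord_neg hf h 1) ?_
        exact Eq.trans (by simp only [List.length_nil]; ring) hσ
    | succ a ih =>
      intro b f σ hf h hσ
      rw [← jet_pderiv_x hf]
      refine ih b (contDiff_pderivCoord hf 0) (σ := -σ) (pderivCoord_neg hf h 0) ?_
      exact Eq.trans (by simp only [List.length_nil]; ring) hσ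
  | cons i l ih =>
    intro a b f σ hf h hσ
    rw [← jet_pderiv_z hf]
    refine ih a b (contDiff_pderivCoord hf _) (σ := -σ) (pderivCoord_neg hf h _) ?_
    exact Eq.trans (by simp only [List.length_cons]; ring) hσ

/-- The partial derivatives of odd order of an even function vanish at the origin. -/
theorem jet_eq_zero_of_odd {n : ℕ} {f : Coord n → ℝ} (hf : ContDiff ℝ ∞ f)
    (he : ∀ k, f (-k) = f k) {a b : ℕ} {l : List (Fin n)} (h : Odd (a + b + l.length)) :
    jet f a b l = 0 :=
  jet_eq_zero_of_parity l a b hf (σ := 1) (by simpa using he) (by simp [h.neg_one_pow])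

/-! ### Taylor's formula -/

/-- The contraction `∑ G [i₁, …, i_c] z_{i₁} ⋯ z_{i_c}` of a family indexed by lists with the
`c`-th power of a vector. -/
def contr {R : Type*} [CommSemiring R] {n : ℕ} : ℕ → (List (Fin n) → R) → (Fin n → R) → R
  | 0, G, _ => G []
  | c + 1, G, z => ∑ i, z i * contr c (fun l => G (i :: l)) z

/-- The part of a Taylor series with coefficients `G a b [i₁, …, i_c]` (at `x^a y^b z^c`) that is
indexed by the triples `(a, b, c)` in `S`. -/
def taylorSum {R : Type*} [CommRing R] [Algebra ℚ R] {n : ℕ} (S : Finset (ℕ × ℕ × ℕ))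
    (G : ℕ → ℕ → List (Fin n) → R) (x y : R) (z : Fin n → R) : R :=
  ∑ s ∈ S, algebraMap ℚ R (1 / (s.1.factorial * s.2.1.factorial * s.2.2.factorial)) *
    (x ^ s.1 * y ^ s.2.1 * contr s.2.2 (G s.1 s.2.1) z)

/-- The exponents `(a, b, c)` of total degree less than `L`. -/
def degSet (L : ℕ) : Finset (ℕ × ℕ × ℕ) :=
  (Finset.range L ×ˢ Finset.range L ×ˢ Finset.range L).filter fun s => s.1 + s.2.1 + s.2.2 < L

theorem mem_degSet {L : ℕ} {s : ℕ × ℕ × ℕ} : s ∈ degSet L ↔ s.1 + s.2.1 + s.2.2 < L := by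
  simp only [degSet, Finset.mem_filter, Finset.mem_product, Finset.mem_range]
  omega

/-- The last `n` coordinates. -/
def zpart {n : ℕ} (k : Coord n) : Fin n → ℝ := fun i => k i.succ.succ

/-- For a symmetric family `G`, the derivative of its contraction with the powers of `t v` is
`c + 1` times a contraction of the family with one index fixed. -/
theorem hasDerivAt_contr {n : ℕ} (c : ℕ) : ∀ {G : List (Fin n) → ℝ}
    (_ : ∀ l l', l.Perm l' → G l = G l') (v : Fin n → ℝ) (t : ℝ),
    HasDerivAt (fun t : ℝ => contr (c + 1) G (t • v))
      ((c + 1 : ℕ) * ∑ i, v i * contr c (fun l => G (i :: l)) (t • v)) t := by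
  induction c with
  | zero =>
    intro G hG v t
    have : (fun t : ℝ => contr 1 G (t • v)) = fun t => t * ∑ i, v i * G [i] := by
      ext t; simp [contr, Finset.mul_sum, mul_assoc]
    simp only [zero_add, this]
    simpa [contr] using (hasDerivAt_id t).mul_const (∑ i, v i * G [i])
  | succ c ih =>
    intro G hG v t
    have hG' : ∀ i, ∀ l l', l.Perm l' → G (i :: l) = G (i :: l') := fun i l l' h =>
      hG _ _ (h.cons i)
    have h1 : ∀ i, HasDerivAt (fun t : ℝ => (t • v) i * contr (c + 1) (fun l => G (i :: l)) (t • v))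
        (v i * contr (c + 1) (fun l => G (i :: l)) (t • v) + (t • v) i *
          ((c + 1 : ℕ) * ∑ j, v j * contr c (fun l => G (i :: j :: l)) (t • v))) t := by
      intro i
      have h2 : HasDerivAt (fun t : ℝ => (t • v) i) (v i) t := by
        simpa using (hasDerivAt_id t).mul_const (v i)
      exact h2.mul (ih (hG' i) v t)
    have h3 := HasDerivAt.fun_sum (u := Finset.univ) fun i _ => h1 i
    change HasDerivAt (fun t : ℝ => ∑ i, (t • v) i * contr (c + 1) (fun l => G (i :: l)) (t • v))
      _ t
    refine h3.congr_deriv ?_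
    rw [Finset.sum_add_distrib]
    have h4 : ∑ i, (t • v) i *
          (((c + 1 : ℕ) : ℝ) * ∑ j, v j * contr c (fun l => G (i :: j :: l)) (t • v)) =
        (c + 1 : ℕ) * ∑ j, v j * contr (c + 1) (fun l => G (j :: l)) (t • v) := by
      simp only [contr, Finset.mul_sum]
      rw [Finset.sum_comm]
      refine Finset.sum_congr rfl fun j _ => Finset.sum_congr rfl fun i _ => ?_
      have : (fun l => G (i :: j :: l)) = fun l => G (j :: i :: l) :=
        funext fun l => hG _ _ (List.Perm.swap j i l)
      rw [this]; ring
    rw [h4]; push_cast; ring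

/-- The Taylor polynomial of `f` at the origin of degree less than `L`. -/
def taylorPoly {n : ℕ} (L : ℕ) (f : Coord n → ℝ) (k : Coord n) : ℝ :=
  taylorSum (degSet L) (jet f) (k 0) (k 1) (zpart k)

theorem sum_degSet_succ_x {L : ℕ} (D : ℕ × ℕ × ℕ → ℝ) (h : ∀ b c, D (0, b, c) = 0) :
    ∑ s ∈ degSet (L + 1), D s = ∑ s ∈ degSet L, D (s.1 + 1, s.2.1, s.2.2) := by
  symm
  refine Finset.sum_of_injOn (fun s => (s.1 + 1, s.2.1, s.2.2)) ?_ ?_ ?_ (fun _ _ => rfl)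
  · rintro ⟨a, b, c⟩ - ⟨a', b', c'⟩ -; simp
  · rintro ⟨a, b, c⟩; simp only [Finset.mem_coe, mem_degSet]; omega
  · rintro ⟨a, b, c⟩ hs hn
    rcases a with _ | a
    · exact h b c
    · exact absurd ⟨(a, b, c), by simp only [Finset.mem_coe, mem_degSet] at hs ⊢; omega, rfl⟩ hn

theorem sum_degSet_succ_y {L : ℕ} (D : ℕ × ℕ × ℕ → ℝ) (h : ∀ a c, D (a, 0, c) = 0) :
    ∑ s ∈ degSet (L + 1), D s = ∑ s ∈ degSet L, D (s.1, s.2.1 + 1, s.2.2) := by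
  symm
  refine Finset.sum_of_injOn (fun s => (s.1, s.2.1 + 1, s.2.2)) ?_ ?_ ?_ (fun _ _ => rfl)
  · rintro ⟨a, b, c⟩ - ⟨a', b', c'⟩ -; simp
  · rintro ⟨a, b, c⟩; simp only [Finset.mem_coe, mem_degSet]; omega
  · rintro ⟨a, b, c⟩ hs hn
    rcases b with _ | b
    · exact h a c
    · exact absurd ⟨(a, b, c), by simp only [Finset.mem_coe, mem_degSet] at hs ⊢; omega, rfl⟩ hn

theorem sum_degSet_succ_z {L : ℕ} (D : ℕ × ℕ × ℕ → ℝ) (h : ∀ a b, D (a, b, 0) = 0) :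
    ∑ s ∈ degSet (L + 1), D s = ∑ s ∈ degSet L, D (s.1, s.2.1, s.2.2 + 1) := by
  symm
  refine Finset.sum_of_injOn (fun s => (s.1, s.2.1, s.2.2 + 1)) ?_ ?_ ?_ (fun _ _ => rfl)
  · rintro ⟨a, b, c⟩ - ⟨a', b', c'⟩ -; simp
  · rintro ⟨a, b, c⟩; simp only [Finset.mem_coe, mem_degSet]; omega
  · rintro ⟨a, b, c⟩ hs hn
    rcases c with _ | c
    · exact h a b
    · exact absurd ⟨(a, b, c), by simp only [Finset.mem_coe, mem_degSet] at hs ⊢; omega, rfl⟩ hn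

/-- Along a line through the origin the derivative of a Taylor polynomial is given by the Taylor
polynomials of the partial derivatives. -/
theorem hasDerivAt_taylorPoly {n : ℕ} {f : Coord n → ℝ} (hf : ContDiff ℝ ∞ f) (L : ℕ)
    (k : Coord n) (t : ℝ) :
    HasDerivAt (fun t : ℝ => taylorPoly (L + 1) f (t • k))
      (∑ i, k i * taylorPoly L (pderivCoord i f) (t • k)) t := by
  have hcontr : ∀ a b c, HasDerivAt (fun t : ℝ => contr c (jet f a b) (t • zpart k))
      (c * ∑ i, zpart k i * contr (c - 1) (fun l => jet f a b (i :: l)) (t • zpart k)) t := by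
    intro a b c
    rcases c with _ | c
    · simpa [contr] using hasDerivAt_const t (jet f a b [])
    · exact hasDerivAt_contr c (fun l l' h => jet_perm f a b h) (zpart k) t
  have hx : HasDerivAt (fun t : ℝ => t * k 0) (k 0) t := by
    simpa using (hasDerivAt_id t).mul_const (k 0)
  have hy : HasDerivAt (fun t : ℝ => t * k 1) (k 1) t := by
    simpa using (hasDerivAt_id t).mul_const (k 1)
  have hterm := fun s : ℕ × ℕ × ℕ => (((hx.pow s.1).mul (hy.pow s.2.1)).mul
    (hcontr s.1 s.2.1 s.2.2)).const_mul
      (algebraMap ℚ ℝ (1 / (s.1.factorial * s.2.1.factorial * s.2.2.factorial)))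
  have hsum := HasDerivAt.fun_sum (u := degSet (L + 1)) fun s _ => hterm s
  refine HasDerivAt.congr_deriv (f := fun t : ℝ => taylorPoly (L + 1) f (t • k)) hsum ?_
  simp only [Pi.mul_apply, Pi.pow_apply]
  have hfac : ∀ m : ℕ, ((m + 1).factorial : ℚ) = (m + 1) * m.factorial := fun m => by
    rw [Nat.factorial_succ]; push_cast; ring
  have hne : ∀ m : ℕ, (m.factorial : ℝ) ≠ 0 := fun m => by
    exact_mod_cast m.factorial_ne_zero
  have hne' : ∀ m : ℕ, (m + 1 : ℝ) ≠ 0 := fun m => by positivity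
  have e : ∀ s : ℕ × ℕ × ℕ,
      algebraMap ℚ ℝ (1 / (s.1.factorial * s.2.1.factorial * s.2.2.factorial)) *
        ((s.1 * (t * k 0) ^ (s.1 - 1) * k 0 * (t * k 1) ^ s.2.1 +
          (t * k 0) ^ s.1 * (s.2.1 * (t * k 1) ^ (s.2.1 - 1) * k 1)) *
            contr s.2.2 (jet f s.1 s.2.1) (t • zpart k) +
          (t * k 0) ^ s.1 * (t * k 1) ^ s.2.1 * (s.2.2 * ∑ i, zpart k i *
            contr (s.2.2 - 1) (fun l => jet f s.1 s.2.1 (i :: l)) (t • zpart k))) =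
      algebraMap ℚ ℝ (1 / (s.1.factorial * s.2.1.factorial * s.2.2.factorial)) *
        (s.1 * (t * k 0) ^ (s.1 - 1) * k 0 * (t * k 1) ^ s.2.1 *
          contr s.2.2 (jet f s.1 s.2.1) (t • zpart k)) +
      (algebraMap ℚ ℝ (1 / (s.1.factorial * s.2.1.factorial * s.2.2.factorial)) *
        ((t * k 0) ^ s.1 * (s.2.1 * (t * k 1) ^ (s.2.1 - 1) * k 1) *
          contr s.2.2 (jet f s.1 s.2.1) (t • zpart k)) +
      algebraMap ℚ ℝ (1 / (s.1.factorial * s.2.1.factorial * s.2.2.factorial)) *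
        ((t * k 0) ^ s.1 * (t * k 1) ^ s.2.1 * (s.2.2 * ∑ i, zpart k i *
            contr (s.2.2 - 1) (fun l => jet f s.1 s.2.1 (i :: l)) (t • zpart k)))) := by
    intro s; ring
  rw [Finset.sum_congr rfl fun s _ => e s, Finset.sum_add_distrib, Finset.sum_add_distrib,
    sum_degSet_succ_x _ (by simp), sum_degSet_succ_y _ (by simp), sum_degSet_succ_z _ (by simp),
    Fin.sum_univ_succ, Fin.sum_univ_succ]
  simp only [taylorPoly, taylorSum, Fin.succ_zero_eq_one, Finset.mul_sum]
  refine congrArg₂ _ ?_ (congrArg₂ _ ?_ ?_)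
  · refine Finset.sum_congr rfl fun s _ => ?_
    have : jet (pderivCoord 0 f) s.1 s.2.1 = jet f (s.1 + 1) s.2.1 :=
      funext fun l => jet_pderiv_x hf _ _ l
    have h1 := hne s.1
    have h2 := hne' s.1
    have h3 := hne s.2.1
    have h4 := hne s.2.2
    rw [this, hfac]
    change _ = k 0 * (_ * ((t * k 0) ^ s.1 * (t * k 1) ^ s.2.1 *
      contr s.2.2 _ (t • zpart k)))
    simp only [Nat.add_sub_cancel, eq_ratCast]
    push_cast
    field_simp
  · refine Finset.sum_congr rfl fun s _ => ?_
    have : jet (pderivCoord 1 f) s.1 s.2.1 = jet f s.1 (s.2.1 + 1) :=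
      funext fun l => jet_pderiv_y hf _ _ l
    have h1 := hne s.1
    have h2 := hne' s.2.1
    have h3 := hne s.2.1
    have h4 := hne s.2.2
    rw [this, hfac]
    change _ = k 1 * (_ * ((t * k 0) ^ s.1 * (t * k 1) ^ s.2.1 *
      contr s.2.2 _ (t • zpart k)))
    simp only [Nat.add_sub_cancel, eq_ratCast]
    push_cast
    field_simp
  · rw [Finset.sum_comm]
    refine Finset.sum_congr rfl fun i _ => Finset.sum_congr rfl fun s _ => ?_
    have : jet (pderivCoord i.succ.succ f) s.1 s.2.1 = fun l => jet f s.1 s.2.1 (i :: l) :=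
      funext fun l => jet_pderiv_z hf _ _ i l
    have h1 := hne s.1
    have h2 := hne' s.2.2
    have h3 := hne s.2.1
    have h4 := hne s.2.2
    rw [this, hfac]
    change _ = k i.succ.succ * (_ * ((t * k 0) ^ s.1 * (t * k 1) ^ s.2.1 *
      contr s.2.2 _ (t • zpart k)))
    change _ * (_ * (_ * (k i.succ.succ * _))) = _
    simp only [Nat.add_sub_cancel, eq_ratCast]
    push_cast
    field_simp

theorem fderiv_apply_eq_sum {n : ℕ} (f : Coord n → ℝ) (x k : Coord n) :
    fderiv ℝ f x k = ∑ i, k i * pderivCoord i f x := by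
  nth_rewrite 1 [← Finset.univ_sum_single k]
  rw [map_sum]
  refine Finset.sum_congr rfl fun i _ => ?_
  rw [pderivCoord, ← smul_eq_mul, ← map_smul]
  congr 1
  ext j
  by_cases h : j = i
  · subst h; simp
  · simp [h]

/-- Taylor's formula on the unit ball, with a bound for the remainder. -/
theorem exists_taylor_bound {n : ℕ} (L : ℕ) : ∀ {f : Coord n → ℝ}, ContDiff ℝ ∞ f →
    ∃ C : ℝ, 0 ≤ C ∧ ∀ k : Coord n, ‖k‖ ≤ 1 → |f k - taylorPoly L f k| ≤ C * ‖k‖ ^ L := by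
  induction L with
  | zero =>
    intro f hf
    obtain ⟨C, hC⟩ := (isCompact_closedBall (0 : Coord n) 1).exists_bound_of_continuousOn
      hf.continuous.continuousOn
    refine ⟨max C 0, le_max_right _ _, fun k hk => ?_⟩
    have h0 : taylorPoly 0 f k = 0 := by simp [taylorPoly, taylorSum, degSet]
    have := hC k (by simpa using hk)
    rw [h0, sub_zero, pow_zero, mul_one]
    exact this.trans (le_max_left _ _)
  | succ L ih =>
    intro f hf
    choose C hC0 hC using fun i => ih (contDiff_pderivCoord hf i)
    refine ⟨∑ i, C i, Finset.sum_nonneg fun i _ => hC0 i, fun k hk => ?_⟩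
    let φ : ℝ → ℝ := fun t => f (t • k) - taylorPoly (L + 1) f (t • k)
    have hφ : ∀ t, HasDerivAt φ (∑ i, k i * (pderivCoord i f (t • k) -
        taylorPoly L (pderivCoord i f) (t • k))) t := by
      intro t
      have h1 : HasDerivAt (fun t : ℝ => f (t • k)) (fderiv ℝ f (t • k) k) t := by
        have h2 : HasDerivAt (fun t : ℝ => t • k) k t := by
          simpa using (hasDerivAt_id t).smul_const k
        exact ((hf.differentiable (by simp) _).hasFDerivAt).comp_hasDerivAt t h2
      refine (h1.sub (hasDerivAt_taylorPoly hf L k t)).congr_deriv ?_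
      rw [fderiv_apply_eq_sum, ← Finset.sum_sub_distrib]
      simp only [mul_sub]
    have hφ0 : φ 0 = 0 := by
      simp only [φ, zero_smul, taylorPoly]
      rw [taylorSum, Finset.sum_eq_single (0, 0, 0)]
      · simp [contr, jet_zero]
      · rintro ⟨a, b, c⟩ - hs
        rcases a with _ | a
        · rcases b with _ | b
          · rcases c with _ | c
            · simp at hs
            · simp [contr, zpart]
          · simp
        · simp
      · intro h; exact absurd (mem_degSet.2 (by simp)) h
    have hb := (convex_Icc (0 : ℝ) 1).norm_image_sub_le_of_norm_hasDerivWithin_le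
      (f := φ) (C := (∑ i, C i) * ‖k‖ ^ (L + 1)) (fun t _ => (hφ t).hasDerivWithinAt) ?_
      (left_mem_Icc.2 zero_le_one) (right_mem_Icc.2 zero_le_one)
    · simpa [hφ0, φ] using hb
    · intro t ht
      rw [Real.norm_eq_abs]
      refine (Finset.abs_sum_le_sum_abs _ _).trans ?_
      rw [Finset.sum_mul]
      refine Finset.sum_le_sum fun i _ => ?_
      have hki : |k i| ≤ ‖k‖ := norm_le_pi_norm k i
      have htk : ‖t • k‖ ≤ ‖k‖ := by
        rw [norm_smul, Real.norm_eq_abs, abs_of_nonneg ht.1]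
        exact mul_le_of_le_one_left (norm_nonneg _) ht.2
      rw [abs_mul]
      calc |k i| * |pderivCoord i f (t • k) - taylorPoly L (pderivCoord i f) (t • k)|
          ≤ ‖k‖ * (C i * ‖t • k‖ ^ L) := by
            gcongr
            exact hC i _ (htk.trans hk)
        _ ≤ ‖k‖ * (C i * ‖k‖ ^ L) := by
            have := hC0 i
            gcongr
        _ = C i * ‖k‖ ^ (L + 1) := by ring

end

noncomputable section

open Filter Topology Set Asymptotics

/-! ### Points in coordinates and weighted Taylor expansions -/

/-- The point with `k₁ = x`, `k₂ = y`, `(k₃, …, k_ν) = z`. -/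
def pt {n : ℕ} (x y : ℝ) (z : Fin n → ℝ) : Coord n := Matrix.vecCons x (Matrix.vecCons y z)

@[simp] theorem pt_zero {n : ℕ} (x y : ℝ) (z : Fin n → ℝ) : pt x y z 0 = x := rfl

@[simp] theorem pt_one {n : ℕ} (x y : ℝ) (z : Fin n → ℝ) : pt x y z 1 = y := rfl

@[simp] theorem pt_succ_succ {n : ℕ} (x y : ℝ) (z : Fin n → ℝ) (i : Fin n) :
    pt x y z i.succ.succ = z i := rfl

@[simp] theorem zpart_pt {n : ℕ} (x y : ℝ) (z : Fin n → ℝ) : zpart (pt x y z) = z := rfl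

theorem coord_ext {n : ℕ} {k k' : Coord n} (h0 : k 0 = k' 0) (h1 : k 1 = k' 1)
    (h2 : zpart k = zpart k') : k = k' := by
  ext i
  refine Fin.cases h0 (fun i => Fin.cases h1 (fun i => ?_) i) i
  exact congrFun h2 i

theorem pt_eta {n : ℕ} (k : Coord n) : pt (k 0) (k 1) (zpart k) = k := coord_ext rfl rfl rfl

theorem neg_pt {n : ℕ} (x y : ℝ) (z : Fin n → ℝ) : -pt x y z = pt (-x) (-y) (-z) :=
  coord_ext rfl rfl rfl

@[simp] theorem pt_zero_zero {n : ℕ} : pt 0 0 (0 : Fin n → ℝ) = 0 := coord_ext rfl rfl rfl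

theorem zpart_neg {n : ℕ} (k : Coord n) : zpart (-k) = -zpart k := rfl

theorem ContDiff.pt {E : Type*} [NormedAddCommGroup E] [NormedSpace ℝ E] {n : ℕ} {x y : E → ℝ}
    {z : E → Fin n → ℝ} (hx : ContDiff ℝ ∞ x) (hy : ContDiff ℝ ∞ y) (hz : ContDiff ℝ ∞ z) :
    ContDiff ℝ ∞ (fun e => pt (x e) (y e) (z e)) := by
  refine contDiff_pi.2 fun i => ?_
  refine Fin.cases hx (fun i => Fin.cases hy (fun i => ?_) i) i
  exact contDiff_pi.1 hz i

@[fun_prop] theorem contDiff_zpart {n : ℕ} : ContDiff ℝ ∞ (zpart (n := n)) :=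
  contDiff_pi.2 fun i => contDiff_apply ℝ ℝ i.succ.succ

theorem norm_zpart_le {n : ℕ} (k : Coord n) : ‖zpart k‖ ≤ ‖k‖ :=
  (pi_norm_le_iff_of_nonneg (norm_nonneg _)).2 fun i => norm_le_pi_norm k i.succ.succ

theorem isBigO_pow_of_le {τ : Type*} {l : Filter τ} {r : τ → ℝ} (hr : Tendsto r l (𝓝 0))
    {m k : ℕ} (h : m ≤ k) : (fun e => r e ^ k) =O[l] fun e => r e ^ m := by
  have h1 : (fun e => r e ^ (k - m)) =O[l] fun _ => (1 : ℝ) := (hr.pow (k - m)).isBigO_one ℝ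
  have h2 := (isBigO_refl (fun e => r e ^ m) l).mul h1
  refine (h2.congr_left fun e => ?_).congr_right fun e => mul_one _
  rw [← pow_add, Nat.add_sub_cancel' h]

theorem isBigO_pi_apply {τ : Type*} {l : Filter τ} {n : ℕ} {z : τ → Fin n → ℝ} {g : τ → ℝ}
    (hz : z =O[l] g) (i : Fin n) : (fun e => z e i) =O[l] g :=
  (isBigO_pi (f := z)).1 hz i

theorem isBigO_pt {τ : Type*} {l : Filter τ} {n : ℕ} {x y : τ → ℝ} {z : τ → Fin n → ℝ}
    {g : τ → ℝ} (hx : x =O[l] g) (hy : y =O[l] g) (hz : z =O[l] g) :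
    (fun e => pt (x e) (y e) (z e)) =O[l] g := by
  refine isBigO_pi.2 fun i => ?_
  refine Fin.cases hx (fun i => Fin.cases hy (fun i => ?_) i) i
  exact isBigO_pi_apply hz i

theorem isBigO_contr {τ : Type*} {l : Filter τ} {r : τ → ℝ} {n : ℕ} {z : τ → Fin n → ℝ} {q : ℕ}
    (hz : z =O[l] fun e => r e ^ q) (c : ℕ) : ∀ G : List (Fin n) → ℝ,
    (fun e => contr c G (z e)) =O[l] fun e => r e ^ (q * c) := by
  induction c with
  | zero => intro G; simpa [contr] using isBigO_const_const (G []) (one_ne_zero (α := ℝ)) l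
  | succ c ih =>
    intro G
    refine IsBigO.fun_sum fun i _ => ?_
    exact ((isBigO_pi_apply hz i).mul (ih fun l => G (i :: l))).congr_right fun e => by ring

theorem contr_congr {R : Type*} [CommSemiring R] {n : ℕ} (c : ℕ) :
    ∀ {G G' : List (Fin n) → R}, (∀ l, l.length = c → G l = G' l) → ∀ z,
    contr c G z = contr c G' z := by
  induction c with
  | zero => intro G G' h z; exact h [] rfl
  | succ c ih =>
    intro G G' h z
    refine Finset.sum_congr rfl fun i _ => ?_
    rw [ih fun l hl => h (i :: l) (by simp [hl])]

theorem contr_zero {R : Type*} [CommSemiring R] {n : ℕ} (c : ℕ) (z : Fin n → R) :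
    contr c (fun _ => 0) z = 0 := by
  induction c with
  | zero => rfl
  | succ c ih => simp [contr, ih]

/-- The terms with vanishing coefficients may be omitted from a Taylor sum. -/
theorem taylorSum_subset {R : Type*} [CommRing R] [Algebra ℚ R] {n : ℕ}
    {S S' : Finset (ℕ × ℕ × ℕ)} {G : ℕ → ℕ → List (Fin n) → R} (hS : S' ⊆ S)
    (h : ∀ s ∈ S, s ∉ S' → ∀ l : List (Fin n), l.length = s.2.2 → G s.1 s.2.1 l = 0) (x y : R)
    (z : Fin n → R) : taylorSum S G x y z = taylorSum S' G x y z := by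
  refine (Finset.sum_subset hS fun s hs hs' => ?_).symm
  rw [contr_congr s.2.2 (h s hs hs'), contr_zero]
  simp

/-- The exponents `(a, b, c)` of weight less than `W`, where `x`, `y`, `z` have the weights
`p`, `1`, `q`. -/
def wset (p q W : ℕ) : Finset (ℕ × ℕ × ℕ) :=
  (degSet W).filter fun s => p * s.1 + s.2.1 + q * s.2.2 < W

theorem mem_wset {p q W : ℕ} (hp : 1 ≤ p) (hq : 1 ≤ q) {s : ℕ × ℕ × ℕ} :
    s ∈ wset p q W ↔ p * s.1 + s.2.1 + q * s.2.2 < W := by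
  simp only [wset, Finset.mem_filter, mem_degSet, and_iff_right_iff_imp]
  intro h
  have h1 := Nat.mul_le_mul_right s.1 hp
  have h2 := Nat.mul_le_mul_right s.2.2 hq
  omega

theorem isBigO_taylorPoly {n : ℕ} {f : Coord n → ℝ} (hf : ContDiff ℝ ∞ f) (L : ℕ) :
    (fun k => f k - taylorPoly L f k) =O[𝓝 0] fun k => ‖k‖ ^ L := by
  obtain ⟨C, -, hC⟩ := exists_taylor_bound L hf
  refine IsBigO.of_bound C ?_
  filter_upwards [Metric.closedBall_mem_nhds (0 : Coord n) one_pos] with k hk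
  simpa using hC k (by simpa using hk)

/-- Taylor's formula along a family of points whose coordinates `x`, `y`, `z` are of the orders
`r ^ p`, `r`, `r ^ q`: only the terms of weight less than `W` matter up to `O(r ^ W)`. -/
theorem isBigO_taylor {τ : Type*} {l : Filter τ} {r : τ → ℝ} (hr : Tendsto r l (𝓝 0)) {n : ℕ}
    {f : Coord n → ℝ} (hf : ContDiff ℝ ∞ f) {x y : τ → ℝ} {z : τ → Fin n → ℝ} {p q : ℕ}
    (hp : 1 ≤ p) (hq : 1 ≤ q) (hx : x =O[l] fun e => r e ^ p) (hy : y =O[l] r)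
    (hz : z =O[l] fun e => r e ^ q) (W : ℕ) :
    (fun e => f (pt (x e) (y e) (z e)) - taylorSum (wset p q W) (jet f) (x e) (y e) (z e))
      =O[l] fun e => r e ^ W := by
  have hk : (fun e => pt (x e) (y e) (z e)) =O[l] r := by
    refine isBigO_pt (hx.trans ?_) hy (hz.trans ?_)
    · simpa using isBigO_pow_of_le hr hp
    · simpa using isBigO_pow_of_le hr hq
  have h1 : (fun e => f (pt (x e) (y e) (z e)) - taylorPoly W f (pt (x e) (y e) (z e)))
      =O[l] fun e => r e ^ W :=
    ((isBigO_taylorPoly hf W).comp_tendsto (hk.trans_tendsto hr)).trans (hk.norm_left.pow W)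
  have h2 : (fun e => ∑ s ∈ degSet W \ wset p q W,
      algebraMap ℚ ℝ (1 / (s.1.factorial * s.2.1.factorial * s.2.2.factorial)) *
        (x e ^ s.1 * y e ^ s.2.1 * contr s.2.2 (jet f s.1 s.2.1) (z e)))
      =O[l] fun e => r e ^ W := by
    refine IsBigO.fun_sum fun s hs => ?_
    refine IsBigO.const_mul_left (f := fun e => x e ^ s.1 * y e ^ s.2.1 *
      contr s.2.2 (jet f s.1 s.2.1) (z e)) ?_ _
    rw [Finset.mem_sdiff, mem_wset hp hq, not_lt] at hs
    refine IsBigO.trans ?_ (isBigO_pow_of_le hr hs.2)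
    refine (((hx.pow s.1).mul (hy.pow s.2.1)).mul
      (isBigO_contr hz s.2.2 (jet f s.1 s.2.1))).congr_right fun e => ?_
    rw [← pow_mul, ← pow_add, ← pow_add]
  refine (h1.add h2).congr_left fun e => ?_
  have h3 := Finset.sum_sdiff (f := fun s : ℕ × ℕ × ℕ =>
      algebraMap ℚ ℝ (1 / (s.1.factorial * s.2.1.factorial * s.2.2.factorial)) *
        (x e ^ s.1 * y e ^ s.2.1 * contr s.2.2 (jet f s.1 s.2.1) (z e)))
    (Finset.filter_subset _ (degSet W) : wset p q W ⊆ degSet W)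
  change f _ - ∑ s ∈ degSet W, _ + _ = f _ - ∑ s ∈ wset p q W, _
  simp only [pt_zero, pt_one, zpart_pt]
  rw [← h3, wset]
  ring

/-! ### The jet of an even function of corank two -/

theorem jetZZ_transpose {n : ℕ} (f : Coord n → ℝ) (a b : ℕ) : (jetZZ f a b)ᵀ = jetZZ f a b := by
  ext i j
  exact jet_perm f a b (List.Perm.swap _ _ _)

namespace EvenCorankTwo

variable {n : ℕ} {f : Coord n → ℝ}

theorem jet_odd (hf : EvenCorankTwo f) {a b : ℕ} {l : List (Fin n)}
    (h : (a + b + l.length) % 2 = 1) : jet f a b l = 0 :=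
  jet_eq_zero_of_odd hf.smooth hf.even (Nat.odd_iff.2 h)

theorem fderiv_fderiv_eq_zero (hf : EvenCorankTwo f) {v : Coord n}
    (hv : ∀ i : Fin n, v i.succ.succ = 0) (w : Coord n) :
    fderiv ℝ (fderiv ℝ f) 0 v w = 0 := (hf.kernel v).2 hv w

/-- The derivatives of order two vanish when at least one of them is taken in the plane of
`k₁, k₂`, which is the kernel of the second differential. -/
theorem jet_two (hf : EvenCorankTwo f) {a b : ℕ} {l : List (Fin n)}
    (h : a + b + l.length = 2) (hl : l.length ≤ 1) : jet f a b l = 0 := by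
  have key : ∀ j : Fin (n + 2), ∀ i : Fin (n + 2), (i = 0 ∨ i = 1) →
      pderivCoord i (pderivCoord j f) 0 = 0 := by
    intro j i hi
    rw [pderivCoord_pderivCoord hf.smooth]
    refine hf.fderiv_fderiv_eq_zero (fun m => ?_) _
    have h0 : (m.succ.succ : Fin (n + 2)) ≠ 0 := Fin.succ_ne_zero _
    have h1 : (m.succ.succ : Fin (n + 2)) ≠ 1 := fun h => by
      rw [← Fin.succ_zero_eq_one] at h
      exact Fin.succ_ne_zero _ (Fin.succ_injective _ h)
    rcases hi with rfl | rfl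
    · simp [h0]
    · simp [h1]
  have hs := hf.smooth
  have hs' := contDiff_pderivCoord hs
  match l, hl with
  | [], _ =>
    simp only [List.length_nil, add_zero] at h
    obtain ⟨rfl, rfl⟩ | ⟨rfl, rfl⟩ | ⟨rfl, rfl⟩ :
      (a = 2 ∧ b = 0) ∨ (a = 1 ∧ b = 1) ∨ (a = 0 ∧ b = 2) := by omega
    · rw [← jet_pderiv_x hs, ← jet_pderiv_x (hs' _), jet_zero, key _ _ (.inl rfl)]
    · rw [← jet_pderiv_y hs, ← jet_pderiv_x (hs' _), jet_zero, key _ _ (.inl rfl)]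
    · rw [← jet_pderiv_y hs, ← jet_pderiv_y (hs' _), jet_zero, key _ _ (.inr rfl)]
  | [i], _ =>
    simp only [List.length_singleton] at h
    obtain ⟨rfl, rfl⟩ | ⟨rfl, rfl⟩ : (a = 1 ∧ b = 0) ∨ (a = 0 ∧ b = 1) := by omega
    · rw [← jet_pderiv_z hs, ← jet_pderiv_x (hs' _), jet_zero, key _ _ (.inl rfl)]
    · rw [← jet_pderiv_z hs, ← jet_pderiv_y (hs' _), jet_zero, key _ _ (.inr rfl)]

/-- The matrix of the second derivatives in the directions `k₃, …, k_ν`. -/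
theorem jet_zz (hs : ContDiff ℝ ∞ f) (i j : Fin n) :
    jet f 0 0 [i, j] =
      fderiv ℝ (fderiv ℝ f) 0 (Pi.single j.succ.succ 1) (Pi.single i.succ.succ 1) := by
  rw [← jet_pderiv_z hs, ← jet_pderiv_z (contDiff_pderivCoord hs _), jet_zero,
    pderivCoord_pderivCoord hs]

/-- The second differential is nondegenerate transversally to its kernel, the plane of `k₁, k₂`. -/
theorem isUnit_det (hf : EvenCorankTwo f) : IsUnit (jetZZ f 0 0).det := by
  rw [isUnit_iff_ne_zero]
  intro h
  obtain ⟨c, hc, hHc⟩ := Matrix.exists_mulVec_eq_zero_iff.2 h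
  refine hc (funext fun i => ?_)
  refine (hf.kernel (pt 0 0 c)).1 (fun w => ?_) i
  have hsymm : ∀ v w, fderiv ℝ (fderiv ℝ f) 0 v w = fderiv ℝ (fderiv ℝ f) 0 w v := fun v w =>
    (hf.smooth.contDiffAt.isSymmSndFDerivAt (by
      simpa using (WithTop.coe_le_coe.2 (le_top : (2 : ℕ∞) ≤ ⊤) : ((2 : ℕ∞) : ℕ∞ω) ≤ _))) _ _
  have hdec : ∀ u : Fin n → ℝ, pt 0 0 u = ∑ i, u i • (Pi.single i.succ.succ 1 : Coord n) := by
    intro u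
    ext m
    simp only [Finset.sum_apply, Pi.smul_apply, smul_eq_mul]
    refine Fin.cases ?_ (fun m => Fin.cases ?_ (fun m => ?_) m) m
    · symm; refine Finset.sum_eq_zero fun i _ => ?_
      simp [(Fin.succ_ne_zero _).symm]
    · symm; refine Finset.sum_eq_zero fun i _ => ?_
      have : (Fin.succ 0 : Fin (n + 2)) ≠ i.succ.succ := fun h =>
        Fin.succ_ne_zero _ (Fin.succ_injective _ h.symm)
      exact mul_eq_zero_of_right _ (Pi.single_eq_of_ne this _)
    · rw [Finset.sum_eq_single m]
      · simp
      · intro i _ hi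
        have : (m.succ.succ : Fin (n + 2)) ≠ i.succ.succ := by simpa using hi.symm
        simp [this]
      · simp
  have hw : w = pt (w 0) (w 1) 0 + pt 0 0 (zpart w) := coord_ext (by simp) (by simp)
    (by ext i; simp [zpart])
  rw [hw, map_add, hsymm, hf.fderiv_fderiv_eq_zero (fun i => rfl), zero_add, hsymm, hdec,
    hdec]
  simp only [map_sum, map_smul, sum_apply, smul_apply, smul_eq_mul]
  have hrow : ∀ i : Fin n, ∑ j : Fin n, c j * fderiv ℝ (fderiv ℝ f) 0 (Pi.single i.succ.succ 1)
      (Pi.single j.succ.succ 1) = 0 := by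
    intro i
    have := congrFun hHc i
    simp only [Matrix.mulVec, dotProduct, jetZZ, Matrix.of_apply, Pi.zero_apply,
      jet_zz hf.smooth] at this
    rw [← this]
    refine Finset.sum_congr rfl fun j _ => ?_
    rw [hsymm, mul_comm]
  simp only [Finset.mul_sum]
  rw [Finset.sum_comm]
  refine Finset.sum_eq_zero fun j _ => ?_
  rw [← mul_zero (zpart w j), ← hrow j, Finset.mul_sum]
  exact Finset.sum_congr rfl fun i _ => by ring

theorem hessInv_mul (hf : EvenCorankTwo f) : hessInv f * jetZZ f 0 0 = 1 :=
  Matrix.nonsing_inv_mul _ hf.isUnit_det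

theorem mul_hessInv (hf : EvenCorankTwo f) : jetZZ f 0 0 * hessInv f = 1 :=
  Matrix.mul_nonsing_inv _ hf.isUnit_det

end EvenCorankTwo

/-! ### Mean values along curves -/

/-- Mean value theorem for two points with the same second coordinate. -/
theorem exists_mean_value {n : ℕ} {F : Coord n → ℝ} (hF : ContDiff ℝ ∞ F) (x x' t : ℝ)
    (z z' : Fin n → ℝ) : ∃ s ∈ Icc (0 : ℝ) 1, F (pt x t z) - F (pt x' t z') =
      (x - x') * pderivCoord 0 F (pt (x' + s * (x - x')) t (z' + s • (z - z'))) +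
      ∑ i, (z i - z' i) *
        pderivCoord i.succ.succ F (pt (x' + s * (x - x')) t (z' + s • (z - z'))) := by
  let v : Coord n := pt (x - x') 0 (z - z')
  have hpt : ∀ s : ℝ, pt x' t z' + s • v = pt (x' + s * (x - x')) t (z' + s • (z - z')) := fun s =>
    coord_ext (by simp [v]) (by simp [v]) (by ext i; simp [v, zpart])
  have hd : ∀ s : ℝ, HasDerivAt (fun s : ℝ => F (pt x' t z' + s • v))
      (fderiv ℝ F (pt x' t z' + s • v) v) s := by
    intro s
    have h2 : HasDerivAt (fun s : ℝ => pt x' t z' + s • v) v s := by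
      simpa using ((hasDerivAt_id s).smul_const v).const_add (pt x' t z')
    exact ((hF.differentiable (by simp) _).hasFDerivAt).comp_hasDerivAt s h2
  obtain ⟨s, hs, he⟩ := exists_hasDerivAt_eq_slope _ _ (zero_lt_one' ℝ)
    (fun s _ => (hd s).continuousAt.continuousWithinAt) (fun s _ => hd s)
  refine ⟨s, Ioo_subset_Icc_self hs, ?_⟩
  have e1 : pt x' t z' + (1 : ℝ) • v = pt x t z := by rw [hpt]; simp
  have e0 : pt x' t z' + (0 : ℝ) • v = pt x' t z' := by simp
  rw [e1, e0, sub_zero, div_one] at he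
  rw [← he, fderiv_apply_eq_sum, Fin.sum_univ_succ, Fin.sum_univ_succ, hpt]
  simp [v]

/-! ### Leading coefficients -/

/-- If `t ^ k * H t = O(t ^ (k + 1))` with `H` continuous at `0`, then `H 0 = 0`. -/
theorem eq_zero_of_isBigO_pow_succ {H : ℝ → ℝ} (hH : ContinuousAt H 0) {k : ℕ}
    (h : (fun t => t ^ k * H t) =O[𝓝 0] fun t => t ^ (k + 1)) : H 0 = 0 := by
  have h1 : H =O[𝓝[≠] 0] fun t => t := by
    obtain ⟨C, hC⟩ := (h.mono nhdsWithin_le_nhds : _ =O[𝓝[≠] (0 : ℝ)] _).bound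
    refine IsBigO.of_bound C ?_
    filter_upwards [hC, self_mem_nhdsWithin] with t ht ht0
    have ht0' : 0 < ‖t ^ k‖ := norm_pos_iff.2 (pow_ne_zero _ ht0)
    rw [norm_mul, pow_succ, norm_mul] at ht
    refine le_of_mul_le_mul_left ?_ ht0'
    linarith
  have h2 : Tendsto H (𝓝[≠] 0) (𝓝 0) :=
    h1.trans_tendsto (tendsto_id.mono_left nhdsWithin_le_nhds)
  exact tendsto_nhds_unique (hH.tendsto.mono_left nhdsWithin_le_nhds) h2

theorem isBigO_pow_id {m k : ℕ} (h : m ≤ k) :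
    (fun t : ℝ => t ^ k) =O[𝓝 0] fun t => t ^ m :=
  isBigO_pow_of_le (r := fun t : ℝ => t) tendsto_id h

theorem IsBigO.pow_mono {E : Type*} [Norm E] {F : ℝ → E} {m k : ℕ}
    (hF : F =O[𝓝 0] fun t : ℝ => t ^ k) (h : m ≤ k) : F =O[𝓝 0] fun t : ℝ => t ^ m :=
  hF.trans (isBigO_pow_id h)

/-- A smooth function of order `t ^ k` is divisible by `t ^ k`. -/
theorem exists_eq_pow_mul {φ : ℝ → ℝ} (hφ : ContDiff ℝ ∞ φ) {k : ℕ}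
    (h : φ =O[𝓝 0] fun t => t ^ k) : ∃ ψ : ℝ → ℝ, ContDiff ℝ ∞ ψ ∧ ∀ t, φ t = t ^ k * ψ t := by
  induction k with
  | zero => exact ⟨φ, hφ, by simp⟩
  | succ k ih =>
    obtain ⟨ψ, hψ, he⟩ := ih (IsBigO.pow_mono h (Nat.le_succ k))
    have h0 : ψ 0 = 0 := eq_zero_of_isBigO_pow_succ hψ.continuous.continuousAt (k := k)
      (h.congr_left he)
    obtain ⟨L, hL, hLe, -⟩ := exists_hadamard hψ 0 (by simp)
    refine ⟨fun t => L t 1, by fun_prop, fun t => ?_⟩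
    have h1 : ψ t = t * L t 1 := by
      have := hLe t
      simp only [zero_apply, h0, sub_zero, zero_add] at this
      rw [this, ← smul_eq_mul, ← map_smul, smul_eq_mul, mul_one]
    rw [he, h1]; ring

theorem isBigO_deriv_of_isBigO {φ : ℝ → ℝ} (hφ : ContDiff ℝ ∞ φ) {k : ℕ}
    (h : φ =O[𝓝 0] fun t => t ^ (k + 1)) : deriv φ =O[𝓝 0] fun t => t ^ k := by
  obtain ⟨ψ, hψ, he⟩ := exists_eq_pow_mul hφ h
  have hd : deriv φ = fun t => t ^ k * ((k + 1 : ℕ) * ψ t + t * deriv ψ t) := by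
    ext t
    have h1 : φ = fun t => t ^ (k + 1) * ψ t := funext he
    rw [h1]
    have h2 := (hasDerivAt_pow (k + 1) t).mul ((hψ.differentiable (by simp) t).hasDerivAt)
    refine (h2.congr_deriv ?_).deriv
    simp only [Nat.add_sub_cancel]
    ring
  have hc : Continuous (deriv ψ) := hψ.continuous_deriv (by simp)
  have hψc := hψ.continuous
  have hcont : Continuous fun t => ((k + 1 : ℕ) : ℝ) * ψ t + t * deriv ψ t := by fun_prop
  rw [hd]
  simpa using (isBigO_refl (fun t : ℝ => t ^ k) (𝓝 0)).mul ((hcont.tendsto 0).isBigO_one ℝ)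

/-- An even smooth function with `φ = a t ^ (2 m) + O(t ^ (2 m + 1))` has the form
`t ^ (2 m) (a + t² τ(t))` with `τ` even and smooth. -/
theorem exists_even_quotient {φ : ℝ → ℝ} (hφ : ContDiff ℝ ∞ φ) (he : ∀ t, φ (-t) = φ t) {m : ℕ}
    {a : ℝ} (h : (fun t => φ t - a * t ^ (2 * m)) =O[𝓝 0] fun t => t ^ (2 * m + 1)) :
    ∃ τ : ℝ → ℝ, ContDiff ℝ ∞ τ ∧ (∀ t, τ (-t) = τ t) ∧
      ∀ t, φ t = t ^ (2 * m) * (a + t ^ 2 * τ t) := by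
  have h1 : φ =O[𝓝 0] fun t => t ^ (2 * m) := by
    have := (IsBigO.pow_mono h (Nat.le_succ _)).add
      ((isBigO_refl (fun t : ℝ => t ^ (2 * m)) (𝓝 0)).const_mul_left a)
    exact this.congr_left fun t => by ring
  obtain ⟨ψ, hψ, hφψ⟩ := exists_eq_pow_mul hφ h1
  have hψ0 : ψ 0 - a = 0 := by
    refine eq_zero_of_isBigO_pow_succ (H := fun t => ψ t - a)
      (hψ.continuous.continuousAt.sub continuousAt_const) (k := 2 * m) (h.congr_left fun t => ?_)
    rw [hφψ]; ring
  obtain ⟨A, B, c, -, -, hc, -, -, hce, hd⟩ := exists_division_even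
    (h := fun p : ℝ × ℝ => (ψ p.2 + ψ (-p.2)) / 2 - a) (by fun_prop)
    (fun p => by simp [add_comm]) (by simp; linarith)
  refine ⟨fun t => c (0, t), by fun_prop, fun t => ?_, fun t => ?_⟩
  · have := hce (0, t)
    simpa using this
  · have h2 := hd (0, t)
    simp only at h2
    have h3 := hφψ t
    have h4 := hφψ (-t)
    rw [he, Even.neg_pow (even_two_mul m)] at h4
    linear_combination h3 / 2 + h4 / 2 + t ^ (2 * m) * h2

/-- If a combination of the monomials of degree `d` with continuous coefficients is of order
`d + 1`, then the coefficients vanish at the origin. -/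
theorem coeff_eq_zero_of_isBigO {d : ℕ} {q : ℕ → ℝ × ℝ → ℝ} (hq : ∀ i, ContinuousAt (q i) 0)
    (h : (fun p : ℝ × ℝ => ∑ i ∈ Finset.range (d + 1), p.1 ^ (d - i) * p.2 ^ i * q i p)
      =O[𝓝 0] fun p => ‖p‖ ^ (d + 1)) {i : ℕ} (hi : i ≤ d) : q i 0 = 0 := by
  have key : ∀ s : ℝ, ∑ i ∈ Finset.range (d + 1), s ^ i * q i 0 = 0 := by
    intro s
    have hc : ContinuousAt (fun t : ℝ => (t, t * s)) 0 := by fun_prop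
    have hz : ((0 : ℝ), 0 * s) = 0 := by rw [zero_mul]; rfl
    have ht : Tendsto (fun t : ℝ => (t, t * s)) (𝓝 0) (𝓝 0) := by
      have := hc.tendsto
      rwa [hz] at this
    have h1 := h.comp_tendsto ht
    have h2 : (fun t : ℝ => ‖((t, t * s) : ℝ × ℝ)‖ ^ (d + 1)) =O[𝓝 0] fun t => t ^ (d + 1) := by
      refine IsBigO.pow (IsBigO.norm_left ?_) _
      exact (isBigO_refl _ _).prod_left
        (((isBigO_refl (fun t : ℝ => t) (𝓝 0)).const_mul_left s).congr_left fun t => mul_comm _ _)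
    have h3 := h1.trans h2
    have h4 := eq_zero_of_isBigO_pow_succ
      (H := fun t => ∑ i ∈ Finset.range (d + 1), s ^ i * q i (t, t * s)) (k := d) ?_
      (h3.congr_left fun t => ?_)
    · rwa [← hz]
    · refine tendsto_finsetSum _ fun i _ => Tendsto.mul tendsto_const_nhds ?_
      have : ContinuousAt (q i) ((0 : ℝ), 0 * s) := by rw [hz]; exact hq i
      exact ContinuousAt.comp (f := fun t : ℝ => (t, t * s)) this hc
    · simp only [Function.comp_apply]
      rw [Finset.mul_sum]
      refine Finset.sum_congr rfl fun i hi => ?_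
      have hi' : i ≤ d := Nat.lt_succ_iff.1 (Finset.mem_range.1 hi)
      rw [mul_pow, ← mul_assoc, ← pow_add, Nat.sub_add_cancel hi', mul_assoc]
  have hpoly : (∑ i ∈ Finset.range (d + 1), Polynomial.C (q i 0) * Polynomial.X ^ i) = 0 := by
    refine Polynomial.funext fun s => ?_
    rw [Polynomial.eval_finsetSum, Polynomial.eval_zero, ← key s]
    exact Finset.sum_congr rfl fun i _ => by
      rw [Polynomial.eval_mul, Polynomial.eval_C, Polynomial.eval_pow, Polynomial.eval_X, mul_comm]
  have := congrArg (fun p => Polynomial.coeff p i) hpoly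
  simp only [Polynomial.finsetSum_coeff, Polynomial.coeff_C_mul_X_pow, Polynomial.coeff_zero,
    Finset.sum_ite_eq, Finset.mem_range] at this
  rwa [if_pos (Nat.lt_succ_of_le hi)] at this

/-- A polynomial function of order `t ^ k` at the origin has no terms of degree less than `k`. -/
theorem coeff_lt_eq_zero {p : Polynomial ℝ} {k : ℕ}
    (h : (fun t => p.eval t) =O[𝓝 0] fun t => t ^ k) {i : ℕ} (hi : i < k) : p.coeff i = 0 := by
  induction i using Nat.strong_induction_on with
  | _ i ih =>
    obtain ⟨q, hq⟩ := Polynomial.X_pow_dvd_iff.2 (fun j hj => ih j hj (hj.trans hi))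
    have h0 : q.eval 0 = 0 := by
      refine eq_zero_of_isBigO_pow_succ (H := fun t => q.eval t) (k := i)
        q.continuous.continuousAt ((IsBigO.pow_mono h hi).congr_left fun t => ?_)
      rw [hq]; simp
    rw [hq, Polynomial.coeff_X_pow_mul', if_pos le_rfl, Nat.sub_self, Polynomial.coeff_zero_eq_eval_zero, h0]

/-- The leading term of a polynomial of order `t ^ k` at the origin. -/
theorem isBigO_sub_leading {p : Polynomial ℝ} {k : ℕ}
    (h : (fun t => p.eval t) =O[𝓝 0] fun t => t ^ k) :
    (fun t => p.eval t - p.coeff k * t ^ k) =O[𝓝 0] fun t => t ^ (k + 1) := by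
  obtain ⟨q, hq⟩ : Polynomial.X ^ (k + 1) ∣ p - Polynomial.C (p.coeff k) * Polynomial.X ^ k := by
    refine Polynomial.X_pow_dvd_iff.2 fun j hj => ?_
    rw [Polynomial.coeff_sub, Polynomial.coeff_C_mul, Polynomial.coeff_X_pow]
    rcases Nat.lt_succ_iff_lt_or_eq.1 hj with hj | rfl
    · simp [coeff_lt_eq_zero h hj, hj.ne]
    · simp
  have h1 : ∀ t, p.eval t - p.coeff k * t ^ k = t ^ (k + 1) * q.eval t := fun t => by
    have := congrArg (Polynomial.eval t) hq
    simpa using this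
  simp only [h1]
  simpa using (isBigO_refl (fun t : ℝ => t ^ (k + 1)) (𝓝 0)).mul
    ((q.continuous.tendsto 0).isBigO_one ℝ)

/-! ### Expansions of an even function of corank two and of its first derivatives -/

namespace EvenCorankTwo

variable {n : ℕ} {f : Coord n → ℝ} {τ : Type*} {l : Filter τ} {r : τ → ℝ} {x y : τ → ℝ}
  {z : τ → Fin n → ℝ}

/-- If the components `z` are of third order, then `f` is given by its quartic form up to terms of
order six. -/
theorem isBigO_quartic (hf : EvenCorankTwo f) (hr : Tendsto r l (𝓝 0)) (hx : x =O[l] r)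
    (hy : y =O[l] r) (hz : z =O[l] fun e => r e ^ 3) :
    (fun e => f (pt (x e) (y e) (z e)) - (f 0 + quarticForm f (x e) (y e)))
      =O[l] fun e => r e ^ 6 := by
  refine (isBigO_taylor hr hf.smooth le_rfl (by norm_num : 1 ≤ 3) (by simpa using hx) hy hz
    6).congr_left fun e => ?_
  rw [taylorSum_subset (S' := {(0, 0, 0), (4, 0, 0), (3, 1, 0), (2, 2, 0), (1, 3, 0), (0, 4, 0)})]
  · simp [taylorSum, contr, jet_zero, quarticForm, Nat.factorial]
    ring
  · decide
  · rintro ⟨a, b, c⟩ hs hs' l hl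
    rw [mem_wset le_rfl (by norm_num)] at hs
    simp only [Finset.mem_insert, Finset.mem_singleton, Prod.mk.injEq] at hs' hs hl ⊢
    rcases Nat.mod_two_eq_zero_or_one (a + b + l.length) with h | h
    · exact hf.jet_two (by omega) (by omega)
    · exact hf.jet_odd h

theorem isBigO_pderiv_z (hf : EvenCorankTwo f) (hr : Tendsto r l (𝓝 0)) (hx : x =O[l] r)
    (hy : y =O[l] r) (hz : z =O[l] r) (i : Fin n) :
    (fun e => pderivCoord i.succ.succ f (pt (x e) (y e) (z e)) - (jetZZ f 0 0 *ᵥ z e) i)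
      =O[l] fun e => r e ^ 3 := by
  refine (isBigO_taylor hr (contDiff_pderivCoord hf.smooth i.succ.succ) le_rfl le_rfl
    (by simpa using hx) hy (by simpa using hz) 3).congr_left fun e => ?_
  rw [taylorSum_subset (S' := {(0, 0, 1)})]
  · simp [taylorSum, contr, Nat.factorial, Matrix.mulVec, dotProduct, jetZZ,
      jet_pderiv_z hf.smooth, mul_comm]
  · decide
  · rintro ⟨a, b, c⟩ hs hs' l hl
    rw [mem_wset le_rfl le_rfl] at hs
    simp only [Finset.mem_singleton, Prod.mk.injEq] at hs' hs hl ⊢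
    rw [jet_pderiv_z hf.smooth]
    rcases Nat.mod_two_eq_zero_or_one (a + b + (i :: l).length) with h | h
    · simp only [List.length_cons] at h
      exact hf.jet_two (by simp only [List.length_cons]; omega)
        (by simp only [List.length_cons]; omega)
    · exact hf.jet_odd h

/-- The second derivatives are constant up to terms of second order. -/
theorem isBigO_pderiv_pderiv (hf : EvenCorankTwo f) (hr : Tendsto r l (𝓝 0)) (hx : x =O[l] r)
    (hy : y =O[l] r) (hz : z =O[l] r) (i j : Fin (n + 2)) :
    (fun e => pderivCoord i (pderivCoord j f) (pt (x e) (y e) (z e)) -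
      pderivCoord i (pderivCoord j f) 0) =O[l] fun e => r e ^ 2 := by
  have hs := contDiff_pderivCoord (contDiff_pderivCoord hf.smooth j) i
  have he : ∀ k, pderivCoord i (pderivCoord j f) (-k) = pderivCoord i (pderivCoord j f) k := by
    intro k
    have h1 := pderivCoord_neg (σ := 1) hf.smooth (by simpa using hf.even) j
    have h2 := pderivCoord_neg (contDiff_pderivCoord hf.smooth j) h1 i k
    simpa using h2
  refine (isBigO_taylor hr hs le_rfl le_rfl (by simpa using hx) hy (by simpa using hz)
    2).congr_left fun e => ?_
  rw [taylorSum_subset (S' := {(0, 0, 0)})]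
  · simp [taylorSum, contr, Nat.factorial, jet_zero]
  · decide
  · rintro ⟨a, b, c⟩ hs' hs'' l hl
    rw [mem_wset le_rfl le_rfl] at hs'
    simp only [Finset.mem_singleton, Prod.mk.injEq] at hs' hs'' hl ⊢
    exact jet_eq_zero_of_odd hs he (Nat.odd_iff.2 (by omega))

end EvenCorankTwo

namespace Normalized

variable {n : ℕ} {ε η : ℝ} {f : Coord n → ℝ} {τ : Type*} {l : Filter τ} {r : τ → ℝ}
  {x y : τ → ℝ} {z : τ → Fin n → ℝ}

theorem quarticForm_eq (hf : Normalized ε η f) (x y : ℝ) :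
    quarticForm f x y = ε * x ^ 4 + η * x ^ 2 * y ^ 2 + jet f 0 4 [] / 24 * y ^ 4 := by
  rw [quarticForm, hf.d31, hf.d13, hf.d40, hf.d22]
  ring

/-- The derivative in `x` of the quartic part of `f` is the leading part of `∂f/∂x`. -/
theorem isBigO_pderiv_x (hf : Normalized ε η f) (hr : Tendsto r l (𝓝 0)) (hx : x =O[l] r)
    (hy : y =O[l] r) (hz : z =O[l] fun e => r e ^ 3) :
    (fun e => pderivCoord 0 f (pt (x e) (y e) (z e)) - (4 * ε * x e ^ 3 + 2 * η * x e * y e ^ 2))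
      =O[l] fun e => r e ^ 5 := by
  have hs := hf.smooth
  refine (isBigO_taylor hr (contDiff_pderivCoord hs 0) le_rfl (by norm_num : 1 ≤ 3)
    (by simpa using hx) hy hz 5).congr_left fun e => ?_
  rw [taylorSum_subset (S' := {(3, 0, 0), (1, 2, 0)})]
  · simp [taylorSum, contr, Nat.factorial, jet_pderiv_x hs, hf.d40, hf.d22]
    ring
  · decide
  · rintro ⟨a, b, c⟩ hs' hs'' l hl
    rw [mem_wset le_rfl (by norm_num)] at hs'
    simp only [Finset.mem_insert, Finset.mem_singleton, Prod.mk.injEq] at hs' hs'' hl ⊢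
    rw [jet_pderiv_x hs]
    rcases Nat.mod_two_eq_zero_or_one (a + 1 + b + l.length) with h | h
    · by_cases h2 : a + 1 + b + l.length = 2
      · exact hf.jet_two h2 (by omega)
      · obtain ⟨rfl, rfl, rfl⟩ | ⟨rfl, rfl, rfl⟩ :
          (a = 2 ∧ b = 1 ∧ c = 0) ∨ (a = 0 ∧ b = 3 ∧ c = 0) := by omega
        · rw [List.length_eq_zero_iff.1 hl, hf.d31]
        · rw [List.length_eq_zero_iff.1 hl, hf.d13]
    · exact hf.jet_odd h

/-- Near the curves `x, z = O(y³)`, the term `η x² y²` dominates `∂²f/∂x²`. -/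
theorem isBigO_pderiv_xx (hf : Normalized ε η f) (hr : Tendsto r l (𝓝 0))
    (hx : x =O[l] fun e => r e ^ 3) (hy : y =O[l] r) (hz : z =O[l] fun e => r e ^ 3) :
    (fun e => pderivCoord 0 (pderivCoord 0 f) (pt (x e) (y e) (z e)) - 2 * η * y e ^ 2)
      =O[l] fun e => r e ^ 4 := by
  have hs := hf.smooth
  have hs' := contDiff_pderivCoord hs 0
  refine (isBigO_taylor hr (contDiff_pderivCoord hs' 0) (by norm_num : 1 ≤ 3)
    (by norm_num : 1 ≤ 3) hx hy hz 4).congr_left fun e => ?_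
  rw [taylorSum_subset (S' := {(0, 2, 0)})]
  · simp [taylorSum, contr, Nat.factorial, jet_pderiv_x hs, jet_pderiv_x hs', hf.d22]
    ring
  · decide
  · rintro ⟨a, b, c⟩ hm hm' l hl
    rw [mem_wset (by norm_num) (by norm_num)] at hm
    simp only [Finset.mem_singleton, Prod.mk.injEq] at hm hm' hl ⊢
    rw [jet_pderiv_x hs', jet_pderiv_x hs]
    rcases Nat.mod_two_eq_zero_or_one (a + 1 + 1 + b + l.length) with h | h
    · exact hf.jet_two (by omega) (by omega)
    · exact hf.jet_odd h

end Normalized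

/-! ### Division by monomials of higher degree -/

/-- A smooth function of two variables with the parity of `d` and of order `d` at the origin is a
combination of the monomials of degree `d` with even smooth coefficients. -/
theorem exists_division (d : ℕ) : ∀ {h : ℝ × ℝ → ℝ}, ContDiff ℝ ∞ h →
    (∀ p, h (-p) = (-1) ^ d * h p) → (h =O[𝓝 0] fun p => ‖p‖ ^ d) →
    ∃ q : ℕ → ℝ × ℝ → ℝ, (∀ i, ContDiff ℝ ∞ (q i)) ∧ (∀ i p, q i (-p) = q i p) ∧
      ∀ p, h p = ∑ i ∈ Finset.range (d + 1), p.1 ^ (d - i) * p.2 ^ i * q i p := by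
  induction d using Nat.twoStepInduction with
  | zero =>
    intro h hh hp _
    exact ⟨fun _ => h, fun _ => hh, fun _ p => by simpa using hp p, fun p => by simp⟩
  | one =>
    intro h hh hp _
    obtain ⟨a, b, ha, hb, hae, hbe, hab⟩ := exists_division_odd hh fun p => by simpa using hp p
    refine ⟨fun i => if i = 0 then a else b, fun i => ?_, fun i p => ?_, fun p => ?_⟩
    · beta_reduce; split_ifs <;> assumption
    · beta_reduce; split_ifs
      · exact hae p
      · exact hbe p
    · simp [Finset.sum_range_succ, hab p]
  | more d ih _ =>
    intro h hh hp hO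
    have hn : Tendsto (fun p : ℝ × ℝ => ‖p‖) (𝓝 0) (𝓝 0) := tendsto_norm_zero
    obtain ⟨q, hq, hqe, hqh⟩ := ih hh (fun p => by rw [hp, pow_add]; simp)
      (hO.trans (isBigO_pow_of_le hn (by omega)))
    have hq0 : ∀ i ∈ Finset.range (d + 1), q i 0 = 0 := fun i hi =>
      coeff_eq_zero_of_isBigO (fun i => (hq i).continuous.continuousAt)
        ((hO.trans (isBigO_pow_of_le hn (by omega : d + 1 ≤ d + 2))).congr_left hqh)
        (Nat.lt_succ_iff.1 (Finset.mem_range.1 hi))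
    have hdiv : ∀ i, ∃ abc : (ℝ × ℝ → ℝ) × (ℝ × ℝ → ℝ) × (ℝ × ℝ → ℝ), ContDiff ℝ ∞ abc.1 ∧
        ContDiff ℝ ∞ abc.2.1 ∧ ContDiff ℝ ∞ abc.2.2 ∧ (∀ p, abc.1 (-p) = abc.1 p) ∧
        (∀ p, abc.2.1 (-p) = abc.2.1 p) ∧ (∀ p, abc.2.2 (-p) = abc.2.2 p) ∧
        ∀ p, q i p - q i 0 = p.1 ^ 2 * abc.1 p + p.1 * p.2 * abc.2.1 p + p.2 ^ 2 * abc.2.2 p := by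
      intro i
      obtain ⟨a, b, c, ha, hb, hc, h1, h2, h3, h4⟩ := exists_division_even
        (h := fun p => q i p - q i 0) ((hq i).sub contDiff_const)
        (fun p => by simp [hqe]) (by simp)
      exact ⟨(a, b, c), ha, hb, hc, h1, h2, h3, h4⟩
    choose abc ha hb hc hae hbe hce habc using hdiv
    refine ⟨fun j p => ∑ i ∈ Finset.range (d + 1), ((if j = i then (abc i).1 p else 0) +
      (if j = i + 1 then (abc i).2.1 p else 0) + (if j = i + 2 then (abc i).2.2 p else 0)),
      fun j => ?_, fun j p => ?_, fun p => ?_⟩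
    · refine ContDiff.sum fun i _ => (ContDiff.add ?_ ?_).add ?_
      · split_ifs
        · exact ha i
        · exact contDiff_const
      · split_ifs
        · exact hb i
        · exact contDiff_const
      · split_ifs
        · exact hc i
        · exact contDiff_const
    · simp only [hae, hbe, hce]
    · simp only [Finset.mul_sum]
      rw [Finset.sum_comm, hqh p]
      refine Finset.sum_congr rfl fun i hi => ?_
      have hi' : i ≤ d := Nat.lt_succ_iff.1 (Finset.mem_range.1 hi)
      have h1 := habc i p
      rw [hq0 i hi, sub_zero] at h1
      simp only [mul_add, Finset.sum_add_distrib, mul_ite, mul_zero, Finset.sum_ite_eq',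
        Finset.mem_range]
      rw [if_pos (by omega), if_pos (by omega), if_pos (by omega), h1,
        show d + 2 - i = d - i + 2 by omega, show d + 2 - (i + 1) = d - i + 1 by omega,
        show d + 2 - (i + 2) = d - i by omega]
      ring

/-! ### Critical curves -/

/-- `t ↦ (X t, t, Z t)` is a curve, tangent to the `k₂`-axis to third order, along which the
derivatives of `f` in the directions other than `k₂` vanish. -/
structure IsCritCurve {n : ℕ} (f : Coord n → ℝ) (X : ℝ → ℝ) (Z : ℝ → Fin n → ℝ) : Prop where
  smooth_x : ContDiff ℝ ∞ X
  smooth_z : ContDiff ℝ ∞ Z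
  odd_x : ∀ t, X (-t) = -X t
  odd_z : ∀ t, Z (-t) = -Z t
  order_x : X =O[𝓝 0] fun t : ℝ => t ^ 3
  order_z : Z =O[𝓝 0] fun t : ℝ => t ^ 3
  crit_x : ∀ᶠ t in 𝓝 0, pderivCoord 0 f (pt (X t) t (Z t)) = 0
  crit_z : ∀ᶠ t in 𝓝 0, ∀ i : Fin n, pderivCoord i.succ.succ f (pt (X t) t (Z t)) = 0

namespace Normalized

variable {n : ℕ} {ε η : ℝ} {f : Coord n → ℝ} {x x' : ℝ → ℝ} {z z' : ℝ → Fin n → ℝ}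

/-- Points of the segments between two curves are as close to one of them as the curves are to each
other. -/
theorem isBigO_segment {E : Type*} [NormedAddCommGroup E] [NormedSpace ℝ E] {u u' : ℝ → E}
    {s : ℝ → ℝ} (hs : ∀ t, s t ∈ Icc (0 : ℝ) 1) {p : ℕ}
    (hu : (fun t => u t - u' t) =O[𝓝 0] fun t : ℝ => t ^ p) :
    (fun t => s t • (u t - u' t)) =O[𝓝 0] fun t : ℝ => t ^ p := by
  refine IsBigO.trans ?_ hu
  refine IsBigO.of_bound 1 (Eventually.of_forall fun t => ?_)
  rw [norm_smul, Real.norm_eq_abs, abs_of_nonneg (hs t).1]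
  exact mul_le_mul_of_nonneg_right (hs t).2 (norm_nonneg _)

/-- The increment of `∂f/∂x` between two curves that are tangent to the `y`-axis to third order:
the mixed derivatives `∂²f/∂x∂z` are of the second order there. -/
theorem isBigO_pderiv_x_sub (hf : Normalized ε η f) (hx : x =O[𝓝 0] fun t : ℝ => t ^ 3)
    (hx' : x' =O[𝓝 0] fun t : ℝ => t ^ 3) (hz : z =O[𝓝 0] fun t : ℝ => t ^ 3)
    (hz' : z' =O[𝓝 0] fun t : ℝ => t ^ 3) {p q N : ℕ}
    (hwx : (fun t => x t - x' t) =O[𝓝 0] fun t : ℝ => t ^ p)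
    (hwz : (fun t => z t - z' t) =O[𝓝 0] fun t : ℝ => t ^ q) (h1 : N ≤ p + 4) (h2 : N ≤ q + 2) :
    (fun t => pderivCoord 0 f (pt (x t) t (z t)) - pderivCoord 0 f (pt (x' t) t (z' t)) -
      2 * η * t ^ 2 * (x t - x' t)) =O[𝓝 0] fun t : ℝ => t ^ N := by
  choose s hs he using fun t => exists_mean_value (contDiff_pderivCoord hf.smooth 0) (x t) (x' t) t
    (z t) (z' t)
  have hr : Tendsto (fun t : ℝ => t) (𝓝 0) (𝓝 0) := tendsto_id
  have hxs : (fun t => x' t + s t * (x t - x' t)) =O[𝓝 0] fun t : ℝ => t ^ 3 :=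
    hx'.add (isBigO_segment hs (hx.sub hx'))
  have hzs : (fun t => z' t + s t • (z t - z' t)) =O[𝓝 0] fun t : ℝ => t ^ 3 :=
    hz'.add (isBigO_segment hs (hz.sub hz'))
  have hA := hf.isBigO_pderiv_xx hr hxs (isBigO_refl _ _) hzs
  have h31 : ∀ {E : Type} [NormedAddCommGroup E] {F : ℝ → E}, (F =O[𝓝 0] fun t : ℝ => t ^ 3) →
      F =O[𝓝 0] fun t : ℝ => t := fun h => by
    simpa using IsBigO.pow_mono h (by norm_num : 1 ≤ 3)
  have hB : ∀ i : Fin n, (fun t => (z t i - z' t i) * pderivCoord i.succ.succ (pderivCoord 0 f)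
      (pt (x' t + s t * (x t - x' t)) t (z' t + s t • (z t - z' t)))) =O[𝓝 0]
      fun t : ℝ => t ^ N := by
    intro i
    have h3 := hf.isBigO_pderiv_pderiv hr (h31 hxs) (isBigO_refl _ _) (h31 hzs) i.succ.succ 0
    have h0 : pderivCoord i.succ.succ (pderivCoord 0 f) 0 = 0 := by
      rw [pderivCoord_comm hf.smooth, ← jet_zero (pderivCoord _ _), jet_pderiv_x (contDiff_pderivCoord hf.smooth _),
        jet_pderiv_z hf.smooth]
      exact hf.jet_two (by simp) (by simp)
    simp only [h0, sub_zero] at h3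
    refine (((isBigO_pi_apply hwz i).mul h3).congr_right fun t => (pow_add t q 2).symm).trans
      (isBigO_pow_id h2)
  have hA' := ((hwx.mul hA).congr_right fun t => (pow_add t p 4).symm).trans (isBigO_pow_id h1)
  refine (hA'.add (IsBigO.fun_sum (s := Finset.univ) fun i _ => hB i)).congr_left fun t => ?_
  rw [he t]
  ring

/-- The increment of `∂f/∂z` between two curves that are tangent to the `y`-axis to third order is
given by the Hessian block, up to terms of relative order two. -/
theorem isBigO_pderiv_z_sub (hf : Normalized ε η f) (hx : x =O[𝓝 0] fun t : ℝ => t ^ 3)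
    (hx' : x' =O[𝓝 0] fun t : ℝ => t ^ 3) (hz : z =O[𝓝 0] fun t : ℝ => t ^ 3)
    (hz' : z' =O[𝓝 0] fun t : ℝ => t ^ 3) {p q N : ℕ}
    (hwx : (fun t => x t - x' t) =O[𝓝 0] fun t : ℝ => t ^ p)
    (hwz : (fun t => z t - z' t) =O[𝓝 0] fun t : ℝ => t ^ q) (h1 : N ≤ p + 2) (h2 : N ≤ q + 2)
    (i : Fin n) :
    (fun t => pderivCoord i.succ.succ f (pt (x t) t (z t)) -
      pderivCoord i.succ.succ f (pt (x' t) t (z' t)) - (jetZZ f 0 0 *ᵥ (z t - z' t)) i)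
      =O[𝓝 0] fun t : ℝ => t ^ N := by
  choose s hs he using fun t => exists_mean_value (contDiff_pderivCoord hf.smooth i.succ.succ)
    (x t) (x' t) t (z t) (z' t)
  have hr : Tendsto (fun t : ℝ => t) (𝓝 0) (𝓝 0) := tendsto_id
  have h31 : ∀ {E : Type} [NormedAddCommGroup E] {F : ℝ → E}, (F =O[𝓝 0] fun t : ℝ => t ^ 3) →
      F =O[𝓝 0] fun t : ℝ => t := fun h => by
    simpa using IsBigO.pow_mono h (by norm_num : 1 ≤ 3)
  have hxs : (fun t => x' t + s t * (x t - x' t)) =O[𝓝 0] fun t : ℝ => t :=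
    h31 (hx'.add (isBigO_segment hs (hx.sub hx')))
  have hzs : (fun t => z' t + s t • (z t - z' t)) =O[𝓝 0] fun t : ℝ => t :=
    h31 (hz'.add (isBigO_segment hs (hz.sub hz')))
  have hA := hf.isBigO_pderiv_pderiv hr hxs (isBigO_refl _ _) hzs 0 i.succ.succ
  have h0 : pderivCoord 0 (pderivCoord i.succ.succ f) 0 = 0 := by
    rw [← jet_zero (pderivCoord _ _), jet_pderiv_x (contDiff_pderivCoord hf.smooth _), jet_pderiv_z hf.smooth]
    exact hf.jet_two (by simp) (by simp)
  simp only [h0, sub_zero] at hA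
  have hB : ∀ j : Fin n, (fun t => (z t j - z' t j) *
      (pderivCoord j.succ.succ (pderivCoord i.succ.succ f)
        (pt (x' t + s t * (x t - x' t)) t (z' t + s t • (z t - z' t))) - jet f 0 0 [i, j])) =O[𝓝 0]
      fun t : ℝ => t ^ N := by
    intro j
    have h3 := hf.isBigO_pderiv_pderiv hr hxs (isBigO_refl _ _) hzs j.succ.succ i.succ.succ
    have h0 : pderivCoord j.succ.succ (pderivCoord i.succ.succ f) 0 = jet f 0 0 [i, j] := by
      rw [← jet_zero (pderivCoord _ _), jet_pderiv_z (contDiff_pderivCoord hf.smooth _), jet_pderiv_z hf.smooth]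
    rw [h0] at h3
    refine (((isBigO_pi_apply hwz j).mul h3).congr_right fun t => (pow_add t q 2).symm).trans
      (isBigO_pow_id h2)
  have hA' := ((hwx.mul hA).congr_right fun t => (pow_add t p 2).symm).trans (isBigO_pow_id h1)
  refine (hA'.add (IsBigO.fun_sum (s := Finset.univ) fun i _ => hB i)).congr_left fun t => ?_
  rw [he t]
  simp only [mul_sub, Finset.sum_sub_distrib, Matrix.mulVec, dotProduct, jetZZ, Matrix.of_apply,
    Pi.sub_apply]
  have : ∑ j, jet f 0 0 [i, j] * z t j - ∑ j, jet f 0 0 [i, j] * z' t j =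
      ∑ j, (z t j - z' t j) * jet f 0 0 [i, j] := by
    rw [← Finset.sum_sub_distrib]
    exact Finset.sum_congr rfl fun j _ => by ring
  rw [this]
  ring

/-- Along a critical curve the function is stationary: a perturbation of the curve changes its
values by a quantity of the second order. -/
theorem isBigO_sub_of_crit (hf : Normalized ε η f) {X : ℝ → ℝ} {Z : ℝ → Fin n → ℝ}
    (hc : IsCritCurve f X Z) (hx : x =O[𝓝 0] fun t : ℝ => t ^ 3)
    (hz : z =O[𝓝 0] fun t : ℝ => t ^ 3) {p q N : ℕ}
    (hwx : (fun t => x t - X t) =O[𝓝 0] fun t : ℝ => t ^ p)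
    (hwz : (fun t => z t - Z t) =O[𝓝 0] fun t : ℝ => t ^ q) (h1 : N ≤ 2 * p + 2)
    (h2 : N ≤ p + q + 2) (h3 : N ≤ 2 * q) :
    (fun t => f (pt (x t) t (z t)) - f (pt (X t) t (Z t))) =O[𝓝 0] fun t : ℝ => t ^ N := by
  choose s hs he using fun t => exists_mean_value hf.smooth (x t) (X t) t (z t) (Z t)
  have hsx : (fun t => s t * (x t - X t)) =O[𝓝 0] fun t : ℝ => t ^ p := isBigO_segment hs hwx
  have hsz : (fun t => s t • (z t - Z t)) =O[𝓝 0] fun t : ℝ => t ^ q := isBigO_segment hs hwz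
  have hxs : (fun t => X t + s t * (x t - X t)) =O[𝓝 0] fun t : ℝ => t ^ 3 :=
    hc.order_x.add (isBigO_segment hs (hx.sub hc.order_x))
  have hzs : (fun t => Z t + s t • (z t - Z t)) =O[𝓝 0] fun t : ℝ => t ^ 3 :=
    hc.order_z.add (isBigO_segment hs (hz.sub hc.order_z))
  have hsx' : (fun t => X t + s t * (x t - X t) - X t) =O[𝓝 0] fun t : ℝ => t ^ p :=
    hsx.congr_left fun t => by ring
  have hsz' : (fun t => Z t + s t • (z t - Z t) - Z t) =O[𝓝 0] fun t : ℝ => t ^ q :=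
    hsz.congr_left fun t => by simp
  have hA := hf.isBigO_pderiv_x_sub hxs hc.order_x hzs hc.order_z hsx' hsz'
    (N := min (p + 2) (q + 2)) (by omega) (by omega)
  have hA2 : (fun t => pderivCoord 0 f (pt (X t + s t * (x t - X t)) t (Z t + s t • (z t - Z t))))
      =O[𝓝 0] fun t : ℝ => t ^ min (p + 2) (q + 2) := by
    have h4 : (fun t => 2 * η * t ^ 2 * (X t + s t * (x t - X t) - X t)) =O[𝓝 0]
        fun t : ℝ => t ^ min (p + 2) (q + 2) :=
      ((((isBigO_refl (fun t : ℝ => t ^ 2) (𝓝 0)).const_mul_left (2 * η)).mul hsx').congr_right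
        fun t => (pow_add t 2 p).symm).trans (isBigO_pow_id (by omega))
    refine (hA.add h4).congr' ?_ EventuallyEq.rfl
    filter_upwards [hc.crit_x] with t ht
    rw [ht]; ring
  have hB2 : ∀ i : Fin n, (fun t => pderivCoord i.succ.succ f
      (pt (X t + s t * (x t - X t)) t (Z t + s t • (z t - Z t)))) =O[𝓝 0]
        fun t : ℝ => t ^ min (p + 2) q := by
    intro i
    have hB := hf.isBigO_pderiv_z_sub hxs hc.order_x hzs hc.order_z hsx' hsz'
      (N := min (p + 2) q) (by omega) (by omega) i
    have h4 : (fun t => (jetZZ f 0 0 *ᵥ (Z t + s t • (z t - Z t) - Z t)) i) =O[𝓝 0]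
        fun t : ℝ => t ^ min (p + 2) q := by
      simp only [Matrix.mulVec, dotProduct]
      refine IsBigO.fun_sum fun j _ => IsBigO.const_mul_left ?_ _
      exact IsBigO.pow_mono (isBigO_pi_apply hsz' j) (by omega)
    refine (hB.add h4).congr' ?_ EventuallyEq.rfl
    filter_upwards [hc.crit_z] with t ht
    rw [ht i]; ring
  have hA3 := ((hwx.mul hA2).congr_right fun t => (pow_add t _ _).symm).trans
    (isBigO_pow_id (m := N) (by omega))
  have hB3 := fun i => (((isBigO_pi_apply hwz i).mul (hB2 i)).congr_right
    fun t => (pow_add t _ _).symm).trans (isBigO_pow_id (m := N) (by omega))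
  refine (hA3.add (IsBigO.fun_sum (s := Finset.univ) fun i _ => hB3 i)).congr_left fun t => ?_
  rw [he t]
  rfl

end Normalized

/-! ### Existence of critical curves -/

theorem hasFDerivAt_of_isBigO_sq {E G : Type*} [NormedAddCommGroup E] [NormedSpace ℝ E]
    [NormedAddCommGroup G] [NormedSpace ℝ G] {F : E → G} {L : E →L[ℝ] G}
    (h : (fun u => F u - L u) =O[𝓝 0] fun u => ‖u‖ ^ 2) : HasFDerivAt F L 0 := by
  have h1 : HasFDerivAt (fun u => F u - L u) (0 : E →L[ℝ] G) 0 :=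
    IsBigO.hasFDerivAt (n := 2) (by simpa using h) (by norm_num)
  have h2 := h1.add L.hasFDerivAt
  rw [zero_add] at h2
  exact h2.congr_of_eventuallyEq (Eventually.of_forall fun u => by simp)

/-- The linear equivalence given by the Hessian in the directions `k₃, …, k_ν`. -/
theorem EvenCorankTwo.exists_hessEquiv {n : ℕ} {f : Coord n → ℝ} (hf : EvenCorankTwo f) :
    ∃ L : (Fin n → ℝ) ≃L[ℝ] (Fin n → ℝ), ∀ z, L z = jetZZ f 0 0 *ᵥ z := by
  refine ⟨(LinearEquiv.ofLinearMap (Matrix.mulVecLin (jetZZ f 0 0)) (Matrix.mulVecLin (hessInv f))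
    ?_ ?_).toContinuousLinearEquiv, fun z => rfl⟩
  · rw [← Matrix.mulVecLin_mul, hf.mul_hessInv, Matrix.mulVecLin_one]
  · rw [← Matrix.mulVecLin_mul, hf.hessInv_mul, Matrix.mulVecLin_one]

theorem isBigO_of_mulVec {τ : Type*} {l : Filter τ} {n : ℕ} (M : Matrix (Fin n) (Fin n) ℝ)
    {z : τ → Fin n → ℝ} {g : τ → ℝ} (hz : z =O[l] g) : (fun e => M *ᵥ z e) =O[l] g := by
  refine isBigO_pi.2 fun i => ?_
  simp only [Matrix.mulVec, dotProduct]
  exact IsBigO.fun_sum fun j _ => IsBigO.const_mul_left (isBigO_pi_apply hz j) _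

theorem isBigO_norm_of_contDiff {E G : Type*} [NormedAddCommGroup E] [NormedSpace ℝ E]
    [NormedAddCommGroup G] [NormedSpace ℝ G] {F : E → G} (hF : ContDiff ℝ ∞ F) (h0 : F 0 = 0) :
    F =O[𝓝 0] fun u => ‖u‖ := by
  have := ((hF.differentiable (by simp) 0).hasFDerivAt).isBigO_sub
  simpa [h0] using this.norm_right

/-- The equations `∂f/∂z = 0` define `z` as a function of `(x, y)`, of third order. -/
theorem EvenCorankTwo.exists_fiber_crit {n : ℕ} {f : Coord n → ℝ} (hf : EvenCorankTwo f) :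
    ∃ ζ : ℝ × ℝ → Fin n → ℝ, ContDiff ℝ ∞ ζ ∧ (∀ p, ζ (-p) = -ζ p) ∧
      (ζ =O[𝓝 0] fun p => ‖p‖ ^ 3) ∧
      ∀ᶠ p in 𝓝 0, ∀ i : Fin n, pderivCoord i.succ.succ f (pt p.1 p.2 (ζ p)) = 0 := by
  obtain ⟨L, hL⟩ := hf.exists_hessEquiv
  let F : (Fin n → ℝ) × (ℝ × ℝ) → Fin n → ℝ := fun q i =>
    pderivCoord i.succ.succ f (pt q.2.1 q.2.2 q.1)
  have hF : ContDiff ℝ ∞ F := contDiff_pi.2 fun i =>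
    (contDiff_pderivCoord hf.smooth i.succ.succ).comp
      (ContDiff.pt (by fun_prop) (by fun_prop) (by fun_prop))
  have hodd : ∀ (i : Fin n) k, pderivCoord i.succ.succ f (-k) = -pderivCoord i.succ.succ f k :=
    fun i k => by simpa using pderivCoord_neg (σ := 1) hf.smooth (by simpa using hf.even) i.succ.succ k
  have h0 : F (0, 0) = 0 := by
    ext i
    simpa [F] using map_zero_of_odd (hodd i)
  have hderiv : HasFDerivAt (fun u => F (u, 0)) (L : (Fin n → ℝ) →L[ℝ] (Fin n → ℝ)) 0 := by
    refine hasFDerivAt_of_isBigO_sq (isBigO_pi.2 fun i => ?_)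
    have := hf.isBigO_pderiv_z (l := 𝓝 (0 : Fin n → ℝ)) (r := fun u => ‖u‖) tendsto_norm_zero
      (x := fun _ => 0) (y := fun _ => 0) (z := fun u => u) (isBigO_zero _ _) (isBigO_zero _ _)
      (isBigO_refl _ _).norm_right i
    refine (this.trans (isBigO_pow_of_le tendsto_norm_zero (by norm_num : 2 ≤ 3))).congr_left
      fun u => ?_
    simp [F, hL]
  obtain ⟨ζ, hζ, hζo, hζ0, hζe⟩ := exists_implicit_parity hF h0 L hderiv (σ := -1) (Or.inr rfl)
    (by simp) (fun u k h => by
      ext i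
      have := congrFun h i
      simp only [F, Pi.zero_apply] at this ⊢
      have h2 : pt (-k).1 (-k).2 ((-1 : ℝ) • u) = -pt k.1 k.2 u := by
        rw [neg_pt]; simp
      rw [h2, hodd, this, neg_zero])
  have hcrit : ∀ᶠ p in 𝓝 0, ∀ i : Fin n, pderivCoord i.succ.succ f (pt p.1 p.2 (ζ p)) = 0 := by
    filter_upwards [hζe] with p hp i
    exact congrFun hp i
  refine ⟨ζ, hζ, fun p => by simpa using hζo p, ?_, hcrit⟩
  have h1 : ζ =O[𝓝 0] fun p => ‖p‖ := isBigO_norm_of_contDiff hζ hζ0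
  have h2 : (fun p => jetZZ f 0 0 *ᵥ ζ p) =O[𝓝 0] fun p => ‖p‖ ^ 3 := by
    refine isBigO_pi.2 fun i => ?_
    have := hf.isBigO_pderiv_z (l := 𝓝 (0 : ℝ × ℝ)) (r := fun p => ‖p‖) tendsto_norm_zero
      (x := Prod.fst) (y := Prod.snd) (z := ζ) isBigO_fst_prod'.norm_right
      isBigO_snd_prod'.norm_right h1 i
    refine this.neg_left.congr' ?_ EventuallyEq.rfl
    filter_upwards [hcrit] with p hp
    rw [hp i]; ring
  refine (isBigO_of_mulVec (hessInv f) h2).congr_left fun p => ?_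
  rw [Matrix.mulVec_mulVec, hf.hessInv_mul, Matrix.one_mulVec]

/-- On the surface `∂f/∂z = 0`, the equation `∂f/∂x = 0` has a solution `x = O(y³)`. -/
theorem Normalized.exists_critCurve {n : ℕ} {ε η : ℝ} (hη : IsSign η) {f : Coord n → ℝ}
    (hf : Normalized ε η f) {ζ : ℝ × ℝ → Fin n → ℝ} (hζ : ContDiff ℝ ∞ ζ)
    (hζo : ∀ p, ζ (-p) = -ζ p) (hζ3 : ζ =O[𝓝 0] fun p => ‖p‖ ^ 3)
    (hζc : ∀ᶠ p in 𝓝 0, ∀ i : Fin n, pderivCoord i.succ.succ f (pt p.1 p.2 (ζ p)) = 0) :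
    ∃ X : ℝ → ℝ, IsCritCurve f X (fun t => ζ (X t, t)) := by
  have hηη : η * η = 1 := by rcases hη with rfl | rfl <;> norm_num
  have hη0 : η ≠ 0 := by rintro rfl; simp at hηη
  let gx : ℝ × ℝ → ℝ := fun p => pderivCoord 0 f (pt p.1 p.2 (ζ p))
  have hgx : ContDiff ℝ ∞ gx := (contDiff_pderivCoord hf.smooth 0).comp
    (ContDiff.pt contDiff_fst contDiff_snd hζ)
  have hodd : ∀ p, gx (-p) = -gx p := fun p => by
    have h1 := pderivCoord_neg (σ := 1) hf.smooth (by simpa using hf.even) 0 (pt p.1 p.2 (ζ p))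
    rw [neg_pt] at h1
    simpa [gx, hζo] using h1
  have hn : Tendsto (fun p : ℝ × ℝ => ‖p‖) (𝓝 0) (𝓝 0) := tendsto_norm_zero
  have h1 : (fun p : ℝ × ℝ => p.1) =O[𝓝 0] fun p => ‖p‖ := isBigO_fst_prod'.norm_right
  have h2 : (fun p : ℝ × ℝ => p.2) =O[𝓝 0] fun p => ‖p‖ := isBigO_snd_prod'.norm_right
  have hexp := hf.isBigO_pderiv_x (l := 𝓝 (0 : ℝ × ℝ)) hn h1 h2 hζ3
  have hcub : (fun p : ℝ × ℝ => 4 * ε * p.1 ^ 3 + 2 * η * p.1 * p.2 ^ 2) =O[𝓝 0]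
      fun p => ‖p‖ ^ 3 := by
    refine IsBigO.add ((h1.pow 3).const_mul_left _) ?_
    exact ((h1.mul (h2.pow 2)).const_mul_left (2 * η)).congr (fun p => by ring) (fun p => by ring)
  have hgx3 : gx =O[𝓝 0] fun p => ‖p‖ ^ 3 :=
    ((hexp.trans (isBigO_pow_of_le hn (by norm_num))).add hcub).congr_left fun p => by ring
  obtain ⟨q, hq, hqe, hgq⟩ := exists_division 3 hgx (fun p => by rw [hodd]; ring) hgx3
  let c : ℕ → ℝ := fun i => if i = 0 then 4 * ε else if i = 2 then 2 * η else 0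
  have hqc : ∀ i, i ≤ 3 → q i 0 - c i = 0 := fun i hi =>
    coeff_eq_zero_of_isBigO (d := 3) (q := fun i p => q i p - c i)
      (fun i => (hq i).continuous.continuousAt.sub continuousAt_const)
      ((hexp.trans (isBigO_pow_of_le hn (by norm_num))).congr_left fun p => by
        have := hgq p
        simp only [gx] at this
        rw [this]
        simp [Finset.sum_range_succ, c]
        ring) hi
  have hq2 : q 2 0 = 2 * η := by simpa [c, sub_eq_zero] using hqc 2 (by norm_num)
  have hq3 : q 3 0 = 0 := by simpa [c] using hqc 3 (by norm_num)
  obtain ⟨c0, c1, c2, hc0, hc1, hc2, hc0e, hc1e, hc2e, hdiv⟩ :=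
    exists_division_even (hq 3) (hqe 3) hq3
  -- the equation for `ξ`, where `x = y³ ξ`, after division by `y⁵`
  let F : ℝ × ℝ → ℝ := fun u => u.2 ^ 4 * u.1 ^ 3 * q 0 (u.2 ^ 3 * u.1, u.2) +
    u.2 ^ 2 * u.1 ^ 2 * q 1 (u.2 ^ 3 * u.1, u.2) + u.1 * q 2 (u.2 ^ 3 * u.1, u.2) +
    u.2 ^ 4 * u.1 ^ 2 * c0 (u.2 ^ 3 * u.1, u.2) + u.2 ^ 2 * u.1 * c1 (u.2 ^ 3 * u.1, u.2) +
    c2 (u.2 ^ 3 * u.1, u.2)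
  have hF : ContDiff ℝ ∞ F := by
    have := hq 0
    have := hq 1
    have := hq 2
    fun_prop
  have hF0 : ∀ u : ℝ, F (u, 0) = 2 * η * u + c2 0 := fun u => by
    have h0 : ((0 : ℝ), (0 : ℝ)) = 0 := rfl
    simp [F, h0, hq2]
    ring
  let L : ℝ ≃L[ℝ] ℝ := ContinuousLinearEquiv.unitsEquivAut ℝ (Units.mk0 (2 * η) (by simpa))
  obtain ⟨ξ, hξ, hξe, -, hξF⟩ := exists_implicit_parity hF (u₀ := -(η * c2 0) / 2)
    (by rw [hF0]; linear_combination (-c2 0) * hηη) L (by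
      simp only [hF0]
      have h3 : HasFDerivAt (fun u : ℝ => L u + c2 0) (L : ℝ →L[ℝ] ℝ) (-(η * c2 0) / 2) :=
        (L.hasFDerivAt).add_const _
      refine h3.congr_of_eventuallyEq (Eventually.of_forall fun u => ?_)
      simp [L, mul_comm]) (σ := 1) (Or.inl rfl) (by simp) (fun u k h => by
      have e : ((-k) ^ 3 * u, -k) = -(k ^ 3 * u, k) := by ext <;> simp <;> ring
      have : F ((1 : ℝ) • u, -k) = F (u, k) := by
        simp only [F, one_smul, e, hqe, hc0e, hc1e, hc2e]
        ring
      rw [this, h])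
  let X : ℝ → ℝ := fun t => t ^ 3 * ξ t
  have hX : ContDiff ℝ ∞ X := by fun_prop
  have hX3 : X =O[𝓝 0] fun t : ℝ => t ^ 3 := by
    simpa using (isBigO_refl (fun t : ℝ => t ^ 3) (𝓝 0)).mul
      ((hξ.continuous.tendsto 0).isBigO_one ℝ)
  have hXo : ∀ t, X (-t) = -X t := fun t => by
    have := hξe t
    simp only [one_smul] at this
    simp only [X, this]; ring
  have hX0 : X 0 = 0 := by simp [X]
  have hcurve : Tendsto (fun t => (X t, t)) (𝓝 0) (𝓝 0) := by
    have : Continuous fun t => (X t, t) := by fun_prop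
    have h := this.tendsto 0
    rwa [hX0] at h
  have hp : (fun t => (X t, t)) =O[𝓝 0] fun t : ℝ => t :=
    (by simpa using IsBigO.pow_mono hX3 (by norm_num : 1 ≤ 3) : X =O[𝓝 0] fun t : ℝ => t).prod_left
      (isBigO_refl _ _)
  refine ⟨X, hX, by fun_prop, hXo, fun t => ?_, hX3, ?_, ?_, hcurve.eventually hζc⟩
  · rw [hXo, ← hζo]; rfl
  · exact (hζ3.comp_tendsto hcurve).trans (hp.norm_left.pow 3)
  · filter_upwards [hξF] with t ht
    have h3 := hgq (X t, t)
    have h4 := hdiv (X t, t)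
    simp only [Finset.sum_range_succ, Finset.sum_range_zero, zero_add, h4] at h3
    change gx (X t, t) = 0
    rw [h3]
    simp only [F] at ht
    simp only [X]
    norm_num
    linear_combination t ^ 5 * ht

/-! ### The planar normal form -/

/-- The equations for the coefficients `u = (κ, γ₀, γ₁, γ₂, α, β)` of the change of variables
`x' = x (1 + y² γ₀ + x y γ₁ + x² γ₂)`, `y' = y (1 + y² κ) + x² (α y + β x)` that is to carry
`ε x'⁴ + η x'² y'² + a y'^(2j+4)` to
`y^(2j+4) (a + y² τ) + x² (ε x² + η y² + ∑ x^(4-i) y^i q i)`: the first one compares the powers of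
`y`, the others the coefficients at `x² x^(4-i) y^i`. -/
def planarEqs (ε η a : ℝ) (j : ℕ) (τ : ℝ) (q : ℕ → ℝ) (x y : ℝ) (u : Fin 6 → ℝ) : Fin 6 → ℝ :=
  let P := 1 + y ^ 2 * u 0
  let γ := y ^ 2 * u 1 + x * y * u 2 + x ^ 2 * u 3
  let r := P + x ^ 2 * u 4
  let s := x ^ 2 * u 5
  let V := y ^ 2 * P ^ 2
  let U := (r * y + s * x) ^ 2
  let S := ∑ i ∈ Finset.range (j + 1), U ^ i * V ^ (j - i)
  let G := 4 + 6 * γ + 4 * γ ^ 2 + γ ^ 3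
  let E := (1 + γ) ^ 2
  let cyy := 2 * P * u 4
  let cxy := 2 * P * u 5
  let cxx := (u 4 * y + u 5 * x) ^ 2
  let Syy := P ^ 2 * V ^ j + r ^ 2 * S
  let Sxy := 2 * r * s * S
  let Sxx := s ^ 2 * S
  ![a * u 0 * ∑ i ∈ Finset.range (2 * (j + 2)), P ^ i - τ,
    η * (u 1 * (2 + γ) * P ^ 2 + u 0 * (1 + P)) + a * (cyy * Syy) - q 4,
    η * u 2 * (2 + γ) * P ^ 2 + a * (cyy * Sxy + cxy * Syy) - q 3,
    ε * G * u 1 + η * u 3 * (2 + γ) * P ^ 2 + η * E * cyy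
      + a * (cyy * Sxx + cxy * Sxy + cxx * Syy) - q 2,
    ε * G * u 2 + η * E * cxy + a * (cxy * Sxx + cxx * Sxy) - q 1,
    ε * G * u 3 + η * E * cxx + a * (cxx * Sxx) - q 0]

/-- A solution of `planarEqs` gives the coordinate change. With `P = 1 + y² κ`, `U = y'²` and
`V = (y P)²`, the difference `U - V` is divisible by `x²`, and
`U^(j+2) - V^(j+2) = (U - V) (V^(j+1) + U S)` for `S = ∑ U^i V^(j-i)`. -/
theorem eq_of_planarEqs {ε η a τ x y : ℝ} {j : ℕ} {q : ℕ → ℝ} {u : Fin 6 → ℝ}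
    (h : planarEqs ε η a j τ q x y u = 0) :
    ε * (x * (1 + (y ^ 2 * u 1 + x * y * u 2 + x ^ 2 * u 3))) ^ 4
      + η * (x * (1 + (y ^ 2 * u 1 + x * y * u 2 + x ^ 2 * u 3))) ^ 2
        * (y * (1 + y ^ 2 * u 0) + x ^ 2 * (y * u 4 + x * u 5)) ^ 2
      + a * (y * (1 + y ^ 2 * u 0) + x ^ 2 * (y * u 4 + x * u 5)) ^ (2 * (j + 2)) =
    y ^ (2 * (j + 2)) * (a + y ^ 2 * τ) + x ^ 2 * (ε * x ^ 2 + η * y ^ 2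
      + ∑ i ∈ Finset.range 5, x ^ (4 - i) * y ^ i * q i) := by
  have e0 := congrFun h 0
  have e1 := congrFun h 1
  have e2 := congrFun h 2
  have e3 := congrFun h 3
  have e4 := congrFun h 4
  have e5 := congrFun h 5
  simp only [planarEqs, Matrix.cons_val, Pi.zero_apply] at e0 e1 e2 e3 e4 e5
  clear h
  generalize u 0 = κ at *
  generalize u 1 = γ₀ at *
  generalize u 2 = γ₁ at *
  generalize u 3 = γ₂ at *
  generalize u 4 = α at *
  generalize u 5 = β at *
  obtain ⟨P, hP⟩ : ∃ P, P = 1 + y ^ 2 * κ := ⟨_, rfl⟩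
  obtain ⟨γ, hγ⟩ : ∃ γ, γ = y ^ 2 * γ₀ + x * y * γ₁ + x ^ 2 * γ₂ := ⟨_, rfl⟩
  simp only [← hP, ← hγ] at e0 e1 e2 e3 e4 e5 ⊢
  have hU : y * P + x ^ 2 * (y * α + x * β) = (P + x ^ 2 * α) * y + x ^ 2 * β * x := by ring
  rw [hU, pow_mul _ 2 (j + 2)]
  obtain ⟨U, hU'⟩ : ∃ U, U = ((P + x ^ 2 * α) * y + x ^ 2 * β * x) ^ 2 := ⟨_, rfl⟩
  obtain ⟨V, hV⟩ : ∃ V, V = y ^ 2 * P ^ 2 := ⟨_, rfl⟩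
  simp only [← hU', ← hV] at e1 e2 e3 e4 e5 ⊢
  have hgeo := mul_neg_geom_sum P (2 * (j + 2))
  have hgeo2 := (Commute.all U V).mul_geom_sum₂ (j + 2)
  rw [Finset.sum_range_succ'] at hgeo2
  have hS : ∑ k ∈ Finset.range (j + 1), U ^ (k + 1) * V ^ (j + 2 - 1 - (k + 1)) =
      U * ∑ i ∈ Finset.range (j + 1), U ^ i * V ^ (j - i) := by
    rw [Finset.mul_sum]
    refine Finset.sum_congr rfl fun i _ => ?_
    rw [show j + 2 - 1 - (i + 1) = j - i by omega]; ring
  rw [hS] at hgeo2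
  rw [show j + 2 - 1 - 0 = j + 1 by omega] at hgeo2
  generalize ∑ i ∈ Finset.range (j + 1), U ^ i * V ^ (j - i) = S at *
  generalize ∑ i ∈ Finset.range (2 * (j + 2)), P ^ i = g at *
  have hVm : V ^ (j + 2) = y ^ (2 * (j + 2)) * P ^ (2 * (j + 2)) := by rw [hV]; ring
  have hUm : U ^ (j + 2) = y ^ (2 * (j + 2)) * (1 + y ^ 2 * κ * g) + (U - V) * (V * V ^ j + U * S) := by
    have : P ^ (2 * (j + 2)) = 1 + y ^ 2 * κ * g := by
      linear_combination hgeo + g * hP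
    rw [← this, ← hVm]
    linear_combination -hgeo2
  rw [hUm]
  generalize V ^ j = W at *
  generalize y ^ (2 * (j + 2)) = Y at *
  simp only [Finset.sum_range_succ, Finset.sum_range_zero]
  norm_num
  have key : ε * (x * (1 + γ)) ^ 4 + η * (x * (1 + γ)) ^ 2 * U + a * ((U - V) * (V * W + U * S)) =
      x ^ 2 * (ε * x ^ 2 + η * y ^ 2 + (x ^ 4 * q 0 + x ^ 3 * y * q 1 + x ^ 2 * y ^ 2 * q 2
        + x * y ^ 3 * q 3 + y ^ 4 * q 4)) := by
    rw [hU', hV]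
    linear_combination x ^ 2 * (y ^ 4 * e1 + x * y ^ 3 * e2 + x ^ 2 * y ^ 2 * e3 + x ^ 3 * y * e4
      + x ^ 4 * e5) + (ε * x ^ 4 * (4 + 6 * γ + 4 * γ ^ 2 + γ ^ 3)
      + η * x ^ 2 * y ^ 2 * (2 + γ) * P ^ 2) * hγ + η * x ^ 2 * y ^ 2 * (1 + P) * hP
  linear_combination key + Y * y ^ 2 * e0

/-- The linear part of `planarEqs` at `x = y = 0`. -/
def planarLin (ε η a δ : ℝ) (m : ℕ) : (Fin 6 → ℝ) →ₗ[ℝ] (Fin 6 → ℝ) where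
  toFun u := ![2 * m * a * u 0, 2 * η * u 1 + 2 * η * u 0 + 4 * δ * u 4,
    2 * η * u 2 + 4 * δ * u 5, 4 * ε * u 1 + 2 * η * u 3 + 2 * η * u 4,
    4 * ε * u 2 + 2 * η * u 5, 4 * ε * u 3]
  map_add' u v := by ext i; fin_cases i <;> simp <;> ring
  map_smul' c u := by ext i; fin_cases i <;> simp <;> ring

/-- The equations at `x = y = 0` determine the coefficients. For `m = 2` the determinant has the
factor `1 - 4 ε a`, which vanishes when `ε x⁴ + η x² y² + a y⁴` is a square up to sign. -/
theorem planarLin_injective {ε η a δ : ℝ} {m : ℕ} (hε : IsSign ε) (hη : IsSign η) (ha : a ≠ 0)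
    (hm : m ≠ 0) (hδ : 4 * ε * δ ≠ 1) : Function.Injective (planarLin ε η a δ m) := by
  have hεε : ε * ε = 1 := by rcases hε with rfl | rfl <;> norm_num
  have hηη : η * η = 1 := by rcases hη with rfl | rfl <;> norm_num
  rw [← LinearMap.ker_eq_bot, LinearMap.ker_eq_bot']
  intro u h
  have e0 := congrFun h 0
  have e1 := congrFun h 1
  have e2 := congrFun h 2
  have e3 := congrFun h 3
  have e4 := congrFun h 4
  have e5 := congrFun h 5
  simp only [planarLin, LinearMap.coe_mk, AddHom.coe_mk, Matrix.cons_val, Pi.zero_apply]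
    at e0 e1 e2 e3 e4 e5
  have hm' : (m : ℝ) ≠ 0 := by exact_mod_cast hm
  have h0 : u 0 = 0 := by simpa [ha, hm'] using e0
  have h3 : u 3 = 0 := by linear_combination ε / 4 * e5 - u 3 * hεε
  have hδ' : (1 - 4 * ε * δ) ≠ 0 := fun h => hδ (by linarith)
  have h4 : u 4 = 0 := (mul_eq_zero.1 (by
    linear_combination η / 2 * e3 - ε * e1 - u 4 * hηη + (2 * ε * η) * h0 - η * η * h3 :
      (1 - 4 * ε * δ) * u 4 = 0)).resolve_left hδ'
  have h5 : u 5 = 0 := (mul_eq_zero.1 (by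
    linear_combination η / 2 * e4 - ε * e2 - u 5 * hηη :
      (1 - 4 * ε * δ) * u 5 = 0)).resolve_left hδ'
  have h1 : u 1 = 0 := by
    linear_combination η / 2 * e1 - u 1 * hηη - η * η * h0 - 2 * δ * η * h4
  have h2 : u 2 = 0 := by linear_combination η / 2 * e2 - u 2 * hηη - 2 * δ * η * h5
  ext i
  fin_cases i <;> assumption

/-- At `x = y = 0` the equations are affine in `u`. -/
theorem planarEqs_zero (ε η a : ℝ) (j : ℕ) (τ : ℝ) (q : ℕ → ℝ) (u : Fin 6 → ℝ) :
    planarEqs ε η a j τ q 0 0 u = planarLin ε η a (a * 0 ^ j) (j + 2) u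
      - ![τ, q 4, q 3, q 2, q 1, q 0] := by
  have hS : ∑ i ∈ Finset.range (j + 1), (0 : ℝ) ^ i * 0 ^ (j - i) = 0 ^ j := by
    rw [Finset.sum_eq_single 0]
    · simp
    · intro i _ hi; simp [hi]
    · simp
  ext i
  fin_cases i
  · simp [planarEqs, planarLin]; ring
  all_goals simp [planarEqs, planarLin, hS]; try first | ring1 | exact Or.inl (by ring1)

theorem planarEqs_neg (ε η a : ℝ) (j : ℕ) (τ : ℝ) (q : ℕ → ℝ) (x y : ℝ) (u : Fin 6 → ℝ) :
    planarEqs ε η a j τ q (-x) (-y) u = planarEqs ε η a j τ q x y u := by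
  have h (r s : ℝ) : (r * -y + s * -x) ^ 2 = (r * y + s * x) ^ 2 := by ring
  simp only [planarEqs, neg_sq, neg_mul_neg, h]

theorem contDiff_planarEqs (ε η a : ℝ) (j : ℕ) {τ : ℝ → ℝ} (hτ : ContDiff ℝ ∞ τ)
    {q : ℕ → ℝ × ℝ → ℝ} (hq : ∀ i, ContDiff ℝ ∞ (q i)) :
    ContDiff ℝ ∞ (fun w : (Fin 6 → ℝ) × (ℝ × ℝ) =>
      planarEqs ε η a j (τ w.2.2) (fun i => q i w.2) w.2.1 w.2.2 w.1) := by
  have := hq 0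
  have := hq 1
  have := hq 2
  have := hq 3
  have := hq 4
  have hu (i : Fin 6) : ContDiff ℝ ∞ fun w : (Fin 6 → ℝ) × (ℝ × ℝ) => w.1 i := by fun_prop
  have h0 := hu 0
  have h1 := hu 1
  have h2 := hu 2
  have h3 := hu 3
  have h4 := hu 4
  have h5 := hu 5
  refine contDiff_pi.2 fun i => ?_
  fin_cases i <;> simp [planarEqs] <;> fun_prop

/-- An even germ in the plane whose principal part is `ε x⁴ + η x² y² + a y^(2m)` is reduced to
this form by an odd change of variables that is tangent to the identity. If `m = 2`, the condition
on `a` excludes the squares of quadratic forms. -/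
theorem planar_normal_form {ε η a : ℝ} {j : ℕ} (hε : IsSign ε) (hη : IsSign η) (ha : a ≠ 0)
    (hj : j = 0 → 4 * ε * a ≠ 1) {τ : ℝ → ℝ} (hτ : ContDiff ℝ ∞ τ) (hτe : ∀ t, τ (-t) = τ t)
    {q : ℕ → ℝ × ℝ → ℝ} (hq : ∀ i, ContDiff ℝ ∞ (q i)) (hqe : ∀ i p, q i (-p) = q i p) :
    ∃ x' y' : ℝ × ℝ → ℝ, ContDiff ℝ ∞ x' ∧ ContDiff ℝ ∞ y' ∧ (∀ p, x' (-p) = -x' p) ∧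
      (∀ p, y' (-p) = -y' p) ∧ ((fun p => x' p - p.1) =O[𝓝 0] fun p => ‖p‖ ^ 2) ∧
      ((fun p => y' p - p.2) =O[𝓝 0] fun p => ‖p‖ ^ 2) ∧
      ∀ᶠ p in 𝓝 0, ε * x' p ^ 4 + η * x' p ^ 2 * y' p ^ 2 + a * y' p ^ (2 * (j + 2)) =
        p.2 ^ (2 * (j + 2)) * (a + p.2 ^ 2 * τ p.2) + p.1 ^ 2 * (ε * p.1 ^ 2 + η * p.2 ^ 2
          + ∑ i ∈ Finset.range 5, p.1 ^ (4 - i) * p.2 ^ i * q i p) := by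
  have hinj : Function.Injective (planarLin ε η a (a * 0 ^ j) (j + 2)) := by
    refine planarLin_injective hε hη ha (by omega) ?_
    rcases Nat.eq_zero_or_pos j with rfl | h
    · simpa [mul_assoc] using hj rfl
    · simp [h.ne']
  let L : (Fin 6 → ℝ) ≃L[ℝ] (Fin 6 → ℝ) :=
    (LinearEquiv.ofInjectiveEndo _ hinj).toContinuousLinearEquiv
  have hL : ∀ u, L u = planarLin ε η a (a * 0 ^ j) (j + 2) u := fun u => rfl
  let v : Fin 6 → ℝ := ![τ 0, q 4 0, q 3 0, q 2 0, q 1 0, q 0 0]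
  let F : (Fin 6 → ℝ) × (ℝ × ℝ) → (Fin 6 → ℝ) := fun w =>
      planarEqs ε η a j (τ w.2.2) (fun i => q i w.2) w.2.1 w.2.2 w.1
  have hF0 : ∀ u, F (u, 0) = L u - v := fun u => by
    simp only [F, Prod.fst_zero, Prod.snd_zero, planarEqs_zero, hL, v]
  obtain ⟨u, hu, hue, -, huF⟩ := exists_implicit_parity (F := F)
    (contDiff_planarEqs ε η a j hτ hq) (u₀ := L.symm v) (by simp [hF0]) L (by
      simp only [hF0]
      exact L.hasFDerivAt.sub_const _) (σ := 1) (Or.inl rfl) (by simp) (fun u k h => by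
      rw [← h]
      simp only [F, one_smul, Prod.fst_neg, Prod.snd_neg, hτe, hqe, planarEqs_neg])
  simp only [one_smul] at hue
  have hu' : ∀ i, ContDiff ℝ ∞ fun p => u p i := fun i => contDiff_pi.1 hu i
  have h0 := hu' 0
  have h1 := hu' 1
  have h2 := hu' 2
  have h3 := hu' 3
  have h4 := hu' 4
  have h5 := hu' 5
  have hp1 : (fun p : ℝ × ℝ => p.1) =O[𝓝 0] fun p => ‖p‖ := isBigO_fst_prod'.norm_right
  have hp2 : (fun p : ℝ × ℝ => p.2) =O[𝓝 0] fun p => ‖p‖ := isBigO_snd_prod'.norm_right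
  -- a function in the square of the maximal ideal
  have hsq : ∀ {w₁ w₂ c : ℝ × ℝ → ℝ}, (w₁ =O[𝓝 0] fun p => ‖p‖) → (w₂ =O[𝓝 0] fun p => ‖p‖) →
      ContDiff ℝ ∞ c → (fun p => w₁ p * w₂ p * c p) =O[𝓝 0] fun p => ‖p‖ ^ 2 := by
    intro w₁ w₂ c h1 h2 hc
    simpa [sq] using (h1.mul h2).mul ((hc.continuous.tendsto 0).isBigO_one ℝ)
  refine ⟨fun p => p.1 * (1 + (p.2 ^ 2 * u p 1 + p.1 * p.2 * u p 2 + p.1 ^ 2 * u p 3)),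
    fun p => p.2 * (1 + p.2 ^ 2 * u p 0) + p.1 ^ 2 * (p.2 * u p 4 + p.1 * u p 5),
    by fun_prop, by fun_prop, fun p => ?_, fun p => ?_, ?_, ?_, ?_⟩
  · simp only [hue, Prod.fst_neg, Prod.snd_neg]; ring
  · simp only [hue, Prod.fst_neg, Prod.snd_neg]; ring
  · exact (hsq hp1 hp2 (c := fun p => p.2 * u p 1 + p.1 * u p 2) (by fun_prop) |>.add
      (hsq hp1 hp1 (c := fun p => p.1 * u p 3) (by fun_prop))).congr_left fun p => by ring
  · exact (hsq hp2 hp2 (c := fun p => p.2 * u p 0) (by fun_prop) |>.add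
      (hsq hp1 hp1 (c := fun p => p.2 * u p 4 + p.1 * u p 5) (by fun_prop))).congr_left
        fun p => by ring
  · filter_upwards [huF] with p hp
    exact eq_of_planarEqs hp

/-! ### Existence of the normal form -/

/-- Second-order Hadamard lemma for an even function; `P` is a linear projection. -/
theorem exists_hadamard_sq {E : Type} [NormedAddCommGroup E] [NormedSpace ℝ E]
    [FiniteDimensional ℝ E] {f : E → ℝ} (hf : ContDiff ℝ ∞ f) (he : ∀ k, f (-k) = f k)
    (P : E →L[ℝ] E) (hP : ∀ k, P (P k) = P k) :
    ∃ M : E → (E →L[ℝ] E →L[ℝ] ℝ), ContDiff ℝ ∞ M ∧ (∀ k, M (-k) = M k) ∧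
      ∀ k, f k = f (P k) + fderiv ℝ f (P k) (k - P k) + M k (k - P k) (k - P k) := by
  obtain ⟨L, hL, hfL, hLP⟩ := exists_hadamard hf P hP
  obtain ⟨M, hM, hLM, -⟩ := exists_hadamard hL P hP
  have key : ∀ k, f k = f (P k) + fderiv ℝ f (P k) (k - P k) + M k (k - P k) (k - P k) :=
    fun k => by rw [hfL k, hLM k, hLP k, add_apply]; ring
  refine ⟨fun k => (1 / 2 : ℝ) • (M k + M (-k)), by fun_prop, fun k => ?_, fun k => ?_⟩
  · simp [add_comm]
  · have hd : ∀ x, fderiv ℝ f (-x) = -fderiv ℝ f x := fun x => by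
      have h := (hf.differentiable (by simp) (-x)).hasFDerivAt.comp x (hasFDerivAt_id x).neg
      have h2 : f ∘ Neg.neg = f := funext fun k => he k
      rw [h2] at h
      rw [h.fderiv]
      ext v
      simp
    have h1 := key k
    have h2 := key (-k)
    have h3 : -k - P (-k) = -(k - P k) := by rw [map_neg]; abel
    rw [he, h3, map_neg, he, hd] at h2
    simp only [map_neg, neg_apply, neg_neg] at h2
    simp only [smul_apply, add_apply, smul_eq_mul]
    linarith

theorem OddGerm.of_near_id {n : ℕ} {f g : Coord n → ℝ} {Φ : Coord n → Coord n}
    (hΦ : ContDiff ℝ ∞ Φ) (ho : ∀ k, Φ (-k) = -Φ k)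
    (hid : (fun k => Φ k - k) =O[𝓝 0] fun k => ‖k‖ ^ 2) (h : f =ᶠ[𝓝 0] g ∘ Φ) : OddGerm f g :=
  ⟨Φ, hΦ, ho, ⟨ContinuousLinearEquiv.refl ℝ _, hasFDerivAt_of_isBigO_sq hid⟩, h⟩

/-- A change of variables in the plane of `k₁, k₂`. -/
theorem OddGerm.of_planar {n : ℕ} {g g' : ℝ → ℝ → ℝ} {x' y' : ℝ × ℝ → ℝ} (hx : ContDiff ℝ ∞ x')
    (hy : ContDiff ℝ ∞ y') (hxo : ∀ p, x' (-p) = -x' p) (hyo : ∀ p, y' (-p) = -y' p)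
    (hxi : (fun p => x' p - p.1) =O[𝓝 0] fun p => ‖p‖ ^ 2)
    (hyi : (fun p => y' p - p.2) =O[𝓝 0] fun p => ‖p‖ ^ 2)
    (h : ∀ᶠ p in 𝓝 (0 : ℝ × ℝ), g p.1 p.2 = g' (x' p) (y' p)) (d : ℝ)
    (Q : QuadraticForm ℝ (Fin n → ℝ)) : OddGerm (splitForm d g Q) (splitForm d g' Q) := by
  let π : Coord n →L[ℝ] ℝ × ℝ := (ContinuousLinearMap.proj 0).prod (ContinuousLinearMap.proj 1)
  have hπ : ∀ k, π k = (k 0, k 1) := fun k => rfl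
  have hπ0 : Tendsto π (𝓝 0) (𝓝 0) := by simpa using π.continuous.tendsto 0
  have hπO : (fun k => ‖π k‖ ^ 2) =O[𝓝 0] fun k => ‖k‖ ^ 2 :=
    ((π.isBigO_id (𝓝 0)).norm_norm).pow 2
  refine OddGerm.of_near_id (Φ := fun k => pt (x' (k 0, k 1)) (y' (k 0, k 1)) (zpart k))
    (ContDiff.pt (by fun_prop) (by fun_prop) contDiff_zpart) (fun k => ?_) ?_ ?_
  · have : ((-k) 0, (-k) 1) = -(k 0, k 1) := rfl
    rw [this, hxo, hyo, neg_pt, zpart_neg]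
  · refine (isBigO_pt (x := fun k => x' (π k) - (π k).1) (y := fun k => y' (π k) - (π k).2)
      (z := fun _ : Coord n => (0 : Fin n → ℝ)) ((hxi.comp_tendsto hπ0).trans hπO)
      ((hyi.comp_tendsto hπ0).trans hπO) (isBigO_zero _ _)).congr_left fun k => ?_
    refine coord_ext ?_ ?_ ?_
    · simp [hπ]
    · simp [hπ]
    · ext i; simp [zpart]
  · filter_upwards [hπ0.eventually h] with k hk
    simp only [splitForm, Function.comp_apply, pt_zero, pt_one, pt_succ_succ]
    rw [hπ] at hk
    rw [← hk]
    rfl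

/-- The quadratic form `½ zᵀ H z`, where `H` is the Hessian of `f` in the directions
`k₃, …, k_ν`. -/
def hessForm {n : ℕ} (f : Coord n → ℝ) : QuadraticForm ℝ (Fin n → ℝ) :=
  ((1 / 2 : ℝ) • jetZZ f 0 0).toQuadraticForm'

theorem hessForm_apply {n : ℕ} (f : Coord n → ℝ) (z : Fin n → ℝ) :
    hessForm f z = 1 / 2 * (z ⬝ᵥ (jetZZ f 0 0 *ᵥ z)) := by
  simp [hessForm, Matrix.toQuadraticForm', Matrix.toLinearMap₂'_apply']

theorem dotProduct_hess_comm {n : ℕ} (f : Coord n → ℝ) (v w : Fin n → ℝ) :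
    v ⬝ᵥ (jetZZ f 0 0 *ᵥ w) = w ⬝ᵥ (jetZZ f 0 0 *ᵥ v) := by
  rw [Matrix.dotProduct_mulVec, ← Matrix.mulVec_transpose, (jetZZ_transpose f 0 0), dotProduct_comm]

theorem EvenCorankTwo.nondegenerate_hessForm {n : ℕ} {f : Coord n → ℝ} (hf : EvenCorankTwo f) :
    (hessForm f).Nondegenerate := by
  rw [QuadraticMap.nondegenerate_iff_radical_eq_bot, Submodule.eq_bot_iff]
  intro m hm
  obtain ⟨h0, h⟩ := QuadraticMap.mem_radical_iff'.1 hm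
  have h1 : jetZZ f 0 0 *ᵥ m = 0 := by
    refine (dotProduct_eq_zero_iff).1 fun w => ?_
    have h2 := h w
    rw [hessForm_apply] at h0 h2
    rw [hessForm_apply, Matrix.mulVec_add, add_dotProduct, dotProduct_add, dotProduct_add,
      dotProduct_hess_comm f m w] at h2
    rw [dotProduct_comm]
    linarith
  have h3 : hessInv f *ᵥ (jetZZ f 0 0 *ᵥ m) = 0 := by rw [h1, Matrix.mulVec_zero]
  rwa [Matrix.mulVec_mulVec, hf.hessInv_mul, Matrix.one_mulVec] at h3

theorem EvenCorankTwo.hessForm_add_mulVec {n : ℕ} {f : Coord n → ℝ} (hf : EvenCorankTwo f)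
    (S : Matrix (Fin n) (Fin n) ℝ) (z : Fin n → ℝ) :
    hessForm f (z + hessInv f *ᵥ (S *ᵥ z)) =
      hessForm f z + z ⬝ᵥ ((S + (1 / 2 : ℝ) • (Sᵀ * hessInv f * S)) *ᵥ z) := by
  have h1 : jetZZ f 0 0 *ᵥ (hessInv f *ᵥ (S *ᵥ z)) = S *ᵥ z := by
    rw [Matrix.mulVec_mulVec, hf.mul_hessInv, Matrix.one_mulVec]
  have h2 : z ⬝ᵥ ((Sᵀ * hessInv f * S) *ᵥ z) = (hessInv f *ᵥ (S *ᵥ z)) ⬝ᵥ (S *ᵥ z) := by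
    rw [Matrix.mul_assoc, ← Matrix.mulVec_mulVec, ← Matrix.mulVec_mulVec,
      Matrix.dotProduct_mulVec, Matrix.vecMul_transpose, dotProduct_comm]
  rw [hessForm_apply, hessForm_apply, Matrix.mulVec_add, h1, add_dotProduct, dotProduct_add,
    dotProduct_add, dotProduct_hess_comm f (hessInv f *ᵥ (S *ᵥ z)) z, h1, Matrix.add_mulVec, dotProduct_add,
    Matrix.smul_mulVec, dotProduct_smul, h2, smul_eq_mul]
  ring

/-- Splitting lemma: an odd change of the variables `k₃, …, k_ν` makes `f` the sum of a function
of `k₁, k₂` and a quadratic form. -/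
theorem EvenCorankTwo.oddGerm_split {n : ℕ} {f : Coord n → ℝ} (hf : EvenCorankTwo f)
    {ζ : ℝ × ℝ → Fin n → ℝ} (hζ : ContDiff ℝ ∞ ζ)
    (hζo : ∀ p, ζ (-p) = -ζ p) (hζ3 : ζ =O[𝓝 0] fun p => ‖p‖ ^ 3)
    (hζc : ∀ᶠ p in 𝓝 0, ∀ i : Fin n, pderivCoord i.succ.succ f (pt p.1 p.2 (ζ p)) = 0) :
    OddGerm f (splitForm (f 0) (fun x y => f (pt x y (ζ (x, y))) - f 0) (hessForm f)) := by
  have hζ' : ContDiff ℝ ∞ fun k : Coord n => ζ (k 0, k 1) := by fun_prop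
  let π : Coord n →L[ℝ] ℝ × ℝ := (ContinuousLinearMap.proj 0).prod (ContinuousLinearMap.proj 1)
  have hπ : ∀ k, π k = (k 0, k 1) := fun k => rfl
  have hπ0 : Tendsto π (𝓝 0) (𝓝 0) := by simpa using π.continuous.tendsto 0
  have hneg : ∀ k : Coord n, ζ ((-k) 0, (-k) 1) = -ζ (k 0, k 1) := fun k => hζo (k 0, k 1)
  -- the translation `z ↦ z - ζ(x, y)`
  let f₁ : Coord n → ℝ := fun k => f (pt (k 0) (k 1) (zpart k + ζ (k 0, k 1)))
  have hf₁ : ContDiff ℝ ∞ f₁ := hf.smooth.comp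
    (ContDiff.pt (by fun_prop) (by fun_prop) (contDiff_zpart.add hζ'))
  have hf₁e : ∀ k, f₁ (-k) = f₁ k := fun k => by
    have : pt ((-k) 0) ((-k) 1) (zpart (-k) + ζ ((-k) 0, (-k) 1)) =
        -pt (k 0) (k 1) (zpart k + ζ (k 0, k 1)) := by
      rw [neg_pt, hneg, zpart_neg, neg_add]; rfl
    simp only [f₁, this, hf.even]
  have hone : OddGerm f f₁ := by
    refine OddGerm.of_near_id (Φ := fun k => pt (k 0) (k 1) (zpart k - ζ (k 0, k 1)))
      (ContDiff.pt (by fun_prop) (by fun_prop) (contDiff_zpart.sub hζ')) (fun k => ?_) ?_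
      (Eventually.of_forall fun k => ?_)
    · rw [neg_pt, hneg, zpart_neg, neg_sub_neg, neg_sub]
      rfl
    · have h1 : (fun k => ζ (π k)) =O[𝓝 0] fun k : Coord n => ‖k‖ ^ 2 :=
        ((hζ3.comp_tendsto hπ0).trans (((π.isBigO_id (𝓝 0)).norm_norm).pow 3)).trans
          (isBigO_pow_of_le tendsto_norm_zero (by norm_num))
      refine (isBigO_pt (isBigO_zero _ _) (isBigO_zero _ _) h1.neg_left).congr_left fun k => ?_
      refine coord_ext ?_ ?_ ?_
      · simp
      · simp
      · ext i; simp [zpart, hπ]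
    · simp [f₁, pt_eta]
  refine hone.trans ?_
  -- Morse lemma with parameters
  let P : Coord n →L[ℝ] Coord n := ContinuousLinearMap.pi
    (Matrix.vecCons (ContinuousLinearMap.proj 0) (Matrix.vecCons (ContinuousLinearMap.proj 1) 0))
  have hP : ∀ k, P k = pt (k 0) (k 1) 0 := fun k => coord_ext rfl rfl rfl
  have hPs : ∀ k, k - P k = pt 0 0 (zpart k) := fun k => by
    rw [hP]
    refine coord_ext ?_ ?_ ?_
    · simp
    · simp
    · ext i; simp [zpart]
  obtain ⟨M, hM, hMe, hfM⟩ := exists_hadamard_sq hf₁ hf₁e P (fun k => by simp [hP])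
  have hsum : ∀ z : Fin n → ℝ, pt 0 0 z = ∑ i : Fin n, z i • (Pi.single i.succ.succ 1 : Coord n) :=
    fun z => by
    refine coord_ext ?_ ?_ ?_
    · simp [(Fin.succ_ne_zero _).symm]
    · simp [Fin.ext_iff]
    · ext i
      simp only [zpart, pt_succ_succ, Finset.sum_apply, Pi.smul_apply, Pi.single_apply,
        Fin.succ_inj, smul_eq_mul, mul_ite, mul_one, mul_zero, Finset.sum_ite_eq,
        Finset.mem_univ, if_true]
  let A : Coord n → Matrix (Fin n) (Fin n) ℝ := fun k => Matrix.of fun i j =>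
    M k (Pi.single i.succ.succ 1) (Pi.single j.succ.succ 1)
  have hA : ∀ k z, M k (pt 0 0 z) (pt 0 0 z) = z ⬝ᵥ (A k *ᵥ z) := fun k z => by
    rw [hsum]
    simp only [map_sum, map_smul, sum_apply, smul_apply, smul_eq_mul, A, Matrix.mulVec,
      dotProduct, Matrix.of_apply, Finset.mul_sum]
    rw [Finset.sum_comm]
    exact Finset.sum_congr rfl fun i _ => Finset.sum_congr rfl fun j _ => by ring
  -- the derivative along `z` vanishes
  have hd : ∀ᶠ k in 𝓝 (0 : Coord n), fderiv ℝ f₁ (P k) (k - P k) = 0 := by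
    filter_upwards [hπ0.eventually hζc] with k hk
    rw [hPs, hP, ← (hf₁.differentiable (by simp) _).lineDeriv_eq_fderiv]
    have : lineDeriv ℝ f₁ (pt (k 0) (k 1) 0) (pt 0 0 (zpart k)) =
        lineDeriv ℝ f (pt (k 0) (k 1) (ζ (k 0, k 1))) (pt 0 0 (zpart k)) := by
      unfold lineDeriv
      congr 1
      ext t
      refine congrArg f (coord_ext ?_ ?_ ?_)
      · simp
      · simp
      · ext i; simp [zpart]; ring
    rw [this, (hf.smooth.differentiable (by simp) _).lineDeriv_eq_fderiv, hsum, map_sum]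
    refine Finset.sum_eq_zero fun i _ => ?_
    rw [map_smul]
    have := hk i
    simp only [hπ, pderivCoord] at this
    rw [this, smul_zero]
  have hA0 : ∀ z, z ⬝ᵥ (A 0 *ᵥ z) = hessForm f z := fun z => by
    have h1 : ∀ t : ℝ, f (pt 0 0 (t • z)) = f 0 + t ^ 2 * (z ⬝ᵥ (A (pt 0 0 (t • z)) *ᵥ z)) :=
      fun t => by
      have h2 := hfM (pt 0 0 (t • z))
      have h3 : fderiv ℝ f₁ 0 = 0 := by
        ext v
        rw [fderiv_apply_eq_sum]
        exact Finset.sum_eq_zero fun i _ => by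
          rw [map_zero_of_odd (Φ := pderivCoord i f₁) (fun k => by
            simpa using pderivCoord_neg (σ := 1) hf₁ (by simpa using hf₁e) i k), mul_zero]
      have h5 : ζ (0, 0) = 0 := map_zero_of_odd hζo
      have h6 : f₁ 0 = f 0 := by
        change f (pt 0 0 (0 + ζ (0, 0))) = f 0
        rw [h5, add_zero, pt_zero_zero]
      have h7 : f₁ (pt 0 0 (t • z)) = f (pt 0 0 (t • z)) := by
        change f (pt 0 0 (t • z + ζ (0, 0))) = _
        rw [h5, add_zero]
      rw [hPs, hA, hP, h7] at h2
      simp only [pt_zero, pt_one, zpart_pt, pt_zero_zero, h3, h6, zero_apply, add_zero,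
        Matrix.mulVec_smul, dotProduct_smul, smul_dotProduct, smul_eq_mul] at h2
      rw [h2]
      ring
    have h2 := isBigO_taylor (l := 𝓝 (0 : ℝ)) (r := fun t => t) tendsto_id hf.smooth
      (x := fun _ => 0) (y := fun _ => 0) (z := fun t => t • z) le_rfl le_rfl (isBigO_zero _ _)
      (isBigO_zero _ _) (by
        simpa using (isBigO_refl (fun t : ℝ => t) (𝓝 0)).smul
          (isBigO_const_const z (one_ne_zero (α := ℝ)) _)) 3
    have h3 : ∀ t : ℝ, taylorSum (wset 1 1 3) (jet f) 0 0 (t • z) = f 0 + t ^ 2 * hessForm f z := by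
      intro t
      rw [taylorSum_subset (S' := {(0, 0, 0), (0, 0, 2)})]
      · simp [taylorSum, contr, Nat.factorial, jet_zero, hessForm_apply, Matrix.mulVec,
          dotProduct, jetZZ, Finset.mul_sum]
        exact Finset.sum_congr rfl fun i _ => Finset.sum_congr rfl fun j _ => by ring
      · decide
      · rintro ⟨a, b, c⟩ hs hs' l hl
        rw [mem_wset le_rfl le_rfl] at hs
        simp only [Finset.mem_singleton, Finset.mem_insert, Prod.mk.injEq] at hs' hs hl ⊢
        rcases Nat.mod_two_eq_zero_or_one (a + b + l.length) with h | h
        · exact hf.jet_two (by omega) (by omega)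
        · exact hf.jet_odd h
    have h4 := eq_zero_of_isBigO_pow_succ (k := 2)
      (H := fun t => z ⬝ᵥ (A (pt 0 0 (t • z)) *ᵥ z) - hessForm f z) (by
        refine Continuous.continuousAt ?_
        simp only [← hA]
        have : Continuous fun t : ℝ => pt 0 0 (t • z) :=
          (ContDiff.pt contDiff_const contDiff_const
            (contDiff_id.smul contDiff_const)).continuous
        exact (((hM.continuous.comp this).clm_apply continuous_const).clm_apply
          continuous_const).sub continuous_const)
      (h2.congr_left fun t => by rw [h1, h3]; ring)
    simp only [zero_smul, pt_zero_zero] at h4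
    linarith
  -- the equation `S + ½ Sᵀ H⁻¹ S = A - A(0)`
  let F : (Fin n → Fin n → ℝ) × Coord n → (Fin n → Fin n → ℝ) := fun w i j =>
    w.1 i j + 1 / 2 * (∑ b, ∑ a, w.1 a i * hessInv f a b * w.1 b j) - (A w.2 i j - A 0 i j)
  have hF : ContDiff ℝ ∞ F := by
    refine contDiff_pi.2 fun i => contDiff_pi.2 fun j => ?_
    simp only [F, A, Matrix.of_apply]
    fun_prop
  obtain ⟨S, hS, hSe, hS0, hSF⟩ := exists_implicit_parity hF (u₀ := 0) (by ext; simp [F])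
    (ContinuousLinearEquiv.refl ℝ _) (hasFDerivAt_of_isBigO_sq (by
      refine isBigO_pi.2 fun i => isBigO_pi.2 fun j => ?_
      have h (a b : Fin n) : (fun u : Fin n → Fin n → ℝ => u a b) =O[𝓝 0] fun u => ‖u‖ :=
        isBigO_pi.1 (isBigO_pi.1 (isBigO_refl _ _).norm_right a) b
      have h2 : (fun u : Fin n → Fin n → ℝ => 1 / 2 * (∑ b, ∑ a, u a i * hessInv f a b * u b j))
          =O[𝓝 0] fun u => ‖u‖ ^ 2 := by
        refine IsBigO.const_mul_left (IsBigO.fun_sum fun b _ => IsBigO.fun_sum fun a _ => ?_) _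
        exact (((h a i).mul (h b j)).const_mul_left (hessInv f a b)).congr (fun u => by ring)
          fun u => by ring
      refine h2.congr_left fun u => ?_
      simp [F])) (σ := 1) (Or.inl rfl) (by simp) (fun u k h => by
      rw [← h]; simp [F, A, hMe])
  simp only [one_smul] at hSe
  refine OddGerm.of_near_id
    (Φ := fun k => pt (k 0) (k 1) (zpart k + hessInv f *ᵥ (Matrix.of (S k) *ᵥ zpart k)))
    (ContDiff.pt (by fun_prop) (by fun_prop) ?_) (fun k => ?_) ?_ ?_
  · refine contDiff_pi.2 fun i => ?_
    simp only [Matrix.mulVec, dotProduct, Matrix.of_apply, zpart, Pi.add_apply]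
    fun_prop
  · rw [neg_pt, hSe, zpart_neg]
    simp only [Matrix.mulVec_neg, neg_add, Pi.neg_apply]
  · have hz : (fun k : Coord n => zpart k) =O[𝓝 0] fun k => ‖k‖ :=
      IsBigO.of_bound' (Eventually.of_forall fun k => by simpa using norm_zpart_le k)
    have h1 : (fun k => Matrix.of (S k) *ᵥ zpart k) =O[𝓝 0] fun k => ‖k‖ ^ 2 := by
      refine isBigO_pi.2 fun i => ?_
      simp only [Matrix.mulVec, dotProduct, Matrix.of_apply]
      refine IsBigO.fun_sum fun j _ => ?_
      simpa [sq] using (isBigO_pi.1 (isBigO_pi.1 (isBigO_norm_of_contDiff hS hS0) i) j).mul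
        (isBigO_pi_apply hz j)
    refine (isBigO_pt (isBigO_zero _ _) (isBigO_zero _ _)
      (isBigO_of_mulVec (hessInv f) h1)).congr_left fun k => ?_
    refine coord_ext ?_ ?_ ?_
    · simp
    · simp
    · ext i; simp [zpart]
  · filter_upwards [hSF, hd] with k hk hdk
    have h1 := hfM k
    rw [hdk, hPs, hA, hP] at h1
    have h2 : Matrix.of (S k) + (1 / 2 : ℝ) • ((Matrix.of (S k))ᵀ * hessInv f * Matrix.of (S k)) =
        A k - A 0 := by
      ext i j
      have := congrFun (congrFun hk i) j
      simp only [F, Pi.zero_apply] at this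
      simp only [Matrix.add_apply, Matrix.smul_apply, Matrix.mul_apply, Matrix.transpose_apply,
        Matrix.of_apply, Matrix.sub_apply, Finset.sum_mul, smul_eq_mul]
      linarith
    simp only [splitForm, Function.comp_apply, pt_zero, pt_one, pt_succ_succ]
    rw [h1, hf.hessForm_add_mulVec, h2, Matrix.sub_mulVec, dotProduct_sub, hA0]
    simp [f₁]

/-- An even function `B` such that `x² B` is of fifth order is a combination of the monomials of
degree four. -/
theorem exists_quartic_division {B : ℝ × ℝ → ℝ} (hB : ContDiff ℝ ∞ B) (he : ∀ p, B (-p) = B p)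
    (hO : (fun p => p.1 ^ 2 * B p) =O[𝓝 0] fun p => ‖p‖ ^ 5) :
    ∃ q : ℕ → ℝ × ℝ → ℝ, (∀ i, ContDiff ℝ ∞ (q i)) ∧ (∀ i p, q i (-p) = q i p) ∧
      ∀ p, B p = ∑ i ∈ Finset.range 5, p.1 ^ (4 - i) * p.2 ^ i * q i p := by
  have hn : Tendsto (fun p : ℝ × ℝ => ‖p‖) (𝓝 0) (𝓝 0) := tendsto_norm_zero
  have h0 : B 0 = 0 := coeff_eq_zero_of_isBigO (d := 2) (i := 0)
    (q := fun i => if i = 0 then B else 0) (fun i => by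
      by_cases h : i = 0
      · simpa [h] using hB.continuous.continuousAt
      · simp only [h, if_false]; exact continuousAt_const)
    ((hO.trans (isBigO_pow_of_le hn (by norm_num))).congr_left fun p => by
      simp [Finset.sum_range_succ]) (by norm_num)
  obtain ⟨a, b, c, ha, hb, hc, hae, hbe, hce, hdiv⟩ := exists_division_even hB he h0
  let Q : ℕ → ℝ × ℝ → ℝ := fun i => if i = 0 then a else if i = 1 then b else if i = 2 then c else 0
  have hQ : ∀ i, i ≤ 4 → Q i 0 = 0 := fun i hi => coeff_eq_zero_of_isBigO (d := 4) (fun i => by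
      simp only [Q]
      split_ifs
      · exact ha.continuous.continuousAt
      · exact hb.continuous.continuousAt
      · exact hc.continuous.continuousAt
      · exact continuousAt_const)
    (hO.congr_left fun p => by
      rw [hdiv]
      simp [Finset.sum_range_succ, Q]
      ring) hi
  obtain ⟨a1, a2, a3, ha1, ha2, ha3, ha1e, ha2e, ha3e, hadiv⟩ :=
    exists_division_even ha hae (hQ 0 (by norm_num))
  obtain ⟨b1, b2, b3, hb1, hb2, hb3, hb1e, hb2e, hb3e, hbdiv⟩ :=
    exists_division_even hb hbe (hQ 1 (by norm_num))
  obtain ⟨c1, c2, c3, hc1, hc2, hc3, hc1e, hc2e, hc3e, hcdiv⟩ :=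
    exists_division_even hc hce (hQ 2 (by norm_num))
  refine ⟨fun i p => if i = 0 then a1 p else if i = 1 then a2 p + b1 p else
    if i = 2 then a3 p + b2 p + c1 p else if i = 3 then b3 p + c2 p else c3 p,
    fun i => ?_, fun i p => ?_, fun p => ?_⟩
  · simp only
    split_ifs <;> fun_prop
  · simp only [ha1e, ha2e, ha3e, hb1e, hb2e, hb3e, hc1e, hc2e, hc3e]
  · rw [hdiv, hadiv, hbdiv, hcdiv]
    simp [Finset.sum_range_succ]
    ring

/-- The form of a normalized function in the plane, in coordinates in which the critical curve is
the `y`-axis. -/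
theorem Normalized.exists_planar_form {n : ℕ} {ε η : ℝ} {f : Coord n → ℝ} (hf : Normalized ε η f)
    {ζ : ℝ × ℝ → Fin n → ℝ} (hζ : ContDiff ℝ ∞ ζ) (hζo : ∀ p, ζ (-p) = -ζ p)
    (hζ3 : ζ =O[𝓝 0] fun p => ‖p‖ ^ 3) {X : ℝ → ℝ} (hc : IsCritCurve f X fun t => ζ (X t, t)) :
    ∃ q : ℕ → ℝ × ℝ → ℝ, (∀ i, ContDiff ℝ ∞ (q i)) ∧ (∀ i p, q i (-p) = q i p) ∧
      ∀ᶠ p in 𝓝 (0 : ℝ × ℝ), f (pt (p.1 + X p.2) p.2 (ζ (p.1 + X p.2, p.2))) =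
        f (pt (X p.2) p.2 (ζ (X p.2, p.2))) + p.1 ^ 2 * (ε * p.1 ^ 2 + η * p.2 ^ 2 +
          ∑ i ∈ Finset.range 5, p.1 ^ (4 - i) * p.2 ^ i * q i p) := by
  have hX := hc.smooth_x
  let γ : ℝ × ℝ → Coord n := fun p => pt (p.1 + X p.2) p.2 (ζ (p.1 + X p.2, p.2))
  have hγ : ContDiff ℝ ∞ γ := ContDiff.pt (by fun_prop) (by fun_prop) (by fun_prop)
  have hγo : ∀ p, γ (-p) = -γ p := fun p => by
    have : ((-p).1 + X (-p).2, (-p).2) = -(p.1 + X p.2, p.2) := by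
      ext <;> simp [hc.odd_x]; ring
    simp only [γ, this, hζo, neg_pt]
    congr 1
    simp [hc.odd_x]; ring
  have hn : Tendsto (fun p : ℝ × ℝ => ‖p‖) (𝓝 0) (𝓝 0) := tendsto_norm_zero
  have hp1 : (fun p : ℝ × ℝ => p.1) =O[𝓝 0] fun p => ‖p‖ := isBigO_fst_prod'.norm_right
  have hp2 : (fun p : ℝ × ℝ => p.2) =O[𝓝 0] fun p => ‖p‖ := isBigO_snd_prod'.norm_right
  have hsnd : Tendsto (fun p : ℝ × ℝ => p.2) (𝓝 0) (𝓝 0) := continuous_snd.tendsto 0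
  have hX3 : (fun p : ℝ × ℝ => X p.2) =O[𝓝 0] fun p => ‖p‖ ^ 3 :=
    (hc.order_x.comp_tendsto hsnd).trans (hp2.pow 3)
  have hX1 : (fun p : ℝ × ℝ => X p.2) =O[𝓝 0] fun p => ‖p‖ :=
    (hX3.trans (isBigO_pow_of_le hn (by norm_num : 1 ≤ 3))).congr_right fun p => pow_one _
  have hx1 : (fun p : ℝ × ℝ => p.1 + X p.2) =O[𝓝 0] fun p => ‖p‖ := hp1.add hX1
  have hX0 : X 0 = 0 := map_zero_of_odd hc.odd_x
  have hin : Tendsto (fun p : ℝ × ℝ => (p.1 + X p.2, p.2)) (𝓝 0) (𝓝 0) := by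
    have : Continuous fun p : ℝ × ℝ => (p.1 + X p.2, p.2) := by fun_prop
    have h := this.tendsto 0
    have h0 : ((0 : ℝ × ℝ).1 + X (0 : ℝ × ℝ).2, (0 : ℝ × ℝ).2) = 0 := by simp [hX0]
    rwa [h0] at h
  have hquart : (fun p => f (γ p) - f 0 - quarticForm f p.1 p.2) =O[𝓝 0] fun p => ‖p‖ ^ 6 := by
    have h1 := hf.isBigO_quartic hn hx1 hp2 (z := fun p : ℝ × ℝ => ζ (p.1 + X p.2, p.2))
      ((hζ3.comp_tendsto hin).trans ((hx1.prod_left hp2).norm_left.pow 3))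
    have h2 : (fun p : ℝ × ℝ => X p.2 * (ε * (4 * p.1 ^ 3 + 6 * p.1 ^ 2 * X p.2
        + 4 * (p.1 * X p.2 ^ 2) + X p.2 ^ 3) + η * ((2 * p.1 + X p.2) * p.2 ^ 2)))
        =O[𝓝 0] fun p => ‖p‖ ^ 6 := by
      have h3 : (fun p : ℝ × ℝ => ε * (4 * p.1 ^ 3 + 6 * p.1 ^ 2 * X p.2
        + 4 * (p.1 * X p.2 ^ 2) + X p.2 ^ 3) + η * ((2 * p.1 + X p.2) * p.2 ^ 2))
        =O[𝓝 0] fun p => ‖p‖ ^ 3 := by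
        refine IsBigO.add (IsBigO.const_mul_left (IsBigO.add (IsBigO.add (IsBigO.add ?_ ?_) ?_)
          (hX1.pow 3)) _) (IsBigO.const_mul_left ?_ _)
        · exact (hp1.pow 3).const_mul_left _
        · exact (((hp1.pow 2).const_mul_left 6).mul hX1).congr_right fun p => by ring
        · exact ((hp1.mul (hX1.pow 2)).congr_right fun p => by ring).const_mul_left 4
        · exact (((hp1.const_mul_left 2).add hX1).mul (hp2.pow 2)).congr_right fun p => by ring
      exact (hX3.mul h3).congr_right fun p => by ring
    refine (h1.add h2).congr_left fun p => ?_
    simp only [hf.quarticForm_eq, γ]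
    ring
  let P : ℝ × ℝ →L[ℝ] ℝ × ℝ := (0 : ℝ × ℝ →L[ℝ] ℝ).prod (ContinuousLinearMap.snd ℝ ℝ ℝ)
  have hP : ∀ p, P p = (0, p.2) := fun p => rfl
  have hP0 : Tendsto P (𝓝 0) (𝓝 0) := by simpa using P.continuous.tendsto 0
  obtain ⟨M, hM, hMe, hfM⟩ := exists_hadamard_sq (hf.smooth.comp hγ)
    (fun p => by simp [hγo, hf.even]) P (fun p => rfl)
  let B : ℝ × ℝ → ℝ := fun p => M p (1, 0) (1, 0) - ε * p.1 ^ 2 - η * p.2 ^ 2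
  have hB : ContDiff ℝ ∞ B := by fun_prop
  have hBe : ∀ p, B (-p) = B p := fun p => by simp [B, hMe]
  have hsub : ∀ p : ℝ × ℝ, p - P p = p.1 • (1, 0) := fun p => by ext <;> simp [hP]
  -- the derivative in `x` vanishes on the `y`-axis, the preimage of the critical curve
  have hd : ∀ᶠ p in 𝓝 (0 : ℝ × ℝ), fderiv ℝ (f ∘ γ) (P p) (p - P p) = 0 := by
    filter_upwards [hsnd.eventually hc.crit_x, hsnd.eventually hc.crit_z] with p h1 h2
    have h3 : γ (P p) = pt (X p.2) p.2 (ζ (X p.2, p.2)) := by simp [γ, hP]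
    rw [fderiv_comp _ (hf.smooth.differentiable (by simp) _) (hγ.differentiable (by simp) _),
      hsub, map_smul, ContinuousLinearMap.comp_apply, fderiv_apply_eq_sum, h3,
      Fin.sum_univ_succ, Fin.sum_univ_succ, h1]
    have h4 : fderiv ℝ γ (P p) (1, 0) 1 = 0 := by
      have h5 := (ContinuousLinearMap.proj (R := ℝ) (φ := fun _ : Fin (n + 2) => ℝ) 1).hasFDerivAt.comp
        (P p) (hγ.differentiable (by simp) (P p)).hasFDerivAt
      have h6 : HasFDerivAt (fun p : ℝ × ℝ => p.2) (ContinuousLinearMap.snd ℝ ℝ ℝ) (P p) :=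
        hasFDerivAt_snd
      have h7 := congrArg (fun L => L ((1 : ℝ), (0 : ℝ))) (h5.unique h6)
      simpa using h7
    simp [h2, h4]
  have hexp : ∀ᶠ p in 𝓝 (0 : ℝ × ℝ), f (γ p) = f (γ (0, p.2)) + p.1 ^ 2 * (B p +
      (ε * p.1 ^ 2 + η * p.2 ^ 2)) := by
    filter_upwards [hd] with p hp
    have h1 := hfM p
    rw [hp, hsub] at h1
    simp only [Function.comp_apply, hP, map_smul, smul_apply, smul_eq_mul] at h1
    rw [h1]
    simp only [B]
    ring
  have hBO : (fun p => p.1 ^ 2 * B p) =O[𝓝 0] fun p => ‖p‖ ^ 5 := by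
    refine IsBigO.trans ?_ (isBigO_pow_of_le hn (by norm_num : 5 ≤ 6))
    have h1 : (fun p => f (γ (P p)) - f 0 - quarticForm f (P p).1 (P p).2) =O[𝓝 0]
        fun p => ‖p‖ ^ 6 :=
      (hquart.comp_tendsto hP0).trans (((P.isBigO_id (𝓝 0)).norm_norm).pow 6)
    refine (hquart.sub h1).congr' ?_ EventuallyEq.rfl
    filter_upwards [hexp] with p hp
    simp only [hf.quarticForm_eq, hP, hp]
    ring
  obtain ⟨q, hq, hqe, hqB⟩ := exists_quartic_division hB hBe hBO
  refine ⟨q, hq, hqe, ?_⟩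
  filter_upwards [hexp] with p hp
  rw [← hqB]
  simp only [γ, zero_add] at hp
  rw [hp]
  ring

/-- Along a suitable critical curve, the leading term of `f` determines the normal form of `f`. -/
theorem Normalized.exists_oddGerm {n : ℕ} {ε η : ℝ} (hε : IsSign ε) (hη : IsSign η)
    {f : Coord n → ℝ} (hf : Normalized ε η f) :
    ∃ (X : ℝ → ℝ) (Z : ℝ → Fin n → ℝ), IsCritCurve f X Z ∧
      ∀ (j : ℕ) (a : ℝ), a ≠ 0 → (j = 0 → 4 * ε * a ≠ 1) →
        ((fun t => f (pt (X t) t (Z t)) - f 0 - a * t ^ (2 * (j + 2))) =O[𝓝 0]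
          fun t : ℝ => t ^ (2 * (j + 2) + 1)) →
        OddGerm f (splitForm (f 0) (fun x y => ε * x ^ 4 + η * x ^ 2 * y ^ 2
          + a * y ^ (2 * (j + 2))) (hessForm f)) := by
  obtain ⟨ζ, hζ, hζo, hζ3, hζc⟩ := hf.exists_fiber_crit
  obtain ⟨X, hc⟩ := hf.exists_critCurve hη hζ hζo hζ3 hζc
  refine ⟨X, _, hc, fun j a ha hj hO => ?_⟩
  have hX := hc.smooth_x
  obtain ⟨q, hq, hqe, hform⟩ := hf.exists_planar_form hζ hζo hζ3 hc
  obtain ⟨τ, hτ, hτe, hφ⟩ := exists_even_quotient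
    (φ := fun t => f (pt (X t) t (ζ (X t, t))) - f 0)
    ((hf.smooth.comp (ContDiff.pt hX contDiff_id hc.smooth_z)).sub contDiff_const)
    (fun t => by
      have h := neg_pt (X t) t (ζ (X t, t))
      rw [← hc.odd_x, ← hc.odd_z t] at h
      rw [← h, hf.even]) hO
  obtain ⟨x', y', hx', hy', hxo, hyo, hxi, hyi, hxy⟩ :=
    planar_normal_form hε hη ha hj hτ hτe hq hqe
  refine (hf.oddGerm_split hζ hζo hζ3 hζc).trans ((OddGerm.of_planar
    (g' := fun x y => f (pt (x + X y) y (ζ (x + X y, y))) - f 0)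
    (x' := fun p => p.1 - X p.2) (y' := fun p => p.2) (by fun_prop) (by fun_prop) (fun p => ?_)
    (fun p => rfl) ?_ ?_ ?_ _ _).trans (OddGerm.of_planar hx' hy' hxo hyo hxi hyi ?_ _ _))
  · simp only [Prod.fst_neg, Prod.snd_neg, hc.odd_x]; ring
  · have h1 : (fun p : ℝ × ℝ => X p.2) =O[𝓝 0] fun p => ‖p‖ ^ 3 :=
      (hc.order_x.comp_tendsto (continuous_snd.tendsto 0)).trans
        ((isBigO_snd_prod' : (fun p : ℝ × ℝ => p.2) =O[𝓝 0] fun p => p).norm_right.pow 3)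
    exact (h1.trans (isBigO_pow_of_le tendsto_norm_zero (by norm_num))).neg_left.congr_left
      fun p => by ring
  · simpa using isBigO_zero _ _
  · exact Eventually.of_forall fun p => by simp
  · filter_upwards [hform, hxy] with p h1 h2
    rw [h1, h2]
    linear_combination hφ p.2

/-! ### Comparison of equivalent germs: the quartic parts -/

/-- Smooth maps `Φ` and `Ψ`, inverse to each other near the origin, of which the first one carries
the germ of `f` to that of `g`. -/
structure IsGermEquiv {n : ℕ} (f g : Coord n → ℝ) (Φ Ψ : Coord n → Coord n) : Prop where
  smooth : ContDiff ℝ ∞ Φ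
  smooth_inv : ContDiff ℝ ∞ Ψ
  map_zero : Φ 0 = 0
  inv_zero : Ψ 0 = 0
  eq : f =ᶠ[𝓝 0] g ∘ Φ
  right_inv : ∀ᶠ k in 𝓝 0, Φ (Ψ k) = k
  left_inv : ∀ᶠ k in 𝓝 0, Ψ (Φ k) = k

theorem OddEquiv.exists_isGermEquiv {n : ℕ} {f g : Coord n → ℝ} (h : OddEquiv f g) :
    ∃ Φ Ψ, IsGermEquiv f g Φ Ψ := by
  obtain ⟨e, h0, hodd, hs, hsi, hfg⟩ := h
  have he0 : e 0 = 0 := by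
    have h1 := (hodd 0 h0).2
    rw [neg_zero] at h1
    have h2 : (2 : ℝ) • e 0 = 0 := by
      rw [two_smul]; nth_rewrite 2 [h1]; simp
    simpa using h2
  have h0t : (0 : Coord n) ∈ e.target := he0 ▸ e.map_source h0
  have hi0 : e.symm 0 = 0 := by
    have := e.left_inv h0
    rwa [he0] at this
  obtain ⟨Φ, hΦ, hΦe⟩ := exists_contDiff_eventuallyEq (e.open_source.mem_nhds h0) e.open_source hs
  obtain ⟨Ψ, hΨ, hΨe⟩ := exists_contDiff_eventuallyEq (e.open_target.mem_nhds h0t) e.open_target hsi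
  have hΦ0 : Φ 0 = 0 := hΦe.self_of_nhds.trans he0
  have hΨ0 : Ψ 0 = 0 := hΨe.self_of_nhds.trans hi0
  have hΦt : Tendsto Φ (𝓝 0) (𝓝 0) := by simpa [hΦ0] using hΦ.continuous.tendsto 0
  have hΨt : Tendsto Ψ (𝓝 0) (𝓝 0) := by simpa [hΨ0] using hΨ.continuous.tendsto 0
  refine ⟨Φ, Ψ, hΦ, hΨ, hΦ0, hΨ0, ?_, ?_, ?_⟩
  · filter_upwards [hΦe, e.open_source.mem_nhds h0] with k h1 h2
    rw [Function.comp_apply, h1, hfg k h2]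
  · filter_upwards [hΨe, hΨt.eventually hΦe, e.open_target.mem_nhds h0t] with k h1 h2 h3
    rw [h2, h1, e.right_inv h3]
  · filter_upwards [hΦe, hΦt.eventually hΨe, e.open_source.mem_nhds h0] with k h1 h2 h3
    rw [h2, h1, e.left_inv h3]

namespace IsGermEquiv

variable {n : ℕ} {f g : Coord n → ℝ} {Φ Ψ : Coord n → Coord n}

theorem tendsto (h : IsGermEquiv f g Φ Ψ) : Tendsto Φ (𝓝 0) (𝓝 0) := by
  simpa [h.map_zero] using h.smooth.continuous.tendsto 0

theorem tendsto_inv (h : IsGermEquiv f g Φ Ψ) : Tendsto Ψ (𝓝 0) (𝓝 0) := by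
  simpa [h.inv_zero] using h.smooth_inv.continuous.tendsto 0

theorem map_eq (h : IsGermEquiv f g Φ Ψ) : f 0 = g 0 := by
  have := h.eq.self_of_nhds
  rwa [Function.comp_apply, h.map_zero] at this

/-- An order estimate for the derivative of `f` is inherited by the derivative of `g`. -/
theorem isBigO_pderiv (h : IsGermEquiv f g Φ Ψ) (hf : ContDiff ℝ ∞ f) {τ : Type*} {l : Filter τ}
    {k : τ → Coord n} (hk : Tendsto k l (𝓝 0)) {r : τ → ℝ}
    (hr : ∀ i, (fun e => pderivCoord i f (k e)) =O[l] r) (i : Fin (n + 2)) :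
    (fun e => pderivCoord i g (Φ (k e))) =O[l] r := by
  have hg : g =ᶠ[𝓝 0] f ∘ Ψ := by
    filter_upwards [h.right_inv, h.tendsto_inv.eventually h.eq] with p h1 h2
    rw [Function.comp_apply, h2, Function.comp_apply, h1]
  have h1 : ∀ᶠ e in l, pderivCoord i g (Φ (k e)) =
      ∑ j, fderiv ℝ Ψ (Φ (k e)) (Pi.single i 1) j * pderivCoord j f (k e) := by
    filter_upwards [hk.eventually (h.tendsto.eventually hg.eventually_nhds),
      hk.eventually h.left_inv] with e h1 h2
    have h3 : g =ᶠ[𝓝 (Φ (k e))] f ∘ Ψ := h1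
    rw [← fderiv_apply_eq_sum, pderivCoord, h3.fderiv_eq,
      fderiv_comp _ (hf.differentiable (by simp) _) (h.smooth_inv.differentiable (by simp) _), h2]
    rfl
  refine (IsBigO.fun_sum fun j _ => ?_ : (fun e => ∑ j, fderiv ℝ Ψ (Φ (k e)) (Pi.single i 1) j *
    pderivCoord j f (k e)) =O[l] r).congr' (h1.mono fun _ h => h.symm) EventuallyEq.rfl
  have h2 : Continuous fun p => fderiv ℝ Ψ p (Pi.single i 1) j :=
    (continuous_apply j).comp ((h.smooth_inv.continuous_fderiv (by simp)).clm_apply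
      continuous_const)
  have h3 : (fun e => fderiv ℝ Ψ (Φ (k e)) (Pi.single i 1) j) =O[l] fun _ => (1 : ℝ) :=
    ((h2.tendsto 0).comp (h.tendsto.comp hk)).isBigO_one ℝ
  simpa using h3.mul (hr j)

theorem fderiv_injective (h : IsGermEquiv f g Φ Ψ) {v : Coord n} (hv : fderiv ℝ Φ 0 v = 0) :
    v = 0 := by
  have h1 : Ψ ∘ Φ =ᶠ[𝓝 0] id := h.left_inv
  have h2 := h1.fderiv_eq (𝕜 := ℝ)
  rw [fderiv_comp _ (h.smooth_inv.differentiable (by simp) _)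
    (h.smooth.differentiable (by simp) _), fderiv_id] at h2
  have h3 := congrArg (fun L => L v) h2
  simpa [hv] using h3.symm

end IsGermEquiv

theorem isBigO_sub_fderiv {E G : Type} [NormedAddCommGroup E] [NormedSpace ℝ E]
    [FiniteDimensional ℝ E] [NormedAddCommGroup G] [NormedSpace ℝ G] [CompleteSpace G]
    {Φ : E → G} (hΦ : ContDiff ℝ ∞ Φ) :
    (fun k => Φ k - Φ 0 - fderiv ℝ Φ 0 k) =O[𝓝 0] fun k => ‖k‖ ^ 2 := by
  obtain ⟨L, hL, hΦL, hL0⟩ := exists_hadamard hΦ (0 : E →L[ℝ] E) (fun _ => rfl)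
  have h1 : (fun k => L k - L 0) =O[𝓝 0] fun k => ‖k‖ :=
    isBigO_norm_of_contDiff (hL.sub contDiff_const) (by simp)
  have h2 : (fun k => (L k - L 0) k) =O[𝓝 0] fun k => ‖k‖ * ‖k‖ :=
    (IsBigO.of_bound' (Eventually.of_forall fun k => by
      simpa using (L k - L 0).le_opNorm k)).trans (h1.norm_left.mul (isBigO_refl _ _))
  refine (h2.congr_right fun k => (sq _).symm).congr_left fun k => ?_
  have h3 := hΦL k
  have h4 := hL0 0
  simp only [zero_apply, sub_zero] at h3 h4
  rw [h3, sub_apply, h4]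
  abel

/-- The isomorphism defined by the polar form of a nondegenerate quadratic form. -/
theorem exists_polarEquiv {n : ℕ} {Q : QuadraticForm ℝ (Fin n → ℝ)} (hQ : Q.Nondegenerate) :
    ∃ T : (Fin n → ℝ) ≃L[ℝ] (Fin n → ℝ),
      (∀ z i, T z i = QuadraticMap.polar Q z (Pi.single i 1)) ∧
      ∀ z, Q z = 1 / 2 * ∑ i, z i * T z i := by
  let T₀ : (Fin n → ℝ) →ₗ[ℝ] (Fin n → ℝ) :=
    LinearMap.pi fun i => Q.polarBilin.flip (Pi.single i 1)
  have hT₀ : ∀ z i, T₀ z i = QuadraticMap.polar Q z (Pi.single i 1) := fun z i => rfl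
  have hsum : ∀ z w, QuadraticMap.polar Q z w = ∑ i, w i * T₀ z i := fun z w => by
    have h1 : w = ∑ i, w i • (Pi.single i 1 : Fin n → ℝ) := by
      ext j; simp [Pi.single_apply]
    have h2 : QuadraticMap.polar Q z w = Q.polarBilin z w := rfl
    rw [h2]
    conv_lhs => rw [h1]
    simp [map_sum, hT₀]
  have hinj : Function.Injective T₀ := by
    rw [← LinearMap.ker_eq_bot, LinearMap.ker_eq_bot']
    intro z hz
    refine (QuadraticMap.nondegenerate_polar_iff.2 hQ).1 z fun w => ?_
    rw [QuadraticMap.polarBilin_apply_apply, hsum, hz]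
    simp
  refine ⟨(LinearEquiv.ofInjectiveEndo T₀ hinj).toContinuousLinearEquiv, hT₀, fun z => ?_⟩
  have h1 := hsum z z
  rw [QuadraticMap.polar_self] at h1
  have h2 : ∀ i, (LinearEquiv.ofInjectiveEndo T₀ hinj).toContinuousLinearEquiv z i = T₀ z i :=
    fun i => rfl
  simp only [h2, ← h1]
  simp

theorem contDiff_quadraticForm {n : ℕ} {Q : QuadraticForm ℝ (Fin n → ℝ)} (hQ : Q.Nondegenerate) :
    ContDiff ℝ ∞ Q := by
  obtain ⟨T, -, hT⟩ := exists_polarEquiv hQ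
  have : (Q : (Fin n → ℝ) → ℝ) = fun z => 1 / 2 * ∑ i, z i * T z i := funext hT
  rw [this]
  have h := T.contDiff (n := ∞)
  fun_prop

theorem isBigO_quadraticForm {n : ℕ} {Q : QuadraticForm ℝ (Fin n → ℝ)} (hQ : Q.Nondegenerate)
    {τ : Type*} {l : Filter τ} {z : τ → Fin n → ℝ} {r : τ → ℝ} (hz : z =O[l] r) :
    (fun e => Q (z e)) =O[l] fun e => r e ^ 2 := by
  obtain ⟨T, -, hT⟩ := exists_polarEquiv hQ
  have h1 : (fun e => T (z e)) =O[l] r := ((T : (Fin n → ℝ) →L[ℝ] (Fin n → ℝ)).isBigO_comp z l).trans hz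
  simp only [hT, sq]
  exact IsBigO.const_mul_left (IsBigO.fun_sum fun i _ =>
    (isBigO_pi_apply hz i).mul (isBigO_pi_apply h1 i)) _

theorem contDiff_splitForm {n : ℕ} {d : ℝ} {G : ℝ → ℝ → ℝ} {Q : QuadraticForm ℝ (Fin n → ℝ)}
    (hG : ContDiff ℝ ∞ fun p : ℝ × ℝ => G p.1 p.2) (hQ : Q.Nondegenerate) :
    ContDiff ℝ ∞ (splitForm d G Q) := by
  have h1 : ContDiff ℝ ∞ fun k : Coord n => G (k 0) (k 1) :=
    hG.comp (f := fun k : Coord n => (k 0, k 1)) (by fun_prop)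
  exact (contDiff_const.add h1).add ((contDiff_quadraticForm hQ).comp contDiff_zpart)

theorem pderivCoord_z_splitForm {n : ℕ} {d : ℝ} {G : ℝ → ℝ → ℝ}
    {Q : QuadraticForm ℝ (Fin n → ℝ)} (hG : ContDiff ℝ ∞ fun p : ℝ × ℝ => G p.1 p.2)
    (hQ : Q.Nondegenerate) (k : Coord n) (i : Fin n) :
    pderivCoord i.succ.succ (splitForm d G Q) k =
      QuadraticMap.polar Q (zpart k) (Pi.single i 1) := by
  rw [pderivCoord, ← ((contDiff_splitForm hG hQ).differentiable (by simp) k).lineDeriv_eq_fderiv]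
  refine HasLineDerivAt.lineDeriv ?_
  have h1 : ∀ t : ℝ, splitForm d G Q (k + t • Pi.single i.succ.succ 1) =
      d + G (k 0) (k 1) + (Q (zpart k) + t * QuadraticMap.polar Q (zpart k) (Pi.single i 1)
        + t ^ 2 * Q (Pi.single i 1)) := fun t => by
    have h2 : (fun j : Fin n => (k + t • (Pi.single i.succ.succ 1 : Coord n)) j.succ.succ) =
        zpart k + t • Pi.single i 1 := by
      ext j; simp [zpart, Pi.single_apply, Fin.succ_inj]
    have h3 : (k + t • (Pi.single i.succ.succ 1 : Coord n)) 0 = k 0 := by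
      simp [(Fin.succ_ne_zero _).symm]
    have h4 : (k + t • (Pi.single i.succ.succ 1 : Coord n)) 1 = k 1 := by
      simp [Fin.ext_iff]
    have h5 := QuadraticMap.polar_smul_right (Q := Q) t (zpart k) (Pi.single i 1)
    rw [QuadraticMap.polar, QuadraticMap.map_smul] at h5
    simp only [smul_eq_mul] at h5
    rw [splitForm, h2, h3, h4]
    linear_combination h5
  unfold HasLineDerivAt
  simp only [h1]
  have h2 := ((((hasDerivAt_id (0 : ℝ)).mul_const
    (QuadraticMap.polar Q (zpart k) (Pi.single i 1))).const_add (Q (zpart k))).add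
    (((hasDerivAt_id (0 : ℝ)).pow 2).mul_const (Q (Pi.single i 1)))).const_add (d + G (k 0) (k 1))
  simpa using h2

/-- The `z`-components of a point are controlled by the derivative of the split form there. -/
theorem isBigO_zpart_of_pderiv {n : ℕ} {d : ℝ} {G : ℝ → ℝ → ℝ}
    {Q : QuadraticForm ℝ (Fin n → ℝ)} (hG : ContDiff ℝ ∞ fun p : ℝ × ℝ => G p.1 p.2)
    (hQ : Q.Nondegenerate) {τ : Type*} {l : Filter τ} {k : τ → Coord n} {r : τ → ℝ}
    (h : ∀ i, (fun e => pderivCoord i (splitForm d G Q) (k e)) =O[l] r) :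
    (fun e => zpart (k e)) =O[l] r := by
  obtain ⟨T, hT, -⟩ := exists_polarEquiv hQ
  have h1 : (fun e => T (zpart (k e))) =O[l] r := isBigO_pi.2 fun i => by
    simpa only [hT, pderivCoord_z_splitForm hG hQ] using h i.succ.succ
  exact (((T.symm : (Fin n → ℝ) →L[ℝ] (Fin n → ℝ)).isBigO_comp _ l).trans h1).congr_left fun e => by simp

/-- On the plane of `k₁, k₂` the derivative of `f` is of the third order. -/
theorem EvenCorankTwo.isBigO_pderiv_plane {n : ℕ} {f : Coord n → ℝ} (hf : EvenCorankTwo f)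
    {τ : Type*} {l : Filter τ} {r : τ → ℝ} (hr : Tendsto r l (𝓝 0)) {x y : τ → ℝ}
    (hx : x =O[l] r) (hy : y =O[l] r) (i : Fin (n + 2)) :
    (fun e => pderivCoord i f (pt (x e) (y e) 0)) =O[l] fun e => r e ^ 3 := by
  have key : ∀ i, (∀ a b (l : List (Fin n)), a + b + l.length < 3 → l.length = 0 →
      jet (pderivCoord i f) a b l = 0) →
      (fun e => pderivCoord i f (pt (x e) (y e) 0)) =O[l] fun e => r e ^ 3 := fun i h => by
    refine (isBigO_taylor hr (contDiff_pderivCoord hf.smooth i) le_rfl le_rfl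
      (by simpa using hx) hy (z := fun _ => 0) (isBigO_zero _ _) 3).congr_left fun e => ?_
    rw [sub_eq_self, taylorSum]
    refine Finset.sum_eq_zero fun s hs => ?_
    rw [mem_wset le_rfl le_rfl] at hs
    obtain ⟨a, b, c⟩ := s
    rcases c with _ | c
    · simp only at hs
      simp [contr, h a b [] (by simp; omega) rfl]
    · simp [contr]
  refine key i fun a b l' h1 h2 => ?_
  have hl : l' = [] := List.length_eq_zero_iff.1 h2
  subst hl
  have hj : ∀ a b (l : List (Fin n)), a + b + l.length < 4 → l.length ≤ 1 → 0 < a + b + l.length →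
      jet f a b l = 0 := fun a b l h1 h2 h3 => by
    rcases Nat.mod_two_eq_zero_or_one (a + b + l.length) with h | h
    · exact hf.jet_two (by omega) h2
    · exact hf.jet_odd h
  induction i using Fin.cases with
  | zero =>
    rw [jet_pderiv_x hf.smooth]
    exact hj _ _ _ (by simp at h1 ⊢; omega) (by simp) (by omega)
  | succ i =>
    induction i using Fin.cases with
    | zero =>
      change jet (pderivCoord 1 f) a b [] = 0
      rw [jet_pderiv_y hf.smooth]
      exact hj _ _ _ (by simp at h1 ⊢; omega) (by simp) (by omega)
    | succ i =>
      rw [jet_pderiv_z hf.smooth]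
      exact hj _ _ _ (by simp at h1 ⊢; omega) (by simp) (by simp)

/-- A homogeneous function of two variables vanishes if it is of higher order. -/
theorem eq_zero_of_homogeneous {q : ℝ → ℝ → ℝ} {m : ℕ}
    (hq : ∀ t x y : ℝ, q (t * x) (t * y) = t ^ m * q x y)
    (h : (fun p : ℝ × ℝ => q p.1 p.2) =O[𝓝 0] fun p => ‖p‖ ^ (m + 1)) (x y : ℝ) : q x y = 0 := by
  have h1 : Tendsto (fun t : ℝ => (t * x, t * y)) (𝓝 0) (𝓝 0) := by
    have : Continuous fun t : ℝ => (t * x, t * y) := by fun_prop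
    have h := this.tendsto 0
    have h0 : ((0 : ℝ) * x, (0 : ℝ) * y) = 0 := by simp
    rwa [h0] at h
  have h2 : (fun t : ℝ => (t * x, t * y)) =O[𝓝 0] fun t : ℝ => t :=
    (((isBigO_refl (fun t : ℝ => t) (𝓝 0)).const_mul_left x).congr_left fun t => mul_comm _ _
      ).prod_left (((isBigO_refl (fun t : ℝ => t) (𝓝 0)).const_mul_left y).congr_left
        fun t => mul_comm _ _)
  exact eq_zero_of_isBigO_pow_succ (H := fun _ => q x y) continuousAt_const
    (((h.comp_tendsto h1).trans (h2.norm_left.pow (m + 1))).congr_left fun t => hq t x y)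

/-- The quartic parts of equivalent germs differ by a linear change of `k₁, k₂`. The equivalence
maps the plane of `k₁, k₂` to itself to first order. -/
theorem IsGermEquiv.exists_linear {n : ℕ} {f : Coord n → ℝ} (hf : EvenCorankTwo f)
    {c0 c2 c4 a d : ℝ} {m : ℕ} (hm : 3 ≤ m) {Q : QuadraticForm ℝ (Fin n → ℝ)}
    (hQ : Q.Nondegenerate) {Φ Ψ : Coord n → Coord n}
    (h : IsGermEquiv f (splitForm d (fun x y => c0 * x ^ 4 + c2 * x ^ 2 * y ^ 2 + c4 * y ^ 4
      + a * y ^ (2 * m)) Q) Φ Ψ) :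
    ∃ α β γ δ : ℝ, α * δ - β * γ ≠ 0 ∧
      (∀ x y, quarticForm f x y = c0 * (α * x + β * y) ^ 4
        + c2 * (α * x + β * y) ^ 2 * (γ * x + δ * y) ^ 2 + c4 * (γ * x + δ * y) ^ 4) ∧
      fderiv ℝ Φ 0 (pt 0 1 0) = pt β δ 0 := by
  have hG : ContDiff ℝ ∞ fun p : ℝ × ℝ => c0 * p.1 ^ 4 + c2 * p.1 ^ 2 * p.2 ^ 2 + c4 * p.2 ^ 4
      + a * p.2 ^ (2 * m) := by fun_prop
  have hn : Tendsto (fun p : ℝ × ℝ => ‖p‖) (𝓝 0) (𝓝 0) := tendsto_norm_zero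
  have hp1 : (fun p : ℝ × ℝ => p.1) =O[𝓝 0] fun p => ‖p‖ := isBigO_fst_prod'.norm_right
  have hp2 : (fun p : ℝ × ℝ => p.2) =O[𝓝 0] fun p => ‖p‖ := isBigO_snd_prod'.norm_right
  let κ : ℝ × ℝ → Coord n := fun p => pt p.1 p.2 0
  have hκO : κ =O[𝓝 0] fun p => ‖p‖ := isBigO_pt hp1 hp2 (isBigO_zero _ _)
  have hκ : Tendsto κ (𝓝 0) (𝓝 0) := hκO.trans_tendsto hn
  have hz : (fun p => zpart (Φ (κ p))) =O[𝓝 0] fun p => ‖p‖ ^ 3 :=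
    isBigO_zpart_of_pderiv hG hQ fun i =>
      h.isBigO_pderiv hf.smooth hκ (fun i => hf.isBigO_pderiv_plane hn hp1 hp2 i) i
  -- the `z`-components of `Φ` on the plane are of third order, so that `D` preserves the plane
  let D : Coord n →L[ℝ] Coord n := fderiv ℝ Φ 0
  have hD : (fun p => Φ (κ p) - D (κ p)) =O[𝓝 0] fun p => ‖p‖ ^ 2 := by
    have h1 := ((isBigO_sub_fderiv h.smooth).comp_tendsto hκ).trans (hκO.norm_left.pow 2)
    simpa [h.map_zero, Function.comp_def] using h1
  have hlin : ∀ x y : ℝ, (pt x y 0 : Coord n) = x • pt 1 0 0 + y • pt 0 1 0 := fun x y => by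
    refine coord_ext ?_ ?_ ?_
    · simp
    · simp
    · ext i; simp [zpart]
  have hDlin : ∀ (x y : ℝ) i, D (pt x y 0) i = D (pt 1 0 0) i * x + D (pt 0 1 0) i * y :=
    fun x y i => by
      rw [hlin, map_add, map_smul, map_smul]
      simp [mul_comm]
  have hDz : ∀ (i : Fin n) (x y : ℝ), D (pt x y 0) i.succ.succ = 0 := fun i => by
    refine eq_zero_of_homogeneous (m := 1) (fun t x y => ?_) ?_
    · rw [hDlin (t * x) (t * y), hDlin x y]; ring
    · have h1 := (isBigO_pi_apply hz i).trans (isBigO_pow_of_le hn (by norm_num : 2 ≤ 3))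
      refine (h1.sub (isBigO_pi.1 hD i.succ.succ)).congr_left fun p => ?_
      simp [zpart, κ]
  refine ⟨D (pt 1 0 0) 0, D (pt 0 1 0) 0, D (pt 1 0 0) 1, D (pt 0 1 0) 1, fun hdet => ?_, ?_, ?_⟩
  · have key : ∀ x y : ℝ, D (pt x y 0) 0 = 0 → D (pt x y 0) 1 = 0 → x = 0 ∧ y = 0 :=
      fun x y h0 h1 => by
        have h2 : D (pt x y 0) = 0 := coord_ext h0 h1 (by ext i; exact hDz i x y)
        have h3 := h.fderiv_injective h2
        exact ⟨congrFun h3 0, congrFun h3 1⟩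
    obtain ⟨h1, h2⟩ := key (D (pt 0 1 0) 1) (-D (pt 1 0 0) 1) (by rw [hDlin]; linarith)
      (by rw [hDlin]; ring)
    obtain ⟨h3, h4⟩ := key (-D (pt 0 1 0) 0) (D (pt 1 0 0) 0) (by rw [hDlin]; ring)
      (by rw [hDlin]; linarith)
    exact one_ne_zero (key 1 0 h4 (by linarith)).1
  · obtain ⟨u, hu⟩ : ∃ u : ℝ × ℝ → ℝ, ∀ p, u p = Φ (κ p) 0 := ⟨_, fun _ => rfl⟩
    obtain ⟨v, hv⟩ : ∃ v : ℝ × ℝ → ℝ, ∀ p, v p = Φ (κ p) 1 := ⟨_, fun _ => rfl⟩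
    obtain ⟨u₀, hu₀⟩ : ∃ u : ℝ × ℝ → ℝ, ∀ p, u p = D (pt 1 0 0) 0 * p.1 + D (pt 0 1 0) 0 * p.2 :=
      ⟨_, fun _ => rfl⟩
    obtain ⟨v₀, hv₀⟩ : ∃ u : ℝ × ℝ → ℝ, ∀ p, u p = D (pt 1 0 0) 1 * p.1 + D (pt 0 1 0) 1 * p.2 :=
      ⟨_, fun _ => rfl⟩
    have huu : (fun p => u p - u₀ p) =O[𝓝 0] fun p => ‖p‖ ^ 2 :=
      (isBigO_pi.1 hD 0).congr_left fun p => by rw [hu, hu₀, ← hDlin]; rfl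
    have hvv : (fun p => v p - v₀ p) =O[𝓝 0] fun p => ‖p‖ ^ 2 :=
      (isBigO_pi.1 hD 1).congr_left fun p => by rw [hv, hv₀, ← hDlin]; rfl
    have hu1 : u₀ =O[𝓝 0] fun p => ‖p‖ :=
      ((hp1.const_mul_left _).add (hp2.const_mul_left _)).congr_left fun p => (hu₀ p).symm
    have hv1 : v₀ =O[𝓝 0] fun p => ‖p‖ :=
      ((hp1.const_mul_left _).add (hp2.const_mul_left _)).congr_left fun p => (hv₀ p).symm
    have h21 : (fun p : ℝ × ℝ => ‖p‖ ^ 2) =O[𝓝 0] fun p => ‖p‖ := by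
      simpa using isBigO_pow_of_le hn (by norm_num : 1 ≤ 2)
    have hu2 : u =O[𝓝 0] fun p => ‖p‖ := ((huu.trans h21).add hu1).congr_left fun p => by ring
    have hv2 : v =O[𝓝 0] fun p => ‖p‖ := ((hvv.trans h21).add hv1).congr_left fun p => by ring
    have hquart := hf.isBigO_quartic hn hp1 hp2 (z := fun _ => 0) (isBigO_zero _ _)
    have hQz := isBigO_quadraticForm hQ hz
    have hpow : (fun p => a * v p ^ (2 * m)) =O[𝓝 0] fun p => ‖p‖ ^ 5 :=
      ((hv2.pow (2 * m)).trans (isBigO_pow_of_le hn (by omega))).const_mul_left a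
    -- the difference of the quartic polynomials at `(u, v)` and `(u₀, v₀)`
    have hdiff : (fun p => c0 * ((u p - u₀ p) * (u p ^ 3 + u p ^ 2 * u₀ p + u p * u₀ p ^ 2
          + u₀ p ^ 3)) + c2 * ((u p - u₀ p) * ((u p + u₀ p) * v p ^ 2)
          + (v p - v₀ p) * ((v p + v₀ p) * u₀ p ^ 2))
          + c4 * ((v p - v₀ p) * (v p ^ 3 + v p ^ 2 * v₀ p + v p * v₀ p ^ 2 + v₀ p ^ 3)))
        =O[𝓝 0] fun p => ‖p‖ ^ 5 := by
      have hmul : ∀ {w c : ℝ × ℝ → ℝ}, (w =O[𝓝 0] fun p => ‖p‖ ^ 2) →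
          (c =O[𝓝 0] fun p => ‖p‖ ^ 3) → (fun p => w p * c p) =O[𝓝 0] fun p => ‖p‖ ^ 5 :=
        fun h1 h2 => (h1.mul h2).congr_right fun p => by ring
      have hcub : ∀ {w w₀ : ℝ × ℝ → ℝ}, (w =O[𝓝 0] fun p => ‖p‖) → (w₀ =O[𝓝 0] fun p => ‖p‖) →
          (fun p => w p ^ 3 + w p ^ 2 * w₀ p + w p * w₀ p ^ 2 + w₀ p ^ 3) =O[𝓝 0]
            fun p => ‖p‖ ^ 3 := fun {w w₀} h1 h2 => by
        refine ((IsBigO.add (h1.pow 3) ?_).add ?_).add (h2.pow 3)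
        · exact ((h1.pow 2).mul h2).congr_right fun p => by ring
        · exact (h1.mul (h2.pow 2)).congr_right fun p => by ring
      refine ((hmul huu (hcub hu2 hu1)).const_mul_left c0 |>.add
        (((hmul huu ?_).add (hmul hvv ?_)).const_mul_left c2)).add
        ((hmul hvv (hcub hv2 hv1)).const_mul_left c4)
      · exact ((hu2.add hu1).mul (hv2.pow 2)).congr_right fun p => by ring
      · exact ((hv2.add hv1).mul (hu1.pow 2)).congr_right fun p => by ring
    intro x y
    rw [← sub_eq_zero]
    refine eq_zero_of_homogeneous (m := 4) (q := fun x y => quarticForm f x y -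
      (c0 * (D (pt 1 0 0) 0 * x + D (pt 0 1 0) 0 * y) ^ 4
        + c2 * (D (pt 1 0 0) 0 * x + D (pt 0 1 0) 0 * y) ^ 2
          * (D (pt 1 0 0) 1 * x + D (pt 0 1 0) 1 * y) ^ 2
        + c4 * (D (pt 1 0 0) 1 * x + D (pt 0 1 0) 1 * y) ^ 4)) (fun t x y => ?_) ?_ x y
    · simp only [quarticForm]; ring
    · have h6 : ∀ k, 5 ≤ k → (fun p : ℝ × ℝ => ‖p‖ ^ k) =O[𝓝 0] fun p => ‖p‖ ^ 5 :=
        fun k hk => isBigO_pow_of_le hn hk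
      refine (((hdiff.add hpow).add ((hQz.congr_right fun p => (pow_mul _ 3 2).symm).trans
        (h6 6 (by norm_num)))).sub (hquart.trans (h6 6 (by norm_num)))).congr'
        ?_ EventuallyEq.rfl
      filter_upwards [hκ.eventually h.eq] with p hp
      have h0 := h.map_eq
      simp only [Function.comp_apply, splitForm, ← hu, ← hv] at hp
      have h1 : f 0 = d := by
        rw [h0]
        have h2 : Q (fun _ : Fin n => 0) = 0 := QuadraticMap.map_zero Q
        have h3 : 2 * m ≠ 0 := by omega
        simp [splitForm, h2, h3]
      change f (pt p.1 p.2 0) = _ at hp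
      have h2 : (fun i : Fin n => Φ (κ p) i.succ.succ) = zpart (Φ (κ p)) := rfl
      rw [hp, h1, h2, ← hu₀, ← hv₀]
      ring
  · exact coord_ext rfl rfl (by ext i; exact hDz i 0 1)

/-! ### Comparison of equivalent germs: the modulus -/

/-- A quartic form with nondegenerate differential away from the origin has no multiple root. -/
theorem coeff_ne_zero_of_linear_change {ε η c s a t α β γ δ : ℝ} (hs : IsSign s) (ht : IsSign t)
    (ha : s = t → a ^ 2 ≠ 4) (hdet : α * δ - β * γ ≠ 0)
    (H : ∀ x y : ℝ, ε * x ^ 4 + η * x ^ 2 * y ^ 2 + c * y ^ 4 = s * (α * x + β * y) ^ 4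
      + a * (α * x + β * y) ^ 2 * (γ * x + δ * y) ^ 2 + t * (γ * x + δ * y) ^ 4) : c ≠ 0 := by
  rintro rfl
  obtain ⟨u, hu⟩ : ∃ u, u = 4 * s * β ^ 3 + 2 * a * β * δ ^ 2 := ⟨_, rfl⟩
  obtain ⟨v, hv⟩ : ∃ v, v = 2 * a * β ^ 2 * δ + 4 * t * δ ^ 3 := ⟨_, rfl⟩
  -- the coefficients at `y⁴` and `x y³`
  have h1 : β * u + δ * v = 0 := by
    rw [hu, hv]
    linear_combination -4 * H 0 1
  have h2 : α * u + γ * v = 0 := by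
    rw [hu, hv]
    linear_combination -(2 / 3 : ℝ) * (H 1 1 - H (-1) 1) + (1 / 12 : ℝ) * (H 2 1 - H (-2) 1)
  have hu0 : u = 0 := (mul_eq_zero.1 (by linear_combination δ * h2 - γ * h1 :
    (α * δ - β * γ) * u = 0)).resolve_left hdet
  have hv0 : v = 0 := (mul_eq_zero.1 (by linear_combination α * h1 - β * h2 :
    (α * δ - β * γ) * v = 0)).resolve_left hdet
  have hss : s * s = 1 := by rcases hs with rfl | rfl <;> norm_num
  have htt : t * t = 1 := by rcases ht with rfl | rfl <;> norm_num
  have hs0 : s ≠ 0 := by rintro rfl; simp at hss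
  have ht0 : t ≠ 0 := by rintro rfl; simp at htt
  by_cases hβ : β = 0
  · have : δ = 0 := by
      rw [hβ, hv0] at hv
      simpa [ht0] using hv.symm
    exact hdet (by rw [hβ, this]; ring)
  by_cases hδ : δ = 0
  · have : β = 0 := by
      rw [hδ, hu0] at hu
      simpa [hs0] using hu.symm
    exact hβ this
  -- `(β, δ)` is a critical point off the axes; this forces `a² = 4 s t`
  have e1 : 2 * s * β ^ 2 + a * δ ^ 2 = 0 := (mul_eq_zero.1 (by
    linear_combination (hu0 - hu) / 2 : β * (2 * s * β ^ 2 + a * δ ^ 2) = 0)).resolve_left hβ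
  have e2 : a * β ^ 2 + 2 * t * δ ^ 2 = 0 := (mul_eq_zero.1 (by
    linear_combination (hv0 - hv) / 2 : δ * (a * β ^ 2 + 2 * t * δ ^ 2) = 0)).resolve_left hδ
  have e3 : a ^ 2 - 4 * s * t = 0 := (mul_eq_zero.1 (by
    linear_combination a * e1 - 2 * s * e2 : δ ^ 2 * (a ^ 2 - 4 * s * t) = 0)).resolve_left
      (pow_ne_zero 2 hδ)
  rcases hs with rfl | rfl <;> rcases ht with rfl | rfl
  · exact ha rfl (by linarith)
  · nlinarith [sq_nonneg a]
  · nlinarith [sq_nonneg a]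
  · exact ha rfl (by linarith)

/-- The linear changes between quartic forms of the type `x² (s x² + t y²)`: the double line is
preserved, and then the factor `s x² + t y²` as well. -/
theorem linear_change_of_double_root {ε η c s t α β γ δ : ℝ} (hε : IsSign ε) (hη : IsSign η)
    (hs : IsSign s) (ht : IsSign t) (hdet : α * δ - β * γ ≠ 0)
    (H : ∀ x y : ℝ, ε * x ^ 4 + η * x ^ 2 * y ^ 2 + c * y ^ 4 = s * (α * x + β * y) ^ 4
      + t * (α * x + β * y) ^ 2 * (γ * x + δ * y) ^ 2) :
    s = ε ∧ t = η ∧ β = 0 ∧ c = 0 ∧ δ ^ 2 = 1 := by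
  obtain ⟨p, hp⟩ : ∃ p, p = s * α ^ 2 + t * γ ^ 2 := ⟨_, rfl⟩
  obtain ⟨q, hq⟩ : ∃ q, q = s * β ^ 2 + t * δ ^ 2 := ⟨_, rfl⟩
  obtain ⟨r, hr⟩ : ∃ r, r = s * α * β + t * γ * δ := ⟨_, rfl⟩
  have hε0 : ε ≠ 0 := by rcases hε with rfl | rfl <;> norm_num
  have hs0 : s ≠ 0 := by rcases hs with rfl | rfl <;> norm_num
  have ht0 : t ≠ 0 := by rcases ht with rfl | rfl <;> norm_num
  have c4 : α ^ 2 * p = ε := by rw [hp]; linear_combination -H 1 0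
  have c0 : β ^ 2 * q = c := by rw [hq]; linear_combination -H 0 1
  have c3 : 2 * α ^ 2 * r + 2 * α * β * p = 0 := by
    rw [hp, hr]
    linear_combination (1 / 6 : ℝ) * (H 1 1 - H (-1) 1) - (1 / 12 : ℝ) * (H 2 1 - H (-2) 1)
  have c1 : 2 * α * β * q + 2 * β ^ 2 * r = 0 := by
    rw [hq, hr]
    linear_combination -(2 / 3 : ℝ) * (H 1 1 - H (-1) 1) + (1 / 12 : ℝ) * (H 2 1 - H (-2) 1)
  have c2 : α ^ 2 * q + 4 * α * β * r + β ^ 2 * p = η := by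
    rw [hp, hq, hr]
    linear_combination -(1 / 2 : ℝ) * (H 1 1 + H (-1) 1) + H 1 0 + H 0 1
  have hα : α ≠ 0 := by rintro rfl; simp at c4; exact hε0 c4.symm
  have hdisc : p * q - r ^ 2 ≠ 0 := by
    have : p * q - r ^ 2 = s * t * (α * δ - β * γ) ^ 2 := by rw [hp, hq, hr]; ring
    rw [this]
    exact mul_ne_zero (mul_ne_zero hs0 ht0) (pow_ne_zero 2 hdet)
  have e3 : α * r + β * p = 0 := (mul_eq_zero.1 (by linear_combination c3 / 2 :
    α * (α * r + β * p) = 0)).resolve_left hα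
  have hβ : β = 0 := by
    by_contra hβ
    have e1 : α * q + β * r = 0 := (mul_eq_zero.1 (by linear_combination c1 / 2 :
      β * (α * q + β * r) = 0)).resolve_left hβ
    exact hdisc ((mul_eq_zero.1 (by linear_combination p * e1 - r * e3 :
      α * (p * q - r ^ 2) = 0)).resolve_left hα)
  subst hβ
  have hδ : δ ≠ 0 := by rintro rfl; simp at hdet
  have hr0 : r = 0 := by simpa [hα] using e3
  have hγ : γ = 0 := by
    rw [hr0] at hr
    simpa [ht0, hδ] using hr.symm
  subst hγ
  have hsε : α ^ 4 * s = ε := by rw [← c4, hp]; ring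
  have hα4 : 0 < α ^ 4 := by positivity
  have hs' : s = ε := by
    rcases hs with rfl | rfl <;> rcases hε with rfl | rfl <;> first | rfl | linarith
  have hα1 : α ^ 2 = 1 := by
    have h4 : (α ^ 2 - 1) * (α ^ 2 + 1) = 0 := by
      have : s * (α ^ 4 - 1) = 0 := by linear_combination hsε - hs'
      linear_combination (mul_eq_zero.1 this).resolve_left hs0
    have h5 : α ^ 2 + 1 ≠ 0 := by positivity
    linarith [(mul_eq_zero.1 h4).resolve_right h5]
  have htδ : t * δ ^ 2 = η := by
    rw [hα1, hq] at c2
    linarith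
  have hδ2 : 0 < δ ^ 2 := by positivity
  have ht' : t = η := by
    rcases ht with rfl | rfl <;> rcases hη with rfl | rfl <;> first | rfl | linarith
  refine ⟨hs', ht', rfl, by simpa using c0.symm, ?_⟩
  have : t * (δ ^ 2 - 1) = 0 := by linear_combination htδ - ht'
  linarith [(mul_eq_zero.1 this).resolve_left ht0]

theorem pderivCoord_x_splitForm {n : ℕ} {d : ℝ} {G : ℝ → ℝ → ℝ}
    {Q : QuadraticForm ℝ (Fin n → ℝ)} (hG : ContDiff ℝ ∞ fun p : ℝ × ℝ => G p.1 p.2)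
    (hQ : Q.Nondegenerate) (k : Coord n) {G' : ℝ}
    (h : HasDerivAt (fun x => G x (k 1)) G' (k 0)) :
    pderivCoord 0 (splitForm d G Q) k = G' := by
  rw [pderivCoord, ← ((contDiff_splitForm hG hQ).differentiable (by simp) k).lineDeriv_eq_fderiv]
  refine HasLineDerivAt.lineDeriv ?_
  have h1 : ∀ t : ℝ, splitForm d G Q (k + t • Pi.single 0 1) =
      d + G (k 0 + t) (k 1) + Q (zpart k) := fun t => by
    have h2 : (fun j : Fin n => (k + t • (Pi.single 0 1 : Coord n)) j.succ.succ) = zpart k := by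
      ext j; simp [zpart]
    rw [splitForm, h2]
    simp
  unfold HasLineDerivAt
  simp only [h1]
  have h2 := ((HasDerivAt.comp_const_add (k 0) 0 (by simpa using h)).const_add d).add_const (Q (zpart k))
  simpa using h2

theorem isBigO_of_mul_sq {u : ℝ → ℝ} (h0 : u 0 = 0) {N : ℕ}
    (h : (fun t => u t * t ^ 2) =O[𝓝 0] fun t : ℝ => t ^ (N + 2)) :
    u =O[𝓝 0] fun t : ℝ => t ^ N := by
  obtain ⟨C, hC0, hC⟩ := h.exists_nonneg
  refine IsBigO.of_bound C ?_
  filter_upwards [hC.bound] with t ht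
  by_cases h : t = 0
  · subst h
    rw [h0, norm_zero]
    positivity
  · rw [norm_mul, pow_add, norm_mul, ← mul_assoc] at ht
    exact le_of_mul_le_mul_right ht (norm_pos_iff.2 (pow_ne_zero 2 h))

theorem isBigO_pow_sub_pow {A : ℝ → ℝ} (h : (fun t => A t - t ^ 2) =O[𝓝 0] fun t : ℝ => t ^ 3)
    (m : ℕ) : (fun t => A t ^ m - t ^ (2 * m)) =O[𝓝 0] fun t : ℝ => t ^ (2 * m + 1) := by
  have hA : A =O[𝓝 0] fun t : ℝ => t ^ 2 :=
    ((IsBigO.pow_mono h (by norm_num : 2 ≤ 3)).add (isBigO_refl _ _)).congr_left fun t => by ring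
  induction m with
  | zero => simpa using isBigO_zero _ _
  | succ m ih =>
    have h1 : (fun t => A t ^ m * (A t - t ^ 2)) =O[𝓝 0] fun t : ℝ => t ^ (2 * (m + 1) + 1) :=
      ((hA.pow m).mul h).congr_right fun t => by ring
    have h2 : (fun t => t ^ 2 * (A t ^ m - t ^ (2 * m))) =O[𝓝 0]
        fun t : ℝ => t ^ (2 * (m + 1) + 1) :=
      ((isBigO_refl (fun t : ℝ => t ^ 2) _).mul ih).congr_right fun t => by ring
    exact (h1.add h2).congr_left fun t => by ring

/-- The derivative of `f` along a critical curve has the order of the derivative of the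
restriction of `f` to the curve. -/
theorem IsCritCurve.isBigO_pderiv {n : ℕ} {f : Coord n → ℝ} (hf : ContDiff ℝ ∞ f) {X : ℝ → ℝ}
    {Z : ℝ → Fin n → ℝ} (hc : IsCritCurve f X Z) {k : ℕ}
    (h : (fun t => f (pt (X t) t (Z t)) - f 0) =O[𝓝 0] fun t : ℝ => t ^ (k + 1))
    (i : Fin (n + 2)) :
    (fun t => pderivCoord i f (pt (X t) t (Z t))) =O[𝓝 0] fun t : ℝ => t ^ k := by
  induction i using Fin.cases with
  | zero => exact (isBigO_zero _ _).congr' (hc.crit_x.mono fun t ht => ht.symm) EventuallyEq.rfl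
  | succ i =>
    induction i using Fin.cases with
    | succ i =>
      exact (isBigO_zero _ _).congr' (hc.crit_z.mono fun t ht => (ht i).symm) EventuallyEq.rfl
    | zero =>
      have hκ : ContDiff ℝ ∞ fun t => pt (X t) t (Z t) :=
        ContDiff.pt hc.smooth_x contDiff_id hc.smooth_z
      refine (isBigO_deriv_of_isBigO ((hf.comp hκ).sub contDiff_const) h).congr' ?_
        EventuallyEq.rfl
      filter_upwards [hc.crit_x, hc.crit_z] with t h0 hz
      have h1 := (hκ.differentiable (by simp) t).hasDerivAt
      have h2 := ((hf.differentiable (by simp) (pt (X t) t (Z t))).hasFDerivAt.comp_hasDerivAt t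
        h1).sub_const (f 0)
      rw [fderiv_apply_eq_sum, Fin.sum_univ_succ, Fin.sum_univ_succ, h0] at h2
      have h3 : deriv (fun t => pt (X t) t (Z t)) t 1 = 1 :=
        ((hasDerivAt_pi.1 h1 1).unique (hasDerivAt_id' t))
      simp only [hz, mul_zero, Finset.sum_const_zero, zero_add, add_zero] at h2
      refine h2.deriv.trans ?_
      change deriv (fun t => pt (X t) t (Z t)) t 1 * pderivCoord 1 f (pt (X t) t (Z t)) = _
      rw [h3, one_mul]
      rfl

/-- If `f` is equivalent to the normal form `s x⁴ + θ x² y² + a y^(2m)`, then `a y^(2m)` is the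
leading term of `f` along a critical curve: a lower bound `t^(2k)` for the order of `f` along the
curve is one for the derivative of the normal form at the image of the curve, which is therefore
so close to the `y`-axis that the bound improves as long as `k < m`. -/
theorem Normalized.isBigO_of_equiv {n : ℕ} {ε η : ℝ} (hε : IsSign ε) (hη : IsSign η)
    {f : Coord n → ℝ} (hf : Normalized ε η f) {X : ℝ → ℝ} {Z : ℝ → Fin n → ℝ}
    (hc : IsCritCurve f X Z) {s θ a d : ℝ} (hs : IsSign s) (hθ : IsSign θ) {m : ℕ} (hm : 3 ≤ m)
    {Q : QuadraticForm ℝ (Fin n → ℝ)} (hQ : Q.Nondegenerate)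
    (h : OddEquiv f (splitForm d (fun x y => s * x ^ 4 + θ * x ^ 2 * y ^ 2 + a * y ^ (2 * m)) Q)) :
    s = ε ∧ θ = η ∧ (fun t => f (pt (X t) t (Z t)) - f 0 - a * t ^ (2 * m)) =O[𝓝 0]
      fun t : ℝ => t ^ (2 * m + 1) := by
  have hGe : (fun x y : ℝ => s * x ^ 4 + θ * x ^ 2 * y ^ 2 + a * y ^ (2 * m)) =
      fun x y => s * x ^ 4 + θ * x ^ 2 * y ^ 2 + 0 * y ^ 4 + a * y ^ (2 * m) := by
    ext x y; ring
  rw [hGe] at h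
  obtain ⟨Φ, Ψ, h⟩ := h.exists_isGermEquiv
  obtain ⟨α, β, γ, δ, hdet, hlin, hD⟩ := h.exists_linear hf.toEvenCorankTwo hm hQ
  obtain ⟨hsε, hθη, hβ, hc0, hδ⟩ := linear_change_of_double_root hε hη hs hθ hdet (fun x y => by
    rw [← hf.quarticForm_eq, hlin]; ring)
  refine ⟨hsε, hθη, ?_⟩
  subst hβ
  have hG : ContDiff ℝ ∞ fun p : ℝ × ℝ => s * p.1 ^ 4 + θ * p.1 ^ 2 * p.2 ^ 2 + 0 * p.2 ^ 4
      + a * p.2 ^ (2 * m) := by fun_prop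
  have hθ0 : θ ≠ 0 := by rcases hθ with rfl | rfl <;> norm_num
  have hid : (fun t : ℝ => t) =O[𝓝 0] fun t : ℝ => t := isBigO_refl _ _
  -- the critical curve and its image
  let κ : ℝ → Coord n := fun t => pt (X t) t (Z t)
  have hκ : ContDiff ℝ ∞ κ := ContDiff.pt hc.smooth_x contDiff_id hc.smooth_z
  have hκ0 : κ 0 = 0 := map_zero_of_odd (Φ := κ) fun t => by
    simp only [κ, hc.odd_x, hc.odd_z, neg_pt]
  have hκt : Tendsto κ (𝓝 0) (𝓝 0) := by simpa [hκ0] using hκ.continuous.tendsto 0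
  have hκ3 : (fun t => κ t - t • pt 0 1 0) =O[𝓝 0] fun t : ℝ => t ^ 3 := by
    refine (isBigO_pt hc.order_x (isBigO_zero _ _) hc.order_z).congr_left fun t => ?_
    refine coord_ext ?_ ?_ ?_
    · simp [κ]
    · simp [κ]
    · ext i; simp [κ, zpart]
  have hκO : κ =O[𝓝 0] fun t : ℝ => t := by
    have h1 : (fun t : ℝ => t • (pt 0 1 0 : Coord n)) =O[𝓝 0] fun t : ℝ => t := by
      simpa using hid.smul (isBigO_const_const (pt 0 1 0 : Coord n) (one_ne_zero (α := ℝ)) _)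
    have h2 : (fun t => κ t - t • pt 0 1 0) =O[𝓝 0] fun t : ℝ => t := by
      simpa using IsBigO.pow_mono hκ3 (by norm_num : 1 ≤ 3)
    exact (h2.add h1).congr_left fun t => by abel
  have hΦ : (fun t => Φ (κ t) - t • pt 0 δ 0) =O[𝓝 0] fun t : ℝ => t ^ 2 := by
    have h1 := ((isBigO_sub_fderiv h.smooth).comp_tendsto hκt).trans (hκO.norm_left.pow 2)
    have h2 := ((fderiv ℝ Φ 0).isBigO_comp _ _).trans
      (IsBigO.pow_mono hκ3 (by norm_num : 2 ≤ 3))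
    refine (h1.add h2).congr_left fun t => ?_
    simp [h.map_zero, hD]
  let x : ℝ → ℝ := fun t => Φ (κ t) 0
  let y : ℝ → ℝ := fun t => Φ (κ t) 1
  let z : ℝ → Fin n → ℝ := fun t => zpart (Φ (κ t))
  have hx2 : x =O[𝓝 0] fun t : ℝ => t ^ 2 := (isBigO_pi.1 hΦ 0).congr_left fun t => by simp [x]
  have hx0 : x 0 = 0 := by simp [x, hκ0, h.map_zero]
  have hy2 : (fun t => y t - δ * t) =O[𝓝 0] fun t : ℝ => t ^ 2 :=
    (isBigO_pi.1 hΦ 1).congr_left fun t => by simp [y, mul_comm]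
  have hy1 : y =O[𝓝 0] fun t : ℝ => t := by
    have h2 : (fun t => y t - δ * t) =O[𝓝 0] fun t : ℝ => t := by
      simpa using IsBigO.pow_mono hy2 (by norm_num : 1 ≤ 2)
    exact (h2.add (hid.const_mul_left δ)).congr_left fun t => by ring
  have hyy : (fun t => y t ^ 2 - t ^ 2) =O[𝓝 0] fun t : ℝ => t ^ 3 :=
    (hy2.mul (hy1.add (hid.const_mul_left δ))).congr (fun t => by linear_combination -t ^ 2 * hδ)
      fun t => by ring
  have hym : (fun t => y t ^ (2 * m) - t ^ (2 * m)) =O[𝓝 0] fun t : ℝ => t ^ (2 * m + 1) :=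
    (isBigO_pow_sub_pow hyy m).congr_left fun t => by rw [← pow_mul]
  -- the `x`-derivative of the normal form is `x w`, where `w` has order two
  let w : ℝ → ℝ := fun t => 4 * s * x t ^ 2 + 2 * θ * y t ^ 2
  have hw : (fun t : ℝ => t ^ 2) =O[𝓝 0] w := by
    have h1 : (fun t => w t - 2 * θ * t ^ 2) =O[𝓝 0] fun t : ℝ => t ^ 3 := by
      have h2 : (fun t => x t ^ 2) =O[𝓝 0] fun t : ℝ => t ^ 3 :=
        IsBigO.pow_mono ((hx2.pow 2).congr_right fun t => by rw [← pow_mul])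
          (by norm_num : 3 ≤ 2 * 2)
      exact ((h2.const_mul_left (4 * s)).add (hyy.const_mul_left (2 * θ))).congr_left
        fun t => by simp only [w]; ring
    have h3 : (fun t => w t - 2 * θ * t ^ 2) =o[𝓝 0] fun t : ℝ => 2 * θ * t ^ 2 := by
      refine (h1.trans_isLittleO ?_)
      refine IsLittleO.const_mul_right (by simpa using hθ0) ?_
      exact isLittleO_pow_pow (by norm_num)
    have h4 : (fun t : ℝ => 2 * θ * t ^ 2) =O[𝓝 0] w :=
      (show w ~[𝓝 0] (fun t : ℝ => 2 * θ * t ^ 2) from h3).isBigO_symm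
    exact (h4.const_mul_left (1 / (2 * θ))).congr_left fun t => by field_simp
  -- `∂/∂x` and `∂/∂z` of the normal form are `O(t^(2k-1))` at the image of the curve, hence
  -- `x = O(t^(2k-3))` and `z = O(t^(2k-1))`; the terms other than `a y^(2m)` are `O(t^(4k-4))`
  have hstep : ∀ k, 3 ≤ k → ((fun t => f (κ t) - f 0) =O[𝓝 0] fun t : ℝ => t ^ (2 * k)) →
      ∀ N, N ≤ 4 * k - 4 → N ≤ 2 * m + 1 →
      (fun t => f (κ t) - f 0 - a * t ^ (2 * m)) =O[𝓝 0] fun t : ℝ => t ^ N := by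
    intro k hk hO N hN hNm
    have hgrad := h.isBigO_pderiv hf.smooth hκt (hc.isBigO_pderiv hf.smooth (k := 2 * k - 1)
      (by rwa [show 2 * k - 1 + 1 = 2 * k by omega]))
    have hz : z =O[𝓝 0] fun t : ℝ => t ^ (2 * k - 1) := isBigO_zpart_of_pderiv hG hQ hgrad
    have hx : x =O[𝓝 0] fun t : ℝ => t ^ (2 * k - 3) := by
      refine isBigO_of_mul_sq hx0 (((isBigO_refl x (𝓝 0)).mul hw).trans ?_)
      rw [show 2 * k - 3 + 2 = 2 * k - 1 by omega]
      refine (hgrad 0).congr_left fun t => ?_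
      rw [pderivCoord_x_splitForm hG hQ]
      have h1 := (((((hasDerivAt_id (Φ (κ t) 0)).pow 4).const_mul s).add
        ((((hasDerivAt_id (Φ (κ t) 0)).pow 2).const_mul θ).mul_const (Φ (κ t) 1 ^ 2))).add_const
          (0 * Φ (κ t) 1 ^ 4)).add_const (a * Φ (κ t) 1 ^ (2 * m))
      refine h1.congr_deriv ?_
      simp [x, w, y]
      ring
    have hQz := isBigO_quadraticForm hQ hz
    have h1 : (fun t => s * x t ^ 4) =O[𝓝 0] fun t : ℝ => t ^ N :=
      IsBigO.pow_mono (((hx.pow 4).congr_right fun t => (pow_mul _ _ _).symm).const_mul_left s)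
        (by omega)
    have h2 : (fun t => θ * (x t ^ 2 * y t ^ 2)) =O[𝓝 0] fun t : ℝ => t ^ N :=
      IsBigO.pow_mono ((((hx.pow 2).mul (hy1.pow 2)).congr_right fun t => by
        rw [← pow_mul, ← pow_add]).const_mul_left θ) (by omega)
    have h3 : (fun t => Q (z t)) =O[𝓝 0] fun t : ℝ => t ^ N :=
      IsBigO.pow_mono (hQz.congr_right fun t => (pow_mul _ _ _).symm) (by omega)
    have h4 := (IsBigO.pow_mono hym hNm).const_mul_left a
    refine (((h1.add h2).add h3).add h4).congr' ?_ EventuallyEq.rfl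
    filter_upwards [hκt.eventually h.eq] with t ht
    have h5 : f 0 = d := by
      rw [h.map_eq]
      have h2 : Q (fun _ : Fin n => 0) = 0 := QuadraticMap.map_zero Q
      have h3 : 2 * m ≠ 0 := by omega
      simp [splitForm, h2, h3]
    rw [ht, h5]
    change _ = d + (s * x t ^ 4 + θ * x t ^ 2 * y t ^ 2 + 0 * y t ^ 4 + a * y t ^ (2 * m)) + Q (z t)
      - d - a * t ^ (2 * m)
    ring
  -- the quartic form of `f` has no term `y⁴`
  have hbase : (fun t => f (κ t) - f 0) =O[𝓝 0] fun t : ℝ => t ^ 6 := by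
    have hX1 : X =O[𝓝 0] fun t : ℝ => t := by
      simpa using IsBigO.pow_mono hc.order_x (by norm_num : 1 ≤ 3)
    have h1 := hf.isBigO_quartic (l := 𝓝 (0 : ℝ)) (r := fun t => t) tendsto_id hX1 hid hc.order_z
    have h2 : (fun t => X t ^ 2 * (ε * X t ^ 2 + η * t ^ 2)) =O[𝓝 0] fun t : ℝ => t ^ 6 := by
      have h3 : (fun t => ε * X t ^ 2 + η * t ^ 2) =O[𝓝 0] fun t : ℝ => t ^ 0 :=
        IsBigO.pow_mono (((hX1.pow 2).const_mul_left ε).add ((hid.pow 2).const_mul_left η))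
          (by norm_num : 0 ≤ 2)
      exact ((hc.order_x.pow 2).mul h3).congr_right fun t => by ring
    refine (h1.add h2).congr_left fun t => ?_
    simp only [hf.quarticForm_eq, hc0, κ]
    ring
  have hall : ∀ k, 3 ≤ k → k ≤ m → (fun t => f (κ t) - f 0) =O[𝓝 0] fun t : ℝ => t ^ (2 * k) := by
    intro k hk
    induction k, hk using Nat.le_induction with
    | base => exact fun _ => hbase
    | succ k hk ih =>
      intro hkm
      have h1 := hstep k hk (ih (by omega)) (2 * (k + 1)) (by omega) (by omega)
      have h2 : (fun t : ℝ => a * t ^ (2 * m)) =O[𝓝 0] fun t : ℝ => t ^ (2 * (k + 1)) :=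
        (isBigO_pow_id (by omega)).const_mul_left a
      exact (h1.add h2).congr_left fun t => by ring
  exact hstep m hm (hall m hm le_rfl) (2 * m + 1) (by omega) le_rfl

/-! ### The critical curve as a formal computation -/

theorem map_contr {R S : Type*} [CommRing R] [CommRing S] (φ : R →+* S) {n : ℕ} (c : ℕ) :
    ∀ (G : List (Fin n) → R) (z : Fin n → R),
      φ (contr c G z) = contr c (fun l => φ (G l)) fun i => φ (z i) := by
  induction c with
  | zero => exact fun G z => rfl
  | succ c ih => exact fun G z => by simp only [contr, map_sum, map_mul, ih]

theorem map_taylorSum {R S : Type*} [CommRing R] [Algebra ℚ R] [CommRing S] [Algebra ℚ S]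
    (φ : R →+* S) {n : ℕ} (I : Finset (ℕ × ℕ × ℕ)) (G : ℕ → ℕ → List (Fin n) → R) (x y : R)
    (z : Fin n → R) :
    φ (taylorSum I G x y z) =
      taylorSum I (fun a b l => φ (G a b l)) (φ x) (φ y) fun i => φ (z i) := by
  simp only [taylorSum, map_sum, map_mul, map_pow, map_contr, RingHom.map_rat_algebraMap]

theorem contr_sub {R : Type*} [CommRing R] {n : ℕ} (c : ℕ) :
    ∀ (G G' : List (Fin n) → R) (z : Fin n → R),
      contr c G z - contr c G' z = contr c (fun l => G l - G' l) z := by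
  induction c with
  | zero => exact fun G G' z => rfl
  | succ c ih =>
    intro G G' z
    simp only [contr, ← ih, mul_sub, Finset.sum_sub_distrib]

theorem taylorSum_sub {R : Type*} [CommRing R] [Algebra ℚ R] {n : ℕ} (I : Finset (ℕ × ℕ × ℕ))
    (G G' : ℕ → ℕ → List (Fin n) → R) (x y : R) (z : Fin n → R) :
    taylorSum I G x y z - taylorSum I G' x y z =
      taylorSum I (fun a b l => G a b l - G' a b l) x y z := by
  simp only [taylorSum, ← Finset.sum_sub_distrib, ← contr_sub, mul_sub]

theorem taylorSum_eq_zero {R : Type*} [CommRing R] [Algebra ℚ R] {n : ℕ}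
    (I : Finset (ℕ × ℕ × ℕ)) (x y : R) (z : Fin n → R) :
    taylorSum I (fun _ _ _ => (0 : R)) x y z = 0 := by
  simp [taylorSum, contr_zero]

namespace FormalCurve

variable {R S : Type*} [CommRing R] [Algebra ℚ R] [CommRing S] [Algebra ℚ S] {n : ℕ}

open Polynomial

/-- The `x`-derivative of the series with coefficients `G`, along the curve `(x, t, z)`. -/
def dx (L : ℕ) (G : ℕ → ℕ → List (Fin n) → R) (x : R[X]) (z : Fin n → R[X]) : R[X] :=
  taylorSum (degSet L) (fun a b l => C (G (a + 1) b l)) x X z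

/-- The `z`-derivatives of the series with coefficients `G`, along the curve `(x, t, z)`. -/
def dz (L : ℕ) (G : ℕ → ℕ → List (Fin n) → R) (x : R[X]) (z : Fin n → R[X]) (i : Fin n) : R[X] :=
  taylorSum (degSet L) (fun a b l => C (G a b (i :: l))) x X z

/-- One step of the iteration that solves `H z + ∂T/∂z = 0` and `2 σ t² x + ∂T/∂x = 0` along
`(x, t, z)`, where `T` is the series with coefficients `G`, `σ = ±1` and `Hi` is the inverse
of `H`. -/
def step (σ : ℚ) (L : ℕ) (G : ℕ → ℕ → List (Fin n) → R) (Hi : Fin n → Fin n → R)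
    (u : R[X] × (Fin n → R[X])) : R[X] × (Fin n → R[X]) :=
  let z' : Fin n → R[X] := fun i => -∑ j, C (Hi i j) * dz L G u.1 u.2 j
  (-(C (algebraMap ℚ R (σ / 2)) * (dx L G u.1 z').divX.divX), z')

/-- The iterates of `step`, starting from the `y`-axis. -/
def curve (σ : ℚ) (L : ℕ) (G : ℕ → ℕ → List (Fin n) → R) (Hi : Fin n → Fin n → R) :
    ℕ → R[X] × (Fin n → R[X])
  | 0 => (0, 0)
  | k + 1 => step σ L G Hi (curve σ L G Hi k)

/-- The function `σ x² t² + ½ zᵀ H z + T` along a curve `(x, t, z)` on which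
`H z = -∂T/∂z` and `2 σ t² x = -∂T/∂x`. -/
def value (I : Finset (ℕ × ℕ × ℕ)) (L : ℕ) (G : ℕ → ℕ → List (Fin n) → R)
    (u : R[X] × (Fin n → R[X])) : R[X] :=
  taylorSum I (fun a b l => C (G a b l)) u.1 X u.2
    - C (algebraMap ℚ R (1 / 2)) * (u.1 * dx L G u.1 u.2 + ∑ j, u.2 j * dz L G u.1 u.2 j)

theorem map_dx (φ : R →+* S) (L : ℕ) (G : ℕ → ℕ → List (Fin n) → R) (x : R[X])
    (z : Fin n → R[X]) :
    (dx L G x z).map φ = dx L (fun a b l => φ (G a b l)) (x.map φ) fun i => (z i).map φ := by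
  have := map_taylorSum (mapRingHom φ) (degSet L) (fun a b l => C (G (a + 1) b l)) x X z
  simpa [dx] using this

theorem map_dz (φ : R →+* S) (L : ℕ) (G : ℕ → ℕ → List (Fin n) → R) (x : R[X])
    (z : Fin n → R[X]) (i : Fin n) :
    (dz L G x z i).map φ = dz L (fun a b l => φ (G a b l)) (x.map φ) (fun i => (z i).map φ) i := by
  have := map_taylorSum (mapRingHom φ) (degSet L) (fun a b l => C (G a b (i :: l))) x X z
  simpa [dz] using this

theorem map_divX {R S : Type*} [CommRing R] [CommRing S] (φ : R →+* S) (p : R[X]) : p.divX.map φ = (p.map φ).divX := by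
  ext; simp [coeff_divX]

/-- The curve with the coefficients mapped by `φ`. -/
def mapCurve (φ : R →+* S) (u : R[X] × (Fin n → R[X])) : S[X] × (Fin n → S[X]) :=
  (u.1.map φ, fun i => (u.2 i).map φ)

theorem map_step (φ : R →+* S) (σ : ℚ) (L : ℕ) (G : ℕ → ℕ → List (Fin n) → R)
    (Hi : Fin n → Fin n → R) (u : R[X] × (Fin n → R[X])) :
    mapCurve φ (step σ L G Hi u) =
      step σ L (fun a b l => φ (G a b l)) (fun i j => φ (Hi i j))
        (mapCurve φ u) := by
  have h : ∀ q : ℚ, φ (algebraMap ℚ R q) = algebraMap ℚ S q := RingHom.map_rat_algebraMap φ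
  simp only [step, mapCurve, Polynomial.map_neg, Polynomial.map_mul, map_C, h, map_divX,
    map_dx, map_dz, Polynomial.map_sum]

theorem map_curve (φ : R →+* S) (σ : ℚ) (L : ℕ) (G : ℕ → ℕ → List (Fin n) → R)
    (Hi : Fin n → Fin n → R) (k : ℕ) :
    mapCurve φ (curve σ L G Hi k) =
      curve σ L (fun a b l => φ (G a b l)) (fun i j => φ (Hi i j)) k := by
  induction k with
  | zero => simp [curve, mapCurve, Pi.zero_def]
  | succ k ih => rw [curve, map_step, ih, curve]

theorem map_value (φ : R →+* S) (I : Finset (ℕ × ℕ × ℕ)) (L : ℕ) (G : ℕ → ℕ → List (Fin n) → R)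
    (u : R[X] × (Fin n → R[X])) :
    (value I L G u).map φ = value I L (fun a b l => φ (G a b l))
      (mapCurve φ u) := by
  have h := map_taylorSum (mapRingHom φ) I (fun a b l => C (G a b l)) u.1 X u.2
  simp only [coe_mapRingHom, map_C, map_X] at h
  simp only [value, Polynomial.map_sub, h, Polynomial.map_mul, map_C,
    RingHom.map_rat_algebraMap φ, Polynomial.map_add, map_dx, Polynomial.map_sum, map_dz,
    mapCurve]

theorem value_zero (I : Finset (ℕ × ℕ × ℕ)) (L : ℕ) (u : R[X] × (Fin n → R[X])) :
    value I L (fun _ _ _ => 0) u = 0 := by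
  simp only [value, dx, dz, C_0, taylorSum_eq_zero, mul_zero, Finset.sum_const_zero, add_zero,
    sub_zero]

theorem eval_dx (L : ℕ) (G : ℕ → ℕ → List (Fin n) → ℝ) (x : ℝ[X]) (z : Fin n → ℝ[X]) (t : ℝ) :
    (dx L G x z).eval t =
      taylorSum (degSet L) (fun a b l => G (a + 1) b l) (x.eval t) t fun i => (z i).eval t := by
  have := map_taylorSum (evalRingHom t) (degSet L) (fun a b l => C (G (a + 1) b l)) x X z
  simpa [dx] using this

theorem eval_dz (L : ℕ) (G : ℕ → ℕ → List (Fin n) → ℝ) (x : ℝ[X]) (z : Fin n → ℝ[X]) (i : Fin n)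
    (t : ℝ) : (dz L G x z i).eval t =
      taylorSum (degSet L) (fun a b l => G a b (i :: l)) (x.eval t) t fun i => (z i).eval t := by
  have := map_taylorSum (evalRingHom t) (degSet L) (fun a b l => C (G a b (i :: l))) x X z
  simpa [dz] using this

end FormalCurve

/-! ### The jets that enter the correction polynomials -/

theorem sum_multiIdx {n : ℕ} (a b : ℕ) (l : List (Fin n)) :
    ∑ i, multiIdx a b l i = a + b + l.length := by
  rw [Fin.sum_univ_succ, Fin.sum_univ_succ]
  have h : ∑ i : Fin n, l.count i = l.length := by
    have := Multiset.sum_count_eq_card (s := (Finset.univ : Finset (Fin n)))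
      (m := (l : Multiset (Fin n))) (fun a _ => Finset.mem_univ a)
    simpa using this
  simp [multiIdx, h, add_assoc]

theorem allowed_multiIdx {n μ a b : ℕ} {l : List (Fin n)} :
    JetVar.Allowed μ (Sum.inl (multiIdx a b l)) ↔
      4 ≤ a + b + l.length ∧ a + b + l.length + 8 ≤ 2 * μ ∧ (a ≠ 0 ∨ l ≠ []) := by
  simp only [JetVar.Allowed, sum_multiIdx]
  refine and_congr_right fun _ => and_congr_right fun _ => ⟨?_, ?_⟩
  · rintro ⟨i, hi, h⟩
    induction i using Fin.cases with
    | zero => exact Or.inl h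
    | succ i =>
      induction i using Fin.cases with
      | zero => exact absurd rfl hi
      | succ i =>
        right
        rintro rfl
        exact h (by simp [multiIdx])
  · rintro (h | h)
    · exact ⟨0, by simp, h⟩
    · obtain ⟨i, hi⟩ := List.exists_mem_of_ne_nil l h
      refine ⟨i.succ.succ, by simp [Fin.ext_iff], ?_⟩
      have : 0 < l.count i := List.count_pos_iff.2 hi
      simpa [multiIdx] using this.ne'

/-- The derivatives that are indeterminates of the correction polynomial of `x_{e,μ}`, except for
the normalized derivatives `f_{x²y²}` and `f_{xy³}`. -/
def IsHigher {n : ℕ} (μ a b : ℕ) (l : List (Fin n)) : Prop :=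
  JetVar.Allowed μ (Sum.inl (multiIdx a b l)) ∧ ¬(a = 2 ∧ b = 2 ∧ l = []) ∧
    ¬(a = 1 ∧ b = 3 ∧ l = [])

open Classical in
/-- The derivatives of `f` of the type `IsHigher`. -/
def higherJet {n : ℕ} (μ : ℕ) (f : Coord n → ℝ) (a b : ℕ) (l : List (Fin n)) : ℝ :=
  if IsHigher μ a b l then jet f a b l else 0

open Classical in
/-- The indeterminates for the derivatives of the type `IsHigher`. -/
def higherVar {n : ℕ} (μ a b : ℕ) (l : List (Fin n)) :
    MvPolynomial {v : JetVar n // JetVar.Allowed μ v} ℚ :=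
  if h : IsHigher μ a b l then MvPolynomial.X ⟨_, h.1⟩ else 0

/-- The correction polynomial of order `2m`, for `μ = m + 3`. -/
def correction (n : ℕ) (σ : ℚ) (m : ℕ) : MvPolynomial (JetVar n) ℚ :=
  MvPolynomial.rename Subtype.val ((Nat.factorial (2 * m) : ℚ) •
    (FormalCurve.value (wset 3 3 (2 * m + 1)) (2 * m - 1) (higherVar (m + 3))
      (FormalCurve.curve σ (2 * m - 1) (higherVar (m + 3))
        (fun i j : Fin n => MvPolynomial.X ⟨Sum.inr (i, j), trivial⟩) (m - 2))).coeff (2 * m))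

/-- The computation takes place in the polynomial ring in the allowed indeterminates. -/
theorem allowed_of_mem_vars_correction {n : ℕ} {σ : ℚ} {m : ℕ} {v : JetVar n}
    (hv : v ∈ (correction n σ m).vars) : JetVar.Allowed (m + 3) v := by
  classical
  obtain ⟨w, -, rfl⟩ := Finset.mem_image.1 (MvPolynomial.vars_rename _ _ hv)
  exact w.2

/-- When all jets are set to zero, so are the curve and the value along it. -/
theorem constantCoeff_correction (n : ℕ) (σ : ℚ) (m : ℕ) :
    MvPolynomial.constantCoeff (correction n σ m) = 0 := by
  rw [correction, MvPolynomial.constantCoeff_rename, MvPolynomial.constantCoeff_smul,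
    ← Polynomial.coeff_map, FormalCurve.map_value, FormalCurve.map_curve]
  have h : (fun a b (l : List (Fin n)) => MvPolynomial.constantCoeff (R := ℚ)
      (higherVar (m + 3) a b l)) = fun _ _ _ => 0 := by
    ext a b l
    simp only [higherVar]
    split_ifs <;> simp
  rw [h, FormalCurve.value_zero]
  simp

/-- The correction polynomial specializes to the result of the same formal computation with the
real jet of `f`. -/
theorem evalJet_correction {n : ℕ} (f : Coord n → ℝ) (σ : ℚ) (m : ℕ) :
    evalJet f (correction n σ m) = (Nat.factorial (2 * m) : ℝ) *
      (FormalCurve.value (wset 3 3 (2 * m + 1)) (2 * m - 1) (higherJet (m + 3) f)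
      (FormalCurve.curve σ (2 * m - 1) (higherJet (m + 3) f) (hessInv f) (m - 2))).coeff
        (2 * m) := by
  rw [evalJet, correction, MvPolynomial.aeval_rename, map_smul]
  set φ := MvPolynomial.aeval (R := ℚ) ((Sum.elim (fun α => pd f α) fun p => hessInv f p.1 p.2) ∘
    (Subtype.val : {v : JetVar n // JetVar.Allowed (m + 3) v} → JetVar n)) with hφ
  have h1 : ∀ p, φ p = (φ : _ →+* ℝ) p := fun p => rfl
  rw [h1, ← Polynomial.coeff_map, FormalCurve.map_value, FormalCurve.map_curve]
  have h2 : (fun a b (l : List (Fin n)) => (φ : _ →+* ℝ) (higherVar (m + 3) a b l)) =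
      higherJet (m + 3) f := by
    ext a b l
    simp only [higherVar, higherJet]
    split_ifs
    · simp [hφ, jet]
    · simp
  have h3 : (fun i j : Fin n => (φ : MvPolynomial {v : JetVar n // JetVar.Allowed (m + 3) v} ℚ →+* ℝ)
      (MvPolynomial.X ⟨Sum.inr (i, j), trivial⟩)) =
      hessInv f := by
    ext i j
    simp [hφ]
  rw [h2, h3, Rat.smul_def]
  simp

/-! ### Comparison of the formal and the actual critical curve -/

theorem degSet_eq_wset (L : ℕ) : degSet L = wset 1 1 L := by
  ext s
  rw [mem_degSet, mem_wset le_rfl le_rfl]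
  simp

namespace Normalized

variable {n : ℕ} {ε η : ℝ} {f : Coord n → ℝ}

/-- Up to the order that matters for `x_{e,μ}`, `μ = m + 3`, the nonzero derivatives that are not of
the type `IsHigher` are `f_{x²y²}`, those in `y` only, and the Hessian block. -/
theorem jet_sub_higherJet (hf : Normalized ε η f) {m a b : ℕ} {l : List (Fin n)}
    (h1 : ¬(a = 2 ∧ b = 2 ∧ l.length = 0)) (h2 : ¬(a = 0 ∧ l.length = 0))
    (h3 : ¬(a = 0 ∧ b = 0 ∧ l.length = 2)) (hN : a + b + l.length + 1 ≤ 2 * m) :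
    jet f a b l - higherJet (m + 3) f a b l = 0 := by
  classical
  rw [List.length_eq_zero_iff] at h1 h2
  by_cases h : IsHigher (m + 3) a b l
  · rw [higherJet, if_pos h, sub_self]
  rw [higherJet, if_neg h, sub_zero]
  rcases Nat.mod_two_eq_zero_or_one (a + b + l.length) with hp | hp
  swap
  · exact hf.jet_odd hp
  by_cases h4 : 4 ≤ a + b + l.length
  · have h5 : JetVar.Allowed (m + 3) (Sum.inl (multiIdx a b l)) :=
      allowed_multiIdx.2 ⟨h4, by omega, by tauto⟩
    simp only [IsHigher, h5, h1, not_false_eq_true, true_and, not_not] at h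
    obtain ⟨rfl, rfl, rfl⟩ := h
    exact hf.d13
  · rcases l with _ | ⟨i, l⟩
    · simp only [List.length_nil] at hp h4
      have : a ≠ 0 := by tauto
      exact hf.jet_two (by simp; omega) (by simp)
    · simp only [List.length_cons] at hp h4 h3 hN ⊢
      exact hf.jet_two (by simp only [List.length_cons]; omega)
        (by simp only [List.length_cons]; omega)

theorem higherJet_two_two (f : Coord n → ℝ) (μ : ℕ) : higherJet μ f 2 2 [] = 0 := by
  classical
  rw [higherJet, if_neg]
  simp [IsHigher]

theorem higherJet_pure (f : Coord n → ℝ) (μ b : ℕ) : higherJet μ f 0 b [] = 0 := by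
  classical
  rw [higherJet, if_neg]
  simp [IsHigher, allowed_multiIdx]

theorem higherJet_zz (f : Coord n → ℝ) (μ : ℕ) (i j : Fin n) : higherJet μ f 0 0 [i, j] = 0 := by
  classical
  rw [higherJet, if_neg]
  simp [IsHigher, allowed_multiIdx]

variable {x : ℝ → ℝ} {z : ℝ → Fin n → ℝ} {m : ℕ}

/-- The equation `∂f/∂x = 0` along `(x, t, z)`, in the form that is solved by iteration. -/
theorem isBigO_pderiv_x_higher (hf : Normalized ε η f) (hm : 3 ≤ m)
    (hx : x =O[𝓝 0] fun t : ℝ => t ^ 3) (hz : z =O[𝓝 0] fun t : ℝ => t ^ 3) :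
    (fun t => pderivCoord 0 f (pt (x t) t (z t)) - (2 * η * t ^ 2 * x t +
      taylorSum (degSet (2 * m - 1)) (fun a b l => higherJet (m + 3) f (a + 1) b l) (x t) t (z t)))
      =O[𝓝 0] fun t : ℝ => t ^ (2 * m - 1) := by
  refine (isBigO_taylor (l := 𝓝 (0 : ℝ)) (r := fun t => t) tendsto_id
    (contDiff_pderivCoord hf.smooth 0) le_rfl le_rfl (IsBigO.pow_mono hx (by norm_num))
    (isBigO_refl _ _) (IsBigO.pow_mono hz (by norm_num)) (2 * m - 1)).congr_left fun t => ?_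
  have h := taylorSum_sub (degSet (2 * m - 1)) (jet (pderivCoord 0 f))
    (fun a b l => higherJet (m + 3) f (a + 1) b l) (x t) t (z t)
  rw [taylorSum_subset (S := degSet (2 * m - 1)) (S' := {(1, 2, 0)})
    (G := fun a b l => jet (pderivCoord 0 f) a b l - higherJet (m + 3) f (a + 1) b l)] at h
  · rw [← degSet_eq_wset, eq_add_of_sub_eq h]
    simp [taylorSum, contr, Nat.factorial, jet_pderiv_x hf.smooth, hf.d22, higherJet_two_two]
    ring
  · intro s hs
    rw [Finset.mem_singleton.1 hs, mem_degSet]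
    simp only
    omega
  · rintro ⟨a, b, c⟩ hs hs' l hl
    rw [mem_degSet] at hs
    simp only [Finset.mem_singleton, Prod.mk.injEq] at hs' hs hl ⊢
    rw [jet_pderiv_x hf.smooth]
    exact hf.jet_sub_higherJet (by omega) (by omega) (by omega) (by omega)

/-- The equations `∂f/∂z = 0` along `(x, t, z)`, in the form that is solved by iteration. -/
theorem isBigO_pderiv_z_higher (hf : Normalized ε η f) (hm : 3 ≤ m)
    (hx : x =O[𝓝 0] fun t : ℝ => t ^ 3) (hz : z =O[𝓝 0] fun t : ℝ => t ^ 3) (i : Fin n) :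
    (fun t => pderivCoord i.succ.succ f (pt (x t) t (z t)) - ((jetZZ f 0 0 *ᵥ z t) i +
      taylorSum (degSet (2 * m - 1)) (fun a b l => higherJet (m + 3) f a b (i :: l))
        (x t) t (z t))) =O[𝓝 0] fun t : ℝ => t ^ (2 * m - 1) := by
  refine (isBigO_taylor (l := 𝓝 (0 : ℝ)) (r := fun t => t) tendsto_id
    (contDiff_pderivCoord hf.smooth i.succ.succ) le_rfl le_rfl (IsBigO.pow_mono hx (by norm_num))
    (isBigO_refl _ _) (IsBigO.pow_mono hz (by norm_num)) (2 * m - 1)).congr_left fun t => ?_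
  have h := taylorSum_sub (degSet (2 * m - 1)) (jet (pderivCoord i.succ.succ f))
    (fun a b l => higherJet (m + 3) f a b (i :: l)) (x t) t (z t)
  rw [taylorSum_subset (S := degSet (2 * m - 1)) (S' := {(0, 0, 1)})
    (G := fun a b l => jet (pderivCoord i.succ.succ f) a b l -
      higherJet (m + 3) f a b (i :: l))] at h
  · rw [← degSet_eq_wset, eq_add_of_sub_eq h]
    simp [taylorSum, contr, Nat.factorial, jet_pderiv_z hf.smooth, higherJet_zz, Matrix.mulVec,
      dotProduct, jetZZ, mul_comm]
  · intro s hs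
    rw [Finset.mem_singleton.1 hs, mem_degSet]
    simp only
    omega
  · rintro ⟨a, b, c⟩ hs hs' l hl
    rw [mem_degSet] at hs
    simp only [Finset.mem_singleton, Prod.mk.injEq] at hs' hs hl ⊢
    rw [jet_pderiv_z hf.smooth]
    exact hf.jet_sub_higherJet (by simp) (by simp) (by simp; omega)
      (by simp only [List.length_cons]; omega)

/-- The values of `f` along `(x, t, z)`, with the terms that are normalized or do not enter the
correction written separately. -/
theorem isBigO_higher (hf : Normalized ε η f) (hm : 3 ≤ m)
    (hx : x =O[𝓝 0] fun t : ℝ => t ^ 3) (hz : z =O[𝓝 0] fun t : ℝ => t ^ 3) :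
    (fun t => f (pt (x t) t (z t)) - (∑ b ∈ Finset.range (2 * m + 1),
        jet f 0 b [] / b.factorial * t ^ b + η * x t ^ 2 * t ^ 2
        + 1 / 2 * (z t ⬝ᵥ (jetZZ f 0 0 *ᵥ z t)) +
      taylorSum (wset 3 3 (2 * m + 1)) (higherJet (m + 3) f) (x t) t (z t)))
      =O[𝓝 0] fun t : ℝ => t ^ (2 * m + 1) := by
  let A : Finset (ℕ × ℕ × ℕ) := (Finset.range (2 * m + 1)).image fun b => (0, b, 0)
  have hmemA : ∀ s : ℕ × ℕ × ℕ, s ∈ A ↔ s.1 = 0 ∧ s.2.1 < 2 * m + 1 ∧ s.2.2 = 0 := by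
    rintro ⟨a, b, c⟩
    simp only [A, Finset.mem_image, Finset.mem_range, Prod.mk.injEq]
    constructor
    · rintro ⟨b', h, rfl, rfl, rfl⟩; exact ⟨rfl, h, rfl⟩
    · rintro ⟨rfl, h, rfl⟩; exact ⟨b, h, rfl, rfl, rfl⟩
  let D : Finset (ℕ × ℕ × ℕ) := if m = 3 then ∅ else {(2, 2, 0)}
  have hmemD : ∀ s : ℕ × ℕ × ℕ, s ∈ D ↔ m ≠ 3 ∧ s = (2, 2, 0) := fun s => by
    by_cases h : m = 3 <;> simp [D, h]
  have hsum : ∀ (x t : ℝ) (z : Fin n → ℝ), taylorSum (wset 3 3 (2 * m + 1)) (jet f) x t z -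
      taylorSum (wset 3 3 (2 * m + 1)) (higherJet (m + 3) f) x t z =
      ∑ b ∈ Finset.range (2 * m + 1), jet f 0 b [] / b.factorial * t ^ b
        + 1 / 2 * (z ⬝ᵥ (jetZZ f 0 0 *ᵥ z)) + if m = 3 then 0 else η * x ^ 2 * t ^ 2 := by
    intro x t z
    rw [taylorSum_sub, taylorSum_subset (S' := A ∪ {(0, 0, 2)} ∪ D), taylorSum, Finset.sum_union,
      Finset.sum_union]
    · congr 1
      · congr 1
        · rw [Finset.sum_image (fun a _ b _ h => by simpa using h)]
          refine Finset.sum_congr rfl fun b _ => ?_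
          simp [contr, higherJet_pure]
          ring
        · simp [contr, higherJet_zz, Nat.factorial, Matrix.mulVec, dotProduct, jetZZ,
            Finset.mul_sum]
          exact Finset.sum_congr rfl fun i _ => Finset.sum_congr rfl fun j _ => by ring
      · by_cases h : m = 3
        · simp [D, h]
        · simp [D, h, contr, Nat.factorial, hf.d22, higherJet_two_two]
          ring
    · rw [Finset.disjoint_left]
      intro s hs hs'
      rw [Finset.mem_singleton] at hs'
      rw [hmemA] at hs
      simp [hs'] at hs
    · rw [Finset.disjoint_left]
      intro s hs hs'
      rw [hmemD] at hs'
      rw [Finset.mem_union, hmemA, Finset.mem_singleton] at hs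
      simp [hs'.2] at hs
    · intro s hs
      rw [mem_wset (by norm_num) (by norm_num)]
      simp only [Finset.mem_union, hmemA, hmemD, Finset.mem_singleton] at hs
      rcases hs with (⟨h1, h2, h3⟩ | rfl) | ⟨h1, rfl⟩
      · omega
      · simp only; omega
      · simp only; omega
    · rintro ⟨a, b, c⟩ hs hs' l hl
      rw [mem_wset (by norm_num) (by norm_num)] at hs
      simp only [Finset.mem_union, hmemA, hmemD, Finset.mem_singleton, Prod.mk.injEq, not_or]
        at hs' hs hl ⊢
      have h22 : ¬(a = 2 ∧ b = 2 ∧ l.length = 0) := by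
        rintro ⟨rfl, rfl, h⟩
        rw [hl] at h
        subst h
        exact hs'.2 ⟨by omega, rfl, rfl, rfl⟩
      by_cases hodd : (a + b + l.length) % 2 = 1
      · have h1 : jet f a b l = 0 := hf.jet_odd hodd
        rw [h1, higherJet]
        split_ifs <;> simp [h1]
      · exact hf.jet_sub_higherJet h22 (by omega) (by omega) (by omega)
  have h1 := isBigO_taylor (l := 𝓝 (0 : ℝ)) (r := fun t => t) tendsto_id
    hf.smooth (by norm_num) (by norm_num) hx (isBigO_refl _ _) hz (2 * m + 1)
  by_cases h3 : m = 3
  · have h2 : (fun t => η * (x t ^ 2 * t ^ 2)) =O[𝓝 0] fun t : ℝ => t ^ (2 * m + 1) :=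
      (IsBigO.pow_mono (((hx.pow 2).mul (isBigO_refl (fun t : ℝ => t ^ 2) _)).congr_right
        fun t => by rw [← pow_mul, ← pow_add]) (by omega)).const_mul_left η
    refine (h1.sub h2).congr_left fun t => ?_
    have := hsum (x t) t (z t)
    rw [if_pos h3] at this
    linear_combination -this
  · refine h1.congr_left fun t => ?_
    have := hsum (x t) t (z t)
    rw [if_neg h3] at this
    linear_combination -this

end Normalized

/-! ### The iteration approaches the critical curve -/

namespace Normalized

variable {n : ℕ} {ε η : ℝ} {f : Coord n → ℝ}

theorem isBigO_of_sub {E : Type*} [NormedAddCommGroup E] {u v : ℝ → E} {p q : ℕ}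
    (hv : v =O[𝓝 0] fun t : ℝ => t ^ q) (h : (fun t => u t - v t) =O[𝓝 0] fun t : ℝ => t ^ p)
    (hq : q ≤ p) : u =O[𝓝 0] fun t : ℝ => t ^ q :=
  ((IsBigO.pow_mono h hq).add hv).congr_left fun t => by abel

theorem divX_divX_mul {p : Polynomial ℝ} (h : (fun t => p.eval t) =O[𝓝 0] fun t : ℝ => t ^ 3)
    (t : ℝ) : p.divX.divX.eval t * t ^ 2 = p.eval t := by
  have h0 := coeff_lt_eq_zero h (i := 0) (by norm_num)
  have h1 := coeff_lt_eq_zero h (i := 1) (by norm_num)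
  have e1 := congrArg (Polynomial.eval t) (Polynomial.divX_mul_X_add p)
  have e2 := congrArg (Polynomial.eval t) (Polynomial.divX_mul_X_add p.divX)
  simp only [Polynomial.eval_add, Polynomial.eval_mul, Polynomial.eval_X, Polynomial.eval_C,
    Polynomial.coeff_divX, h0, h1, zero_add] at e1 e2
  linear_combination e1 + t * e2

/-- One step of the iteration raises the order of contact with the critical curve by two. -/
theorem isBigO_step (hη : IsSign η) (hf : Normalized ε η f) {σ : ℚ} (hσ : (σ : ℝ) = η)
    {X : ℝ → ℝ} {Z : ℝ → Fin n → ℝ} (hc : IsCritCurve f X Z) {m : ℕ} (hm : 3 ≤ m)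
    {u v : Polynomial ℝ × (Fin n → Polynomial ℝ)}
    (hv : v = FormalCurve.step σ (2 * m - 1) (higherJet (m + 3) f) (hessInv f) u) {p N : ℕ}
    (hp : 3 ≤ p) (hpm : p + 2 ≤ 2 * m - 1)
    (hx : (fun t => u.1.eval t - X t) =O[𝓝 0] fun t : ℝ => t ^ p)
    (hz : (fun t => (fun i => (u.2 i).eval t) - Z t) =O[𝓝 0] fun t : ℝ => t ^ p)
    (hN : N ≤ p + 2) (hNm : N ≤ 2 * m - 3) (hN3 : 3 ≤ N) :
    ((fun t => v.1.eval t - X t) =O[𝓝 0] fun t : ℝ => t ^ N) ∧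
    ((fun t => (fun i => (v.2 i).eval t) - Z t) =O[𝓝 0] fun t : ℝ => t ^ (p + 2)) := by
  have hηη : η * η = 1 := by rcases hη with rfl | rfl <;> norm_num
  have hx3 := isBigO_of_sub hc.order_x hx hp
  have hz3 : (fun t i => (u.2 i).eval t) =O[𝓝 0] fun t : ℝ => t ^ 3 :=
    isBigO_of_sub hc.order_z hz hp
  have hzN : (fun t => (fun i => (v.2 i).eval t) - Z t) =O[𝓝 0] fun t : ℝ => t ^ (p + 2) := by
    have key : ∀ i, (fun t => (FormalCurve.dz (2 * m - 1) (higherJet (m + 3) f) u.1 u.2 i).eval t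
        + (jetZZ f 0 0 *ᵥ Z t) i) =O[𝓝 0] fun t : ℝ => t ^ (p + 2) := fun i => by
      have h1 := IsBigO.pow_mono (hf.isBigO_pderiv_z_higher hm hx3 hz3 i) hpm
      have h2 := hf.isBigO_pderiv_z_sub hx3 hc.order_x hz3 hc.order_z hx hz le_rfl le_rfl i
      refine (h2.sub h1).congr' ?_ EventuallyEq.rfl
      filter_upwards [hc.crit_z] with t ht
      rw [ht i, FormalCurve.eval_dz, Matrix.mulVec_sub, Pi.sub_apply]
      ring
    refine isBigO_pi.2 fun i => ?_
    have h3 := IsBigO.fun_sum (s := Finset.univ) fun j _ =>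
      (key j).const_mul_left (hessInv f i j)
    refine h3.neg_left.congr_left fun t => ?_
    have h4 : Z t i = (hessInv f *ᵥ (jetZZ f 0 0 *ᵥ Z t)) i := by
      rw [Matrix.mulVec_mulVec, hf.hessInv_mul, Matrix.one_mulVec]
    rw [Pi.sub_apply, h4, hv]
    simp only [FormalCurve.step, Polynomial.eval_neg, Polynomial.eval_finsetSum,
      Polynomial.eval_mul, Polynomial.eval_C, mul_add, Finset.sum_add_distrib]
    rw [Matrix.mulVec, dotProduct]
    ring
  refine ⟨?_, hzN⟩
  have hvz3 : (fun t i => (v.2 i).eval t) =O[𝓝 0] fun t : ℝ => t ^ 3 :=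
    isBigO_of_sub hc.order_z hzN (by omega)
  obtain ⟨d, hd⟩ : ∃ d, d = FormalCurve.dx (2 * m - 1) (higherJet (m + 3) f) u.1 v.2 := ⟨_, rfl⟩
  have h1 : (fun t => d.eval t + 2 * η * t ^ 2 * X t) =O[𝓝 0] fun t : ℝ => t ^ (N + 2) := by
    have h1 := IsBigO.pow_mono (hf.isBigO_pderiv_x_higher hm hx3 hvz3)
      (by omega : N + 2 ≤ 2 * m - 1)
    have h2 := hf.isBigO_pderiv_x_sub hx3 hc.order_x hvz3 hc.order_z hx hzN
      (by omega : N + 2 ≤ p + 4) (by omega : N + 2 ≤ p + 2 + 2)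
    refine (h2.sub h1).congr' ?_ EventuallyEq.rfl
    filter_upwards [hc.crit_x] with t ht
    rw [ht, hd, FormalCurve.eval_dx]
    ring
  have hd3 : (fun t => d.eval t) =O[𝓝 0] fun t : ℝ => t ^ 5 := by
    have h2 : (fun t => 2 * η * (X t * t ^ 2)) =O[𝓝 0] fun t : ℝ => t ^ 5 :=
      ((hc.order_x.mul (isBigO_refl (fun t : ℝ => t ^ 2) _)).congr_right
        fun t => by ring).const_mul_left _
    exact ((IsBigO.pow_mono h1 (by omega)).sub h2).congr_left fun t => by ring
  have hv1 : v.1 = -(Polynomial.C (algebraMap ℚ ℝ (σ / 2)) * d.divX.divX) := by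
    rw [hd, hv]; rfl
  have hX0 : X 0 = 0 := map_zero_of_odd hc.odd_x
  refine isBigO_of_mul_sq ?_ ?_
  · have h2 : d.divX.divX.coeff 0 = 0 := by
      rw [Polynomial.coeff_divX, Polynomial.coeff_divX]
      exact coeff_lt_eq_zero hd3 (by norm_num)
    rw [hv1, hX0, Polynomial.eval_neg, Polynomial.eval_mul, ← Polynomial.coeff_zero_eq_eval_zero,
      ← Polynomial.coeff_zero_eq_eval_zero, h2]
    simp
  · refine (h1.const_mul_left (-(η / 2))).congr_left fun t => ?_
    have h2 := divX_divX_mul (IsBigO.pow_mono hd3 (by norm_num)) t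
    rw [hv1]
    simp only [Polynomial.eval_neg, Polynomial.eval_mul, Polynomial.eval_C, eq_ratCast,
      Rat.cast_div, hσ, Rat.cast_ofNat]
    linear_combination -(t ^ 2 * X t) * hηη + η / 2 * h2

/-- The number of iterations needed for a given order of contact does not depend on `f`, so that
the coefficients of the approximation are universal polynomials in the jet of `f`. -/
theorem isBigO_curve (hη : IsSign η) (hf : Normalized ε η f) {σ : ℚ} (hσ : (σ : ℝ) = η)
    {X : ℝ → ℝ} {Z : ℝ → Fin n → ℝ} (hc : IsCritCurve f X Z) {m : ℕ} (hm : 3 ≤ m) {k : ℕ}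
    (hk : k + 3 ≤ m) :
    ((fun t => (FormalCurve.curve σ (2 * m - 1) (higherJet (m + 3) f) (hessInv f) k).1.eval t - X t)
      =O[𝓝 0] fun t : ℝ => t ^ (2 * k + 3)) ∧
    ((fun t => (fun i => ((FormalCurve.curve σ (2 * m - 1) (higherJet (m + 3) f)
      (hessInv f) k).2 i).eval t) - Z t) =O[𝓝 0] fun t : ℝ => t ^ (2 * k + 3)) := by
  induction k with
  | zero =>
    refine ⟨hc.order_x.neg_left.congr_left fun t => ?_,
      hc.order_z.neg_left.congr_left fun t => ?_⟩
    · simp [FormalCurve.curve]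
    · ext i; simp [FormalCurve.curve]
  | succ k ih =>
    obtain ⟨hx, hz⟩ := ih (by omega)
    exact hf.isBigO_step hη hσ hc hm rfl (by omega) (by omega) hx hz (by omega) (by omega)
      (by omega)

/-- The Taylor coefficient of order `2m` of `f` along a critical curve is
`f_{y^(2m)} + correction`, up to the factorial. -/
theorem exists_taylor_critCurve (hη : IsSign η) (hf : Normalized ε η f) {σ : ℚ}
    (hσ : (σ : ℝ) = η) {X : ℝ → ℝ} {Z : ℝ → Fin n → ℝ} (hc : IsCritCurve f X Z) {m : ℕ}
    (hm : 3 ≤ m) :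
    ∃ p : Polynomial ℝ, ((fun t => f (pt (X t) t (Z t)) - p.eval t) =O[𝓝 0]
      fun t : ℝ => t ^ (2 * m + 1)) ∧
      p.coeff (2 * m) = (jet f 0 (2 * m) [] + evalJet f (correction n σ m)) /
        (Nat.factorial (2 * m) : ℝ) := by
  obtain ⟨j, rfl⟩ : ∃ j, m = j + 3 := ⟨m - 3, by omega⟩
  obtain ⟨hx0, hz0⟩ := hf.isBigO_curve hη hσ hc hm le_rfl
  obtain ⟨v, hv⟩ : ∃ v, v = FormalCurve.curve σ (2 * (j + 3) - 1) (higherJet (j + 3 + 3) f)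
    (hessInv f) (j + 1) := ⟨_, rfl⟩
  obtain ⟨hx, hz⟩ := hf.isBigO_step hη hσ hc hm (v := v) (N := 2 * j + 3) hv (by omega) (by omega)
    hx0 hz0 (by omega) (by omega) (by omega)
  have hx3 := isBigO_of_sub hc.order_x hx (by omega)
  have hz3 : (fun t i => (v.2 i).eval t) =O[𝓝 0] fun t : ℝ => t ^ 3 :=
    isBigO_of_sub hc.order_z hz (by omega)
  let m := j + 3
  have hdiff := hf.isBigO_sub_of_crit hc hx3 hz3 hx hz (N := 2 * m + 1) (by omega) (by omega)
    (by omega)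
  have hexp := hf.isBigO_higher hm hx3 hz3
  -- `2 η t² x = -∂T/∂x` and `H z = -∂T/∂z` up to terms of order `2m - 1`
  have hdx : (fun t => v.1.eval t * (2 * η * t ^ 2 * v.1.eval t +
      (FormalCurve.dx (2 * m - 1) (higherJet (m + 3) f) v.1 v.2).eval t)) =O[𝓝 0]
      fun t : ℝ => t ^ (2 * m + 1) := by
    have h1 := hf.isBigO_pderiv_x_higher hm hx3 hz3
    have h2 := hf.isBigO_pderiv_x_sub hx3 hc.order_x hz3 hc.order_z hx hz
      (N := 2 * m - 1) (by omega) (by omega)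
    have h3 : (fun t => 2 * η * (t ^ 2 * (v.1.eval t - X t))) =O[𝓝 0]
        fun t : ℝ => t ^ (2 * m - 1) :=
      (IsBigO.pow_mono (((isBigO_refl (fun t : ℝ => t ^ 2) _).mul hx).congr_right
        fun t => by rw [← pow_add]) (by omega)).const_mul_left (2 * η)
    have h4 : (fun t => 2 * η * t ^ 2 * v.1.eval t +
      (FormalCurve.dx (2 * m - 1) (higherJet (m + 3) f) v.1 v.2).eval t) =O[𝓝 0]
        fun t : ℝ => t ^ (2 * m - 1) := by
      refine ((h2.sub h1).add h3).congr' ?_ EventuallyEq.rfl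
      filter_upwards [hc.crit_x] with t ht
      rw [ht, FormalCurve.eval_dx]
      simp only [m]
      ring
    exact IsBigO.pow_mono ((hx3.mul h4).congr_right fun t => by rw [← pow_add]) (by omega)
  have hdz : (fun t => ∑ i, (v.2 i).eval t * ((jetZZ f 0 0 *ᵥ fun i => (v.2 i).eval t) i +
      (FormalCurve.dz (2 * m - 1) (higherJet (m + 3) f) v.1 v.2 i).eval t)) =O[𝓝 0]
      fun t : ℝ => t ^ (2 * m + 1) := by
    refine IsBigO.fun_sum fun i _ => ?_
    have h1 := hf.isBigO_pderiv_z_higher hm hx3 hz3 i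
    have h2 := hf.isBigO_pderiv_z_sub hx3 hc.order_x hz3 hc.order_z hx hz
      (N := 2 * m - 1) (by omega) (by omega) i
    have h3 := isBigO_pi_apply (isBigO_of_mulVec (jetZZ f 0 0)
      (IsBigO.pow_mono hz (by omega : 2 * m - 1 ≤ _))) i
    have h4 : (fun t => (jetZZ f 0 0 *ᵥ fun i => (v.2 i).eval t) i +
      (FormalCurve.dz (2 * m - 1) (higherJet (m + 3) f) v.1 v.2 i).eval t) =O[𝓝 0]
        fun t : ℝ => t ^ (2 * m - 1) := by
      refine ((h2.sub h1).add h3).congr' ?_ EventuallyEq.rfl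
      filter_upwards [hc.crit_z] with t ht
      rw [ht i, FormalCurve.eval_dz]
      simp only [m]
      ring
    exact IsBigO.pow_mono (((isBigO_pi_apply hz3 i).mul h4).congr_right
      fun t => by rw [← pow_add]) (by omega)
  refine ⟨∑ b ∈ Finset.range (2 * m + 1),
      Polynomial.C (jet f 0 b [] / b.factorial) * Polynomial.X ^ b +
      FormalCurve.value (wset 3 3 (2 * m + 1)) (2 * m - 1) (higherJet (m + 3) f) v, ?_, ?_⟩
  · refine (((hexp.sub hdiff).add (hdx.const_mul_left (1 / 2))).add
      (hdz.const_mul_left (1 / 2))).congr_left fun t => ?_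
    have hT := map_taylorSum (Polynomial.evalRingHom t) (wset 3 3 (2 * m + 1))
      (fun a b l => Polynomial.C (higherJet (m + 3) f a b l)) v.1 Polynomial.X v.2
    simp only [Polynomial.coe_evalRingHom, Polynomial.eval_C, Polynomial.eval_X] at hT
    simp only [FormalCurve.value, Polynomial.eval_add, Polynomial.eval_sub, hT,
      Polynomial.eval_mul, Polynomial.eval_finsetSum, Polynomial.eval_C, Polynomial.eval_pow,
      Polynomial.eval_X, dotProduct, mul_add, Finset.sum_add_distrib, eq_ratCast]
    push_cast
    generalize (∑ b ∈ Finset.range (2 * m + 1), jet f 0 b [] / (b.factorial : ℝ) * t ^ b) = A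
    simp only [m]
    ring_nf
  · rw [Polynomial.coeff_add, evalJet_correction, Polynomial.finsetSum_coeff,
      Finset.sum_eq_single (2 * m)]
    · have hfac : (Nat.factorial (2 * m) : ℝ) ≠ 0 := by positivity
      rw [Polynomial.coeff_C_mul_X_pow, if_pos rfl, hv]
      change _ = (_ + (Nat.factorial (2 * m) : ℝ) * _) / (Nat.factorial (2 * m) : ℝ)
      rw [add_div, mul_div_cancel_left₀ _ hfac]
      rfl
    · intro b _ hb
      rw [Polynomial.coeff_C_mul_X_pow, if_neg (Ne.symm hb)]
    · intro h
      exact absurd (Finset.mem_range.2 (by omega)) h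

end Normalized

/-! ### The tabulated coefficients -/

theorem contr_one {n : ℕ} (G : List (Fin n) → ℝ) (z : Fin n → ℝ) :
    contr 1 G z = (fun i => G [i]) ⬝ᵥ z := by
  simp [contr, dotProduct, mul_comm]

theorem contr_two {n : ℕ} (G : List (Fin n) → ℝ) (z : Fin n → ℝ) :
    contr 2 G z = z ⬝ᵥ (Matrix.of (fun i j => G [i, j]) *ᵥ z) := by
  simp [contr, dotProduct, Matrix.mulVec, mul_comm]

/-- If `z = t^p z₀ + O(t^q)`, then a contraction with the powers of `z` is given by the one with the
powers of `z₀` in its leading order. -/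
theorem isBigO_contr_sub {n : ℕ} {z : ℝ → Fin n → ℝ} {z₀ : Fin n → ℝ} {p q : ℕ}
    (hpq : p ≤ q) (hz : (fun t => z t - t ^ p • z₀) =O[𝓝 0] fun t : ℝ => t ^ q) (c : ℕ) :
    ∀ G : List (Fin n) → ℝ, (fun t => contr (c + 1) G (z t) - t ^ (p * (c + 1)) *
      contr (c + 1) G z₀) =O[𝓝 0] fun t : ℝ => t ^ (p * c + q) := by
  have hzp : z =O[𝓝 0] fun t : ℝ => t ^ p := by
    have h : (fun t : ℝ => t ^ p • z₀) =O[𝓝 0] fun t : ℝ => t ^ p := by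
      simpa using (isBigO_refl (fun t : ℝ => t ^ p) (𝓝 0)).smul
        (isBigO_const_const z₀ (one_ne_zero (α := ℝ)) (𝓝 (0 : ℝ)))
    exact Normalized.isBigO_of_sub h hz hpq
  induction c with
  | zero =>
    intro G
    refine (IsBigO.fun_sum (s := Finset.univ) fun i _ =>
      (isBigO_pi_apply hz i).const_mul_left (G [i])).congr (fun t => ?_) fun t => by ring_nf
    simp only [contr, Pi.sub_apply, Pi.smul_apply, smul_eq_mul, Finset.mul_sum,
      ← Finset.sum_sub_distrib]
    exact Finset.sum_congr rfl fun i _ => by ring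
  | succ c ih =>
    intro G
    have h1 : ∀ i, (fun t => (z t i - t ^ p * z₀ i) * contr (c + 1) (fun l => G (i :: l)) (z t) +
        z₀ i * (t ^ p * (contr (c + 1) (fun l => G (i :: l)) (z t) - t ^ (p * (c + 1)) *
          contr (c + 1) (fun l => G (i :: l)) z₀))) =O[𝓝 0]
        fun t : ℝ => t ^ (p * (c + 1) + q) := fun i => by
      refine IsBigO.add ?_ (IsBigO.const_mul_left ?_ _)
      · refine ((isBigO_pi_apply hz i).mul (isBigO_contr hzp (c + 1) _)).congr_right fun t => ?_
        rw [← pow_add, add_comm]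
      · refine ((isBigO_refl (fun t : ℝ => t ^ p) _).mul (ih _)).congr_right fun t => ?_
        rw [← pow_add]; ring_nf
    refine (IsBigO.fun_sum (s := Finset.univ) fun i _ => h1 i).congr_left fun t => ?_
    rw [contr, contr, Finset.mul_sum, ← Finset.sum_sub_distrib]
    exact Finset.sum_congr rfl fun i _ => by ring

theorem dotProduct_mulVec_symm {n : ℕ} {M : Matrix (Fin n) (Fin n) ℝ} (hM : Mᵀ = M)
    (u v : Fin n → ℝ) : u ⬝ᵥ (M *ᵥ v) = v ⬝ᵥ (M *ᵥ u) := by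
  rw [Matrix.dotProduct_mulVec, ← Matrix.mulVec_transpose, hM, dotProduct_comm]

theorem hessInv_transpose {n : ℕ} (f : Coord n → ℝ) : (hessInv f)ᵀ = hessInv f := by
  change ((jetZZ f 0 0)⁻¹)ᵀ = (jetZZ f 0 0)⁻¹
  rw [Matrix.transpose_nonsing_inv, jetZZ_transpose]

namespace Normalized

variable {n : ℕ} {ε η : ℝ} {f : Coord n → ℝ} {x : ℝ → ℝ} {z : ℝ → Fin n → ℝ}

/-- The terms of weight less than seven in `∂f/∂x`, for the weights `3, 1, 3` of `x, y, z`. -/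
theorem isBigO_pderiv_x_seven (hf : Normalized ε η f) (hx : x =O[𝓝 0] fun t : ℝ => t ^ 3)
    (hz : z =O[𝓝 0] fun t : ℝ => t ^ 3) :
    (fun t => pderivCoord 0 f (pt (x t) t (z t)) - (2 * η * t ^ 2 * x t +
      jet f 1 5 [] / 120 * t ^ 5 + t ^ 2 / 2 * (jetZ f 1 2 ⬝ᵥ z t))) =O[𝓝 0]
      fun t : ℝ => t ^ 7 := by
  refine (isBigO_taylor (l := 𝓝 (0 : ℝ)) (r := fun t => t) tendsto_id
    (contDiff_pderivCoord hf.smooth 0) (by norm_num) (by norm_num) hx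
    (isBigO_refl _ _) hz 7).congr_left fun t => ?_
  rw [taylorSum_subset (S' := {(1, 2, 0), (0, 5, 0), (0, 2, 1)})]
  · simp [taylorSum, contr, Nat.factorial, jet_pderiv_x hf.smooth, hf.d22, dotProduct, jetZ,
      mul_comm (z t _)]
    ring
  · intro s hs
    rw [mem_wset (by norm_num) (by norm_num)]
    simp only [Finset.mem_insert, Finset.mem_singleton] at hs
    rcases hs with rfl | rfl | rfl <;> norm_num
  · rintro ⟨a, b, c⟩ hs hs' l hl
    rw [mem_wset (by norm_num) (by norm_num)] at hs
    simp only [Finset.mem_insert, Finset.mem_singleton, Prod.mk.injEq] at hs' hs hl ⊢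
    rw [jet_pderiv_x hf.smooth]
    rcases Nat.mod_two_eq_zero_or_one (a + 1 + b + l.length) with h | h
    · by_cases h2 : a + 1 + b + l.length = 2
      · exact hf.jet_two h2 (by omega)
      · obtain ⟨rfl, rfl, rfl⟩ : a = 0 ∧ b = 3 ∧ c = 0 := by omega
        rw [List.length_eq_zero_iff.1 hl, hf.d13]
    · exact hf.jet_odd h

/-- The terms of weight less than seven in `∂f/∂z`, for the weights `3, 1, 3` of `x, y, z`. -/
theorem isBigO_pderiv_z_seven (hf : Normalized ε η f) (hx : x =O[𝓝 0] fun t : ℝ => t ^ 3)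
    (hz : z =O[𝓝 0] fun t : ℝ => t ^ 3) (i : Fin n) :
    (fun t => pderivCoord i.succ.succ f (pt (x t) t (z t)) - ((jetZZ f 0 0 *ᵥ z t) i +
      t ^ 3 / 6 * jetZ f 0 3 i + t ^ 5 / 120 * jetZ f 0 5 i + t ^ 2 / 2 * x t * jetZ f 1 2 i +
      t ^ 2 / 2 * (jetZZ f 0 2 *ᵥ z t) i)) =O[𝓝 0] fun t : ℝ => t ^ 7 := by
  refine (isBigO_taylor (l := 𝓝 (0 : ℝ)) (r := fun t => t) tendsto_id
    (contDiff_pderivCoord hf.smooth i.succ.succ) (by norm_num) (by norm_num) hx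
    (isBigO_refl _ _) hz 7).congr_left fun t => ?_
  rw [taylorSum_subset (S' := {(0, 0, 1), (0, 3, 0), (0, 5, 0), (1, 2, 0), (0, 2, 1)})]
  · simp [taylorSum, contr, Nat.factorial, jet_pderiv_z hf.smooth, Matrix.mulVec, dotProduct,
      jetZ, jetZZ, mul_comm (z t _)]
    ring
  · intro s hs
    rw [mem_wset (by norm_num) (by norm_num)]
    simp only [Finset.mem_insert, Finset.mem_singleton] at hs
    rcases hs with rfl | rfl | rfl | rfl | rfl <;> norm_num
  · rintro ⟨a, b, c⟩ hs hs' l hl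
    rw [mem_wset (by norm_num) (by norm_num)] at hs
    simp only [Finset.mem_insert, Finset.mem_singleton, Prod.mk.injEq] at hs' hs hl ⊢
    rw [jet_pderiv_z hf.smooth]
    rcases Nat.mod_two_eq_zero_or_one (a + b + (i :: l).length) with h | h
    · simp only [List.length_cons] at h
      exact hf.jet_two (by simp only [List.length_cons]; omega)
        (by simp only [List.length_cons]; omega)
    · exact hf.jet_odd h

set_option maxRecDepth 4000 in
theorem even_exponents_of_weight_lt_eleven : ∀ s ∈ Finset.range 4 ×ˢ Finset.range 11 ×ˢ
    Finset.range 4, ¬ 3 * s.1 + s.2.1 + 3 * s.2.2 < 11 ∨ (s.1 + s.2.1 + s.2.2) % 2 = 1 ∨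
    s ∈ ({(0, 0, 0), (0, 4, 0), (0, 6, 0), (0, 8, 0), (0, 10, 0), (1, 5, 0),
    (1, 7, 0), (2, 2, 0), (2, 4, 0), (0, 3, 1), (0, 5, 1), (0, 7, 1), (1, 2, 1), (1, 4, 1),
    (2, 1, 1), (0, 0, 2), (0, 2, 2), (0, 4, 2), (1, 1, 2), (0, 1, 3)} :
      Finset (ℕ × ℕ × ℕ)) ∨
    (s.1 + s.2.1 + s.2.2 = 2 ∧ s.2.2 ≤ 1) ∨ s = (1, 3, 0) ∨ s = (3, 1, 0) := by
  decide

/-- The terms of weight less than eleven in `f`, for the weights `3, 1, 3` of `x, y, z`. -/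
theorem isBigO_taylor_eleven (hf : Normalized ε η f) (hx : x =O[𝓝 0] fun t : ℝ => t ^ 3)
    (hz : z =O[𝓝 0] fun t : ℝ => t ^ 3) :
    (fun t => f (pt (x t) t (z t)) - (f 0 + jet f 0 4 [] / 24 * t ^ 4 +
      jet f 0 6 [] / 720 * t ^ 6 + jet f 0 8 [] / 40320 * t ^ 8 + jet f 0 10 [] / 3628800 * t ^ 10
      + jet f 1 5 [] / 120 * x t * t ^ 5 + jet f 1 7 [] / 5040 * x t * t ^ 7
      + η * x t ^ 2 * t ^ 2 + jet f 2 4 [] / 48 * x t ^ 2 * t ^ 4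
      + t ^ 3 / 6 * (jetZ f 0 3 ⬝ᵥ z t) + t ^ 5 / 120 * (jetZ f 0 5 ⬝ᵥ z t)
      + t ^ 7 / 5040 * contr 1 (jet f 0 7) (z t)
      + x t * t ^ 2 / 2 * (jetZ f 1 2 ⬝ᵥ z t) + x t * t ^ 4 / 24 * contr 1 (jet f 1 4) (z t)
      + x t ^ 2 * t / 2 * contr 1 (jet f 2 1) (z t)
      + 1 / 2 * (z t ⬝ᵥ (jetZZ f 0 0 *ᵥ z t)) + t ^ 2 / 4 * (z t ⬝ᵥ (jetZZ f 0 2 *ᵥ z t))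
      + t ^ 4 / 48 * contr 2 (jet f 0 4) (z t) + x t * t / 2 * contr 2 (jet f 1 1) (z t)
      + t / 6 * contr 3 (jet f 0 1) (z t))) =O[𝓝 0] fun t : ℝ => t ^ 11 := by
  refine (isBigO_taylor (l := 𝓝 (0 : ℝ)) (r := fun t => t) tendsto_id
    hf.smooth (by norm_num) (by norm_num) hx (isBigO_refl _ _) hz 11).congr_left fun t => ?_
  rw [taylorSum_subset (S' := {(0, 0, 0), (0, 4, 0), (0, 6, 0), (0, 8, 0), (0, 10, 0), (1, 5, 0),
    (1, 7, 0), (2, 2, 0), (2, 4, 0), (0, 3, 1), (0, 5, 1), (0, 7, 1), (1, 2, 1), (1, 4, 1),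
    (2, 1, 1), (0, 0, 2), (0, 2, 2), (0, 4, 2), (1, 1, 2), (0, 1, 3)})]
  · have h1 : ∀ a b, jetZ f a b ⬝ᵥ z t = contr 1 (jet f a b) (z t) := fun a b =>
      (contr_one _ _).symm
    have h2 : ∀ a b, z t ⬝ᵥ (jetZZ f a b *ᵥ z t) = contr 2 (jet f a b) (z t) := fun a b =>
      (contr_two _ _).symm
    have h0 : ∀ a b, contr 0 (jet f a b) (z t) = jet f a b [] := fun a b => rfl
    simp only [h1, h2]
    simp [taylorSum, h0, jet_zero, Nat.factorial, hf.d22]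
    ring
  · intro s hs
    rw [mem_wset (by norm_num) (by norm_num)]
    simp only [Finset.mem_insert, Finset.mem_singleton] at hs
    rcases hs with rfl | rfl | rfl | rfl | rfl | rfl | rfl | rfl | rfl | rfl | rfl | rfl | rfl |
      rfl | rfl | rfl | rfl | rfl | rfl | rfl <;> norm_num
  · rintro ⟨a, b, c⟩ hs hs' l hl
    rw [mem_wset (by norm_num) (by norm_num)] at hs
    simp only at hs hl ⊢
    rcases Nat.mod_two_eq_zero_or_one (a + b + l.length) with h | h
    · rw [hl] at h
      rcases even_exponents_of_weight_lt_eleven (a, b, c) (by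
        simp only [Finset.mem_product, Finset.mem_range]; omega) with h1 | h1 | h1 | h2 | h2 | h2
      · exact absurd hs h1
      · simp only at h1; omega
      · exact absurd h1 hs'
      · simp only at h2
        exact hf.jet_two (by omega) (by omega)
      · simp only [Prod.mk.injEq] at h2
        obtain ⟨rfl, rfl, rfl⟩ := h2
        rw [List.length_eq_zero_iff.1 hl, hf.d13]
      · simp only [Prod.mk.injEq] at h2
        obtain ⟨rfl, rfl, rfl⟩ := h2
        rw [List.length_eq_zero_iff.1 hl, hf.d31]
    · exact hf.jet_odd h

end Normalized

/-! ### The table of coefficients -/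

namespace Normalized

variable {n : ℕ} {ε η : ℝ} {f : Coord n → ℝ}

theorem isBigO_monomial {E : Type*} [NormedAddCommGroup E] [NormedSpace ℝ E] (p : ℕ) (v : E) :
    (fun t : ℝ => t ^ p • v) =O[𝓝 0] fun t : ℝ => t ^ p := by
  simpa using (isBigO_refl (fun t : ℝ => t ^ p) (𝓝 0)).smul
    (isBigO_const_const v (one_ne_zero (α := ℝ)) (𝓝 (0 : ℝ)))

/-- An approximate solution of `∂f/∂x = 0`, `∂f/∂z = 0` is close to the critical curve. -/
theorem isBigO_sub_critCurve (hη : IsSign η) (hf : Normalized ε η f) {X : ℝ → ℝ}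
    {Z : ℝ → Fin n → ℝ} (hc : IsCritCurve f X Z) {x : ℝ → ℝ} {z : ℝ → Fin n → ℝ}
    (hx : x =O[𝓝 0] fun t : ℝ => t ^ 3) (hz : z =O[𝓝 0] fun t : ℝ => t ^ 3) (hx0 : x 0 = 0)
    (hfx : (fun t => pderivCoord 0 f (pt (x t) t (z t))) =O[𝓝 0] fun t : ℝ => t ^ 7)
    (hfz : ∀ i : Fin n, (fun t => pderivCoord i.succ.succ f (pt (x t) t (z t))) =O[𝓝 0]
      fun t : ℝ => t ^ 7) :
    (fun t => f (pt (x t) t (z t)) - f (pt (X t) t (Z t))) =O[𝓝 0] fun t : ℝ => t ^ 12 := by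
  have hηη : η * η = 1 := by rcases hη with rfl | rfl <;> norm_num
  have solve : ∀ {N : ℕ}, N ≤ 7 → (∀ i, (fun t => (jetZZ f 0 0 *ᵥ (z t - Z t)) i) =O[𝓝 0]
      fun t : ℝ => t ^ N) → (fun t => z t - Z t) =O[𝓝 0] fun t : ℝ => t ^ N := by
    intro N hN h
    refine (isBigO_of_mulVec (hessInv f) (isBigO_pi.2 h)).congr_left fun t => ?_
    rw [Matrix.mulVec_mulVec, hf.hessInv_mul, Matrix.one_mulVec]
  have step : ∀ {p q N : ℕ}, (fun t => x t - X t) =O[𝓝 0] (fun t : ℝ => t ^ p) →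
      (fun t => z t - Z t) =O[𝓝 0] (fun t : ℝ => t ^ q) → N ≤ p + 2 → N ≤ q + 2 → N ≤ 7 →
      (fun t => z t - Z t) =O[𝓝 0] fun t : ℝ => t ^ N := by
    intro p q N hp hq h1 h2 h3
    refine solve h3 fun i => ?_
    have h4 := hf.isBigO_pderiv_z_sub hx hc.order_x hz hc.order_z hp hq h1 h2 i
    refine ((IsBigO.pow_mono (hfz i) h3).sub h4).congr' ?_ EventuallyEq.rfl
    filter_upwards [hc.crit_z] with t ht
    rw [ht i]
    ring
  have hz5 := step (hx.sub hc.order_x) (hz.sub hc.order_z) (N := 5) le_rfl le_rfl (by norm_num)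
  have hx5 : (fun t => x t - X t) =O[𝓝 0] fun t : ℝ => t ^ 5 := by
    refine isBigO_of_mul_sq (by simp [hx0, map_zero_of_odd hc.odd_x]) ?_
    have h4 := hf.isBigO_pderiv_x_sub hx hc.order_x hz hc.order_z (hx.sub hc.order_x) hz5
      (N := 7) (by norm_num) (by norm_num)
    refine ((hfx.sub h4).const_mul_left (η / 2)).congr' ?_ EventuallyEq.rfl
    filter_upwards [hc.crit_x] with t ht
    rw [ht]
    linear_combination (x t - X t) * t ^ 2 * hηη
  have hz7 := step hx5 hz5 (N := 7) le_rfl le_rfl le_rfl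
  exact hf.isBigO_sub_of_crit hc hx hz hx5 hz7 (by norm_num) (by norm_num) (by norm_num)

/-- The expansion of `f` along a critical curve up to the order ten. The critical curve is
approximated by `x = ξ t³`, `z = -(w / 6) t³ + z₁ t⁵`. -/
theorem isBigO_tabulated (hη : IsSign η) (hf : Normalized ε η f) {X : ℝ → ℝ}
    {Z : ℝ → Fin n → ℝ} (hc : IsCritCurve f X Z) :
    (fun t => f (pt (X t) t (Z t)) - (f 0 + jet f 0 4 [] / 24 * t ^ 4 + a06 f / 720 * t ^ 6 +
      (a08 f - 7 * η / 10 * a15 f ^ 2) / 40320 * t ^ 8 +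
      (a010 f - 3 * η * a15 f * a17 f + 21 / 16 * a15 f ^ 2 * a24 f) / 3628800 * t ^ 10))
      =O[𝓝 0] fun t : ℝ => t ^ 11 := by
  have hηη : η * η = 1 := by rcases hη with rfl | rfl <;> norm_num
  obtain ⟨w, hw⟩ : ∃ w, w = wVec f := ⟨_, rfl⟩
  obtain ⟨ξ, hξ⟩ : ∃ ξ, ξ = -(η / 240) * a15 f := ⟨_, rfl⟩
  obtain ⟨z₀, hz₀⟩ : ∃ z₀, z₀ = (-1 / 6 : ℝ) • w := ⟨_, rfl⟩
  obtain ⟨u, hu⟩ : ∃ u, u = (1 / 120 : ℝ) • jetZ f 0 5 + (ξ / 2) • jetZ f 1 2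
    + (-1 / 12 : ℝ) • (jetZZ f 0 2 *ᵥ w) := ⟨_, rfl⟩
  obtain ⟨z₁, hz₁⟩ : ∃ z₁, z₁ = -(hessInv f *ᵥ u) := ⟨_, rfl⟩
  have hHw : jetZZ f 0 0 *ᵥ w = jetZ f 0 3 := by
    rw [hw, wVec, Matrix.mulVec_mulVec, hf.mul_hessInv, Matrix.one_mulVec]
  have hHz : jetZZ f 0 0 *ᵥ z₁ = -u := by
    rw [hz₁, Matrix.mulVec_neg, Matrix.mulVec_mulVec, hf.mul_hessInv, Matrix.one_mulVec]
  have ha15 : a15 f = jet f 1 5 [] - 10 * (jetZ f 1 2 ⬝ᵥ w) := by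
    rw [a15, hw, dotProduct_comm]
  obtain ⟨x, hx⟩ : ∃ x : ℝ → ℝ, x = fun t => t ^ 3 * ξ := ⟨_, rfl⟩
  obtain ⟨z, hz⟩ : ∃ z : ℝ → Fin n → ℝ, z = fun t => t ^ 3 • z₀ + t ^ 5 • z₁ := ⟨_, rfl⟩
  have hx3 : x =O[𝓝 0] fun t : ℝ => t ^ 3 := hx ▸ isBigO_monomial 3 ξ
  have hz5 : (fun t => z t - t ^ 3 • z₀) =O[𝓝 0] fun t : ℝ => t ^ 5 :=
    (isBigO_monomial 5 z₁).congr_left fun t => by rw [hz]; simp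
  have hz3 : z =O[𝓝 0] fun t : ℝ => t ^ 3 :=
    isBigO_of_sub (isBigO_monomial 3 z₀) hz5 (by norm_num)
  have hmono : ∀ (p : ℕ) (c : ℝ), (fun t : ℝ => t ^ p * c) =O[𝓝 0] fun t : ℝ => t ^ p :=
    fun p c => isBigO_monomial p c
  have hfx : (fun t => pderivCoord 0 f (pt (x t) t (z t))) =O[𝓝 0] fun t : ℝ => t ^ 7 := by
    refine ((hf.isBigO_pderiv_x_seven hx3 hz3).add
      (hmono 7 (1 / 2 * (jetZ f 1 2 ⬝ᵥ z₁)))).congr_left fun t => ?_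
    simp only [hx, hz, hz₀, hξ, dotProduct_add, dotProduct_smul, smul_eq_mul]
    linear_combination t ^ 5 / 120 * a15 f * hηη + t ^ 5 / 120 * ha15
  have hfz : ∀ i : Fin n, (fun t => pderivCoord i.succ.succ f (pt (x t) t (z t))) =O[𝓝 0]
      fun t : ℝ => t ^ 7 := fun i => by
    refine ((hf.isBigO_pderiv_z_seven hx3 hz3 i).add
      (hmono 7 (1 / 2 * (jetZZ f 0 2 *ᵥ z₁) i))).congr_left fun t => ?_
    have h1 := congrFun hHw i
    have h2 := congrFun hHz i
    simp only [hu, Pi.neg_apply, Pi.add_apply, Pi.smul_apply, smul_eq_mul] at h2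
    simp only [hx, hz, hz₀, Matrix.mulVec_add, Matrix.mulVec_smul, Pi.add_apply, Pi.smul_apply,
      smul_eq_mul]
    linear_combination t ^ 3 / 6 * h1 - t ^ 5 * h2
  have hdiff := IsBigO.pow_mono (hf.isBigO_sub_critCurve hη hc hx3 hz3 (by simp [hx]) hfx hfz)
    (by norm_num : 11 ≤ 12)
  have hexp := hf.isBigO_taylor_eleven hx3 hz3
  -- the terms of high weight depend on the leading term of `z` only
  have hcontr : ∀ (k c : ℕ) (b : ℝ) (G : List (Fin n) → ℝ), 11 ≤ k + (3 * c + 5) →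
      (fun t : ℝ => b * (t ^ k * (contr (c + 1) G (z t) - t ^ (3 * (c + 1)) *
        contr (c + 1) G z₀))) =O[𝓝 0] fun t : ℝ => t ^ 11 := fun k c b G h =>
    (IsBigO.pow_mono (((isBigO_refl (fun t : ℝ => t ^ k) _).mul
      (isBigO_contr_sub (by norm_num) hz5 c G)).congr_right fun t => by rw [← pow_add])
      h).const_mul_left b
  have e1 := hcontr 7 0 (1 / 5040) (jet f 0 7) (by norm_num)
  have e2 := hcontr 7 0 (ξ / 24) (jet f 1 4) (by norm_num)
  have e3 := hcontr 7 0 (ξ ^ 2 / 2) (jet f 2 1) (by norm_num)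
  have e4 := hcontr 4 1 (1 / 48) (jet f 0 4) (by norm_num)
  have e5 := hcontr 4 1 (ξ / 2) (jet f 1 1) (by norm_num)
  have e6 := hcontr 1 2 (1 / 6) (jet f 0 1) (by norm_num)
  have e7 := IsBigO.pow_mono (hmono 12 (1 / 4 * (z₁ ⬝ᵥ (jetZZ f 0 2 *ᵥ z₁))))
    (by norm_num : 11 ≤ 12)
  refine ((((((((hexp.sub hdiff).add e1).add e2).add e3).add e4).add e5).add e6).add
    e7).congr_left fun t => ?_
  have hξα : a15 f = -240 * η * ξ := by rw [hξ]; linear_combination -a15 f * hηη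
  have hf15 : jet f 1 5 [] = -240 * η * ξ + 10 * (jetZ f 1 2 ⬝ᵥ w) := by linarith
  have t8 : a08 f - 7 * η / 10 * a15 f ^ 2 = a08 f - 40320 * η * ξ ^ 2 := by
    rw [hξα]; linear_combination -40320 * η * ξ ^ 2 * hηη
  have t10 : a010 f - 3 * η * a15 f * a17 f + 21 / 16 * a15 f ^ 2 * a24 f =
      a010 f + 720 * ξ * a17 f + 75600 * ξ ^ 2 * a24 f := by
    rw [hξα]; linear_combination (720 * ξ * a17 f + 75600 * ξ ^ 2 * a24 f) * hηη
  -- the linear terms along `z`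
  have hHs := fun v => dotProduct_mulVec_symm (jetZZ_transpose f 0 0) w v
  have hD := fun v => dotProduct_mulVec_symm (jetZZ_transpose f 0 2) w v
  have hI := fun v v' => dotProduct_mulVec_symm (hessInv_transpose f) v v'
  have c1 : ∀ a b, contr 1 (jet f a b) z₀ = -1 / 6 * (jetZ f a b ⬝ᵥ w) := fun a b => by
    rw [contr_one, hz₀, dotProduct_smul, smul_eq_mul]; rfl
  have c2 : ∀ a b, contr 2 (jet f a b) z₀ = 1 / 36 * (w ⬝ᵥ (jetZZ f a b *ᵥ w)) := fun a b => by
    rw [contr_two, hz₀, Matrix.mulVec_smul, dotProduct_smul, smul_dotProduct, smul_eq_mul,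
      smul_eq_mul, ← mul_assoc]
    norm_num
    rfl
  have c3 : contr 3 (jet f 0 1) z₀ =
      -1 / 216 * ∑ i, ∑ j, ∑ k, jet f 0 1 [i, j, k] * w i * w j * w k := by
    simp only [contr, hz₀, Pi.smul_apply, smul_eq_mul, Finset.mul_sum]
    refine Finset.sum_congr rfl fun i _ => Finset.sum_congr rfl fun j _ =>
      Finset.sum_congr rfl fun k _ => by ring
  have s1 : jetZ f 0 3 ⬝ᵥ z₁ = -(w ⬝ᵥ u) := by
    rw [← hHw, dotProduct_comm, ← hHs, hHz, dotProduct_neg]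
  have s2 : ∀ v, v ⬝ᵥ z₁ = -(v ⬝ᵥ (hessInv f *ᵥ u)) := fun v => by rw [hz₁, dotProduct_neg]
  have q1 : z t ⬝ᵥ (jetZZ f 0 0 *ᵥ z t) = t ^ 6 / 36 * (jetZ f 0 3 ⬝ᵥ w) + t ^ 8 / 3 * (w ⬝ᵥ u)
      + t ^ 10 * (u ⬝ᵥ (hessInv f *ᵥ u)) := by
    have h := hHs z₁
    simp only [hz, hz₀, Matrix.mulVec_add, Matrix.mulVec_smul, dotProduct_add, add_dotProduct,
      dotProduct_smul, smul_dotProduct, smul_eq_mul, hHw, hHz, dotProduct_neg]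
    rw [dotProduct_comm z₁ u, s2 u, dotProduct_comm z₁, s1, dotProduct_comm w (jetZ f 0 3)]
    ring
  have q2 : z t ⬝ᵥ (jetZZ f 0 2 *ᵥ z t) = t ^ 6 / 36 * (w ⬝ᵥ (jetZZ f 0 2 *ᵥ w)) +
      t ^ 8 / 3 * ((jetZZ f 0 2 *ᵥ w) ⬝ᵥ (hessInv f *ᵥ u))
      + t ^ 10 * (z₁ ⬝ᵥ (jetZZ f 0 2 *ᵥ z₁)) := by
    simp only [hz, hz₀, Matrix.mulVec_add, Matrix.mulVec_smul, dotProduct_add, add_dotProduct,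
      dotProduct_smul, smul_dotProduct, smul_eq_mul]
    rw [hD z₁, dotProduct_comm z₁ (jetZZ f 0 2 *ᵥ w), s2]
    ring
  simp only [t8, t10, hf15, c1, c2, c3, q1, q2, Nat.reduceAdd]
  simp only [hx, hz, hz₀, dotProduct_add, dotProduct_smul, smul_eq_mul, s1, s2, a06, a08, a010,
    a17, a24, ← hw]
  simp only [hu, Matrix.mulVec_add, Matrix.mulVec_sub, Matrix.mulVec_smul, dotProduct_add,
    dotProduct_sub, dotProduct_smul, add_dotProduct, smul_dotProduct, smul_eq_mul, hD]
  rw [hI (jetZ f 0 5) (jetZ f 1 2), hI (jetZ f 0 5) (jetZZ f 0 2 *ᵥ w),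
    hI (jetZ f 1 2) (jetZZ f 0 2 *ᵥ w), dotProduct_comm w (jetZ f 0 5),
    dotProduct_comm w (jetZ f 1 2), dotProduct_comm w (jetZ f 0 7)]
  rw [dotProduct_comm (hessInv f *ᵥ jetZ f 0 5), dotProduct_comm (hessInv f *ᵥ (jetZZ f 0 2 *ᵥ w))]
  generalize (∑ i, ∑ j, ∑ k, jet f 0 1 [i, j, k] * w i * w j * w k) = K
  ring

end Normalized

/-! ### The linear normalization -/

/-- The linear map `planeChange M`. -/
def planeChangeL {n : ℕ} (M : Matrix (Fin 2) (Fin 2) ℝ) : Coord n →ₗ[ℝ] Coord n where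
  toFun := planeChange M
  map_add' k k' := coord_ext (by simp [planeChange]; ring) (by simp [planeChange]; ring)
    (by ext i; simp [planeChange, zpart])
  map_smul' c k := coord_ext (by simp [planeChange]; ring) (by simp [planeChange]; ring)
    (by ext i; simp [planeChange, zpart])

theorem planeChange_inv {n : ℕ} {M : Matrix (Fin 2) (Fin 2) ℝ} (hM : M.det ≠ 0) (k : Coord n) :
    planeChange M (planeChange M⁻¹ k) = k := by
  have h := Matrix.mul_nonsing_inv M (isUnit_iff_ne_zero.2 hM)
  have h00 := congrFun (congrFun h 0) 0
  have h01 := congrFun (congrFun h 0) 1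
  have h10 := congrFun (congrFun h 1) 0
  have h11 := congrFun (congrFun h 1) 1
  simp only [Matrix.mul_apply, Fin.sum_univ_two, Matrix.one_apply_eq, ne_eq, zero_ne_one,
    one_ne_zero, not_false_eq_true, Matrix.one_apply_ne] at h00 h01 h10 h11
  refine coord_ext ?_ ?_ rfl
  · change M 0 0 * (M⁻¹ 0 0 * k 0 + M⁻¹ 0 1 * k 1) + M 0 1 * (M⁻¹ 1 0 * k 0 + M⁻¹ 1 1 * k 1) = k 0
    linear_combination k 0 * h00 + k 1 * h01
  · change M 1 0 * (M⁻¹ 0 0 * k 0 + M⁻¹ 0 1 * k 1) + M 1 1 * (M⁻¹ 1 0 * k 0 + M⁻¹ 1 1 * k 1) = k 1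
    linear_combination k 0 * h10 + k 1 * h11

theorem planeChange_pt {n : ℕ} (M : Matrix (Fin 2) (Fin 2) ℝ) (x y : ℝ) (z : Fin n → ℝ) :
    planeChange M (pt x y z) = pt (M 0 0 * x + M 0 1 * y) (M 1 0 * x + M 1 1 * y) z := rfl

theorem EvenCorankTwo.comp_planeChange {n : ℕ} {f : Coord n → ℝ} (hf : EvenCorankTwo f)
    {M : Matrix (Fin 2) (Fin 2) ℝ} (hM : M.det ≠ 0) : EvenCorankTwo (f ∘ planeChange M) := by
  obtain ⟨L, hL⟩ : ∃ L : Coord n →L[ℝ] Coord n, ∀ k, L k = planeChange M k :=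
    ⟨LinearMap.toContinuousLinearMap (planeChangeL M), fun k => rfl⟩
  have hfun : f ∘ planeChange M = fun k => f (L k) := funext fun k => by simp [hL]
  have hfd : Differentiable ℝ f := hf.smooth.differentiable (by simp)
  have hd : fderiv ℝ (fun k => f (L k)) = fun k => (fderiv ℝ f (L k)).comp L := funext fun k =>
    ((hfd (L k)).hasFDerivAt.comp k L.hasFDerivAt).fderiv
  have hfd2 : DifferentiableAt ℝ (fderiv ℝ f) (L 0) :=
    (hf.smooth.fderiv_right (m := ∞) (by simp)).differentiable (by simp) _
  have hd2 : ∀ v w, fderiv ℝ (fderiv ℝ (fun k => f (L k))) 0 v w =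
      fderiv ℝ (fderiv ℝ f) 0 (L v) (L w) := fun v w => by
    rw [hd]
    have h1 := hfd2.hasFDerivAt.comp 0 L.hasFDerivAt
    have h2 := h1.clm_comp (hasFDerivAt_const L (0 : Coord n))
    have h3 := h2.fderiv
    simp only [Function.comp_def] at h3
    rw [h3, map_zero]
    simp
  refine ⟨?_, fun k => ?_, fun v => ?_⟩
  · rw [hfun]
    exact hf.smooth.comp L.contDiff
  · rw [hfun]
    simp only [map_neg, hf.even]
  · rw [hfun]
    simp only [hd2]
    have h1 : (∀ w, fderiv ℝ (fderiv ℝ f) 0 (L v) (L w) = 0) ↔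
        ∀ w, fderiv ℝ (fderiv ℝ f) 0 (L v) w = 0 := by
      refine ⟨fun h w => ?_, fun h w => h _⟩
      have h2 := h (planeChange M⁻¹ w)
      rwa [hL (planeChange M⁻¹ w), planeChange_inv hM] at h2
    rw [h1, hf.kernel, hL]
    rfl

theorem EvenCorankTwo.quarticForm_comp_planeChange {n : ℕ} {f : Coord n → ℝ}
    (hf : EvenCorankTwo f) {M : Matrix (Fin 2) (Fin 2) ℝ} (hM : M.det ≠ 0) (x y : ℝ) :
    quarticForm (f ∘ planeChange M) x y =
      quarticForm f (M 0 0 * x + M 0 1 * y) (M 1 0 * x + M 1 1 * y) := by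
  have key : ∀ {g : Coord n → ℝ}, EvenCorankTwo g → ∀ a b : ℝ,
      (fun t => g (pt (t * a) (t * b) 0) - (g 0 + t ^ 4 * quarticForm g a b)) =O[𝓝 0]
        fun t : ℝ => t ^ 6 := fun {g} hg a b => by
    have hlin : ∀ c : ℝ, (fun t : ℝ => t * c) =O[𝓝 0] fun t : ℝ => t := fun c =>
      ((isBigO_refl (fun t : ℝ => t) (𝓝 0)).const_mul_left c).congr_left fun t => mul_comm _ _
    refine (hg.isBigO_quartic (l := 𝓝 (0 : ℝ)) (r := fun t => t) (z := fun _ => 0) tendsto_id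
      (hlin a) (hlin b) (isBigO_zero _ _)).congr_left fun t => ?_
    simp only [quarticForm]
    ring
  have h1 := key (hf.comp_planeChange hM) x y
  have h2 := key hf (M 0 0 * x + M 0 1 * y) (M 1 0 * x + M 1 1 * y)
  have h3 := eq_zero_of_isBigO_pow_succ (H := fun _ => quarticForm f (M 0 0 * x + M 0 1 * y)
    (M 1 0 * x + M 1 1 * y) - quarticForm (f ∘ planeChange M) x y) continuousAt_const (k := 4)
    (IsBigO.pow_mono ((h1.sub h2).congr_left fun t => ?_) (by norm_num : 4 + 1 ≤ 6))
  · linarith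
  · have h0 : (f ∘ planeChange M) 0 = f 0 := by
      rw [Function.comp_apply, ← pt_zero_zero, planeChange_pt]
      simp
    rw [h0, Function.comp_apply, planeChange_pt]
    rw [show M 0 0 * (t * x) + M 0 1 * (t * y) = t * (M 0 0 * x + M 0 1 * y) by ring,
      show M 1 0 * (t * x) + M 1 1 * (t * y) = t * (M 1 0 * x + M 1 1 * y) by ring]
    ring

/-- The normalization is a condition on the quartic form. -/
theorem EvenCorankTwo.normalized {n : ℕ} {f : Coord n → ℝ} (hf : EvenCorankTwo f) {ε η c : ℝ}
    (hq : ∀ x y, quarticForm f x y = ε * x ^ 4 + η * x ^ 2 * y ^ 2 + c * y ^ 4)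
    (hc : 4 * c ≠ ε) : Normalized ε η f := by
  have h1 := hq 1 0
  have h2 := hq 0 1
  have h3 := hq 1 1
  have h4 := hq 1 (-1)
  have h5 := hq 2 1
  simp only [quarticForm] at h1 h2 h3 h4 h5
  ring_nf at h1 h2 h3 h4 h5
  refine ⟨hf, by linarith, by linarith, by linarith, by linarith, fun h => hc (by linarith)⟩

/-- Undoing a linear change of variables. -/
theorem LinReduces.isSquareUpToSign {q p : ℝ → ℝ → ℝ} (h : LinReduces q p)
    (hp : IsSquareUpToSign p) : IsSquareUpToSign q := by
  obtain ⟨M, hM, h⟩ := h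
  obtain ⟨s, a, b, c, hs, hp⟩ := hp
  have hD : M 0 0 * M 1 1 - M 0 1 * M 1 0 ≠ 0 := by rwa [← Matrix.det_fin_two]
  set D := M 0 0 * M 1 1 - M 0 1 * M 1 0 with hDdef
  refine ⟨s, (a * M 1 1 ^ 2 - b * M 1 1 * M 1 0 + c * M 1 0 ^ 2) / D ^ 2,
    (-2 * a * M 1 1 * M 0 1 + b * (M 1 1 * M 0 0 + M 0 1 * M 1 0) - 2 * c * M 1 0 * M 0 0) / D ^ 2,
    (a * M 0 1 ^ 2 - b * M 0 1 * M 0 0 + c * M 0 0 ^ 2) / D ^ 2, hs, fun x y => ?_⟩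
  have h1 := h ((M 1 1 * x - M 0 1 * y) / D) ((-M 1 0 * x + M 0 0 * y) / D)
  rw [hp, show M 0 0 * ((M 1 1 * x - M 0 1 * y) / D) + M 0 1 * ((-M 1 0 * x + M 0 0 * y) / D) = x by
      field_simp; rw [hDdef]; ring,
    show M 1 0 * ((M 1 1 * x - M 0 1 * y) / D) + M 1 1 * ((-M 1 0 * x + M 0 0 * y) / D) = y by
      field_simp; rw [hDdef]; ring] at h1
  rw [h1]
  field_simp
  ring

/-- The forms `± x⁴ + a x² y² ± y⁴`, `a ≠ 0`, are scaled to make the middle coefficient a sign. -/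
theorem LinReduces.scale {q : ℝ → ℝ → ℝ} {s a t : ℝ} (ha : a ≠ 0)
    (h : LinReduces q fun x y => s * x ^ 4 + a * x ^ 2 * y ^ 2 + t * y ^ 4) :
    ∃ η c : ℝ, IsSign η ∧ LinReduces q fun x y => s * x ^ 4 + η * x ^ 2 * y ^ 2 + c * y ^ 4 := by
  obtain ⟨M, hM, h⟩ := h
  obtain ⟨r, hr, hr0⟩ : ∃ r : ℝ, |a| * r ^ 2 = 1 ∧ r ≠ 0 := by
    have h1 : 0 < √|a| := Real.sqrt_pos.2 (abs_pos.2 ha)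
    refine ⟨(√|a|)⁻¹, ?_, inv_ne_zero h1.ne'⟩
    rw [inv_pow, Real.sq_sqrt (abs_nonneg a), mul_inv_cancel₀ (abs_ne_zero.2 ha)]
  refine ⟨a * r ^ 2, t * r ^ 4, ?_, !![M 0 0, M 0 1 * r; M 1 0, M 1 1 * r], ?_, fun x y => ?_⟩
  · rcases le_total 0 a with h0 | h0
    · rw [abs_of_nonneg h0] at hr
      exact Or.inl hr
    · rw [abs_of_nonpos h0] at hr
      exact Or.inr (by linarith)
  · rw [Matrix.det_fin_two] at hM ⊢
    simp only [Matrix.of_apply, Matrix.cons_val', Matrix.cons_val_zero, Matrix.cons_val_one,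
      Matrix.cons_val_fin_one]
    intro h0
    exact hM ((mul_eq_zero.1 (by linear_combination h0 :
      (M 0 0 * M 1 1 - M 0 1 * M 1 0) * r = 0)).resolve_right hr0)
  · have h1 := h x (r * y)
    simp only [Matrix.of_apply, Matrix.cons_val', Matrix.cons_val_zero, Matrix.cons_val_one,
      Matrix.cons_val_fin_one]
    rw [mul_assoc (M 0 1), mul_assoc (M 1 1), h1]
    ring

theorem isSquareUpToSign_of_eq {ε η c : ℝ} (hε : IsSign ε) (hη : IsSign η) (hc : 4 * c = ε) :
    IsSquareUpToSign fun x y => ε * x ^ 4 + η * x ^ 2 * y ^ 2 + c * y ^ 4 := by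
  refine ⟨ε, 1, 0, ε * η / 2, hε, fun x y => ?_⟩
  obtain rfl : c = ε / 4 := by linarith
  rcases hε with rfl | rfl <;> rcases hη with rfl | rfl <;> ring

/-- The condition `f_{y⁴} ≠ 6 ε` holds since otherwise the quartic form would be a square up to sign. -/
theorem EvenCorankTwo.exists_normalized {n : ℕ} {f : Coord n → ℝ} (hf : EvenCorankTwo f)
    (hsq : ¬ IsSquareUpToSign (quarticForm f))
    (h : (∃ s t a : ℝ, IsSign s ∧ IsSign t ∧ a ≠ 0 ∧
          LinReduces (quarticForm f) (fun x y => s * x ^ 4 + a * x ^ 2 * y ^ 2 + t * y ^ 4)) ∨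
        (∃ s t : ℝ, IsSign s ∧ IsSign t ∧
          LinReduces (quarticForm f) (fun x y => x ^ 2 * (s * x ^ 2 + t * y ^ 2)))) :
    ∃ ε η : ℝ, IsSign ε ∧ IsSign η ∧
        ∃ M : Matrix (Fin 2) (Fin 2) ℝ, M.det ≠ 0 ∧ Normalized ε η (f ∘ planeChange M) := by
  obtain ⟨ε, η, c, hε, hη, hq⟩ : ∃ ε η c : ℝ, IsSign ε ∧ IsSign η ∧
      LinReduces (quarticForm f) fun x y => ε * x ^ 4 + η * x ^ 2 * y ^ 2 + c * y ^ 4 := by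
    rcases h with ⟨s, t, a, hs, -, ha, h⟩ | ⟨s, t, hs, ht, h⟩
    · obtain ⟨η, c, hη, h⟩ := h.scale ha
      exact ⟨s, η, c, hs, hη, h⟩
    · refine ⟨s, t, 0, hs, ht, ?_⟩
      obtain ⟨M, hM, h⟩ := h
      exact ⟨M, hM, fun x y => (h x y).trans (by ring)⟩
  have hc : 4 * c ≠ ε := fun hc => hsq (hq.isSquareUpToSign (isSquareUpToSign_of_eq hε hη hc))
  obtain ⟨M, hM, hq⟩ := hq
  refine ⟨ε, η, hε, hη, M, hM, (hf.comp_planeChange hM).normalized (c := c) (fun x y => ?_) hc⟩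
  rw [hf.quarticForm_comp_planeChange hM, hq]

/-! ### The criterion -/

/-- The correction polynomials: none for `μ = 5`, the universal ones for `μ ≥ 6`. -/
def xeCorrection (n : ℕ) (σ : ℚ) (μ : ℕ) : MvPolynomial (JetVar n) ℚ :=
  if 6 ≤ μ then correction n σ (μ - 3) else 0

theorem xeCorrection_five (n : ℕ) (σ : ℚ) : xeCorrection n σ 5 = 0 := by
  simp [xeCorrection]

theorem xeCorrection_add_three {n : ℕ} {σ : ℚ} {m : ℕ} (hm : 3 ≤ m) :
    xeCorrection n σ (m + 3) = correction n σ m := by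
  rw [xeCorrection, if_pos (by omega), Nat.add_sub_cancel]

theorem constantCoeff_xeCorrection (n : ℕ) (σ : ℚ) (μ : ℕ) :
    MvPolynomial.constantCoeff (xeCorrection n σ μ) = 0 := by
  rw [xeCorrection]
  split_ifs
  · exact constantCoeff_correction _ _ _
  · exact map_zero _

theorem allowed_of_mem_vars_xeCorrection {n : ℕ} {σ : ℚ} {μ : ℕ} {v : JetVar n}
    (hv : v ∈ (xeCorrection n σ μ).vars) : JetVar.Allowed μ v := by
  rw [xeCorrection] at hv
  split_ifs at hv with h
  · have h1 := allowed_of_mem_vars_correction hv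
    rwa [Nat.sub_add_cancel (by omega)] at h1
  · simp at hv

theorem coeff_eq_of_isBigO {φ : ℝ → ℝ} {p q : Polynomial ℝ} {k i : ℕ}
    (hp : (fun t => φ t - p.eval t) =O[𝓝 0] fun t : ℝ => t ^ k)
    (hq : (fun t => φ t - q.eval t) =O[𝓝 0] fun t : ℝ => t ^ k) (hi : i < k) :
    p.coeff i = q.coeff i := by
  have h := coeff_lt_eq_zero (p := p - q) ((hq.sub hp).congr_left fun t => by
    rw [Polynomial.eval_sub]; ring) hi
  rw [Polynomial.coeff_sub] at h
  linarith

/-- For an even function whose Taylor coefficients of the orders `2m`, `m ≥ 2`, are `c m`, the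
first nonvanishing coefficient determines the leading term. -/
theorem leading_term_iff {φ : ℝ → ℝ} (hφ : ContDiff ℝ ∞ φ) (he : ∀ t, φ (-t) = φ t) {d : ℝ}
    {c : ℕ → ℝ} (h4 : (fun t => φ t - d) =O[𝓝 0] fun t : ℝ => t ^ 4)
    (hc : ∀ m, 2 ≤ m → ∃ p : Polynomial ℝ, ((fun t => φ t - p.eval t) =O[𝓝 0]
      fun t : ℝ => t ^ (2 * m + 1)) ∧ p.coeff (2 * m) = c m) {m : ℕ} (hm : 2 ≤ m) {a : ℝ} :
    ((fun t => φ t - d - a * t ^ (2 * m)) =O[𝓝 0] fun t : ℝ => t ^ (2 * m + 1)) ↔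
      (∀ k, 2 ≤ k → k < m → c k = 0) ∧ a = c m := by
  constructor
  · intro h
    have key : ∀ k, 2 ≤ k → k ≤ m → c k = if k = m then a else 0 := fun k hk hkm => by
      obtain ⟨p, hp, hpc⟩ := hc k hk
      have h1 : (fun t => φ t - (Polynomial.C d + Polynomial.C a * Polynomial.X ^ (2 * m)).eval t)
          =O[𝓝 0] fun t : ℝ => t ^ (2 * k + 1) :=
        (IsBigO.pow_mono h (by omega)).congr_left fun t => by simp; ring
      rw [← hpc, coeff_eq_of_isBigO hp h1 (Nat.lt_succ_self _), Polynomial.coeff_add,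
        Polynomial.coeff_C_mul_X_pow, Polynomial.coeff_C, if_neg (by omega), zero_add]
      by_cases hkm' : k = m
      · rw [if_pos hkm', if_pos (by omega)]
      · rw [if_neg hkm', if_neg (by omega)]
    exact ⟨fun k hk hkm => by rw [key k hk hkm.le, if_neg hkm.ne], by rw [key m hm le_rfl, if_pos rfl]⟩
  · rintro ⟨h0, rfl⟩
    -- a function of order `2m` has the leading term `c m t^(2m)`
    have lead : ∀ k, 2 ≤ k → ((fun t => φ t - d) =O[𝓝 0] fun t : ℝ => t ^ (2 * k)) →
        (fun t => φ t - d - c k * t ^ (2 * k)) =O[𝓝 0] fun t : ℝ => t ^ (2 * k + 1) := by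
      intro k hk h
      obtain ⟨p, hp, hpc⟩ := hc k hk
      have h1 : (fun t => (p - Polynomial.C d).eval t) =O[𝓝 0] fun t : ℝ => t ^ (2 * k) :=
        (h.sub (IsBigO.pow_mono hp (Nat.le_succ _))).congr_left fun t => by simp
      have h2 := isBigO_sub_leading h1
      rw [Polynomial.coeff_sub, hpc, Polynomial.coeff_C, if_neg (by omega), sub_zero] at h2
      exact (hp.add h2).congr_left fun t => by rw [Polynomial.eval_sub, Polynomial.eval_C]; ring
    refine lead m hm ?_
    have ind : ∀ k, 2 ≤ k → k ≤ m → (fun t => φ t - d) =O[𝓝 0] fun t : ℝ => t ^ (2 * k) := by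
      intro k hk
      induction k, hk using Nat.le_induction with
      | base => exact fun _ => h4
      | succ k hk ih =>
        intro hkm
        have h1 := lead k hk (ih (by omega))
        rw [h0 k hk (by omega)] at h1
        obtain ⟨τ, hτ, -, hφτ⟩ := exists_even_quotient (φ := fun t => φ t - d) (by fun_prop)
          (fun t => by rw [he]) h1
        refine ((isBigO_refl (fun t : ℝ => t ^ (2 * (k + 1))) (𝓝 0)).mul
          ((hτ.continuous.tendsto 0).isBigO_one ℝ)).congr (fun t => ?_) fun t => mul_one _
        rw [hφτ]
        ring
    exact ind m hm le_rfl

theorem OddGerm.comp_planeChange {n : ℕ} (g : Coord n → ℝ) {M : Matrix (Fin 2) (Fin 2) ℝ}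
    (hM : M.det ≠ 0) : OddGerm (g ∘ planeChange M) g := by
  have hsurj : Function.Surjective (planeChangeL (n := n) M) := fun k =>
    ⟨planeChange M⁻¹ k, planeChange_inv hM k⟩
  let e : Coord n ≃L[ℝ] Coord n := (LinearEquiv.ofInjectiveEndo (planeChangeL M)
    (LinearMap.injective_iff_surjective.2 hsurj)).toContinuousLinearEquiv
  have he : ∀ k, e k = planeChange M k := fun k => rfl
  have he' : planeChange M = fun k : Coord n => e k := funext fun k => (he k).symm
  rw [he']
  exact ⟨e, e.contDiff, fun k => map_neg e k, ⟨e, e.hasFDerivAt⟩, EventuallyEq.rfl⟩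

namespace Normalized

variable {n : ℕ} {ε η : ℝ} {f : Coord n → ℝ} {σ : ℚ} {X : ℝ → ℝ} {Z : ℝ → Fin n → ℝ}

theorem isBigO_critCurve_five (hf : Normalized ε η f) (hc : IsCritCurve f X Z) :
    (fun t => f (pt (X t) t (Z t)) - (f 0 + jet f 0 4 [] / 24 * t ^ 4)) =O[𝓝 0]
      fun t : ℝ => t ^ 5 := by
  have h1 := IsBigO.pow_mono (hf.isBigO_quartic (l := 𝓝 (0 : ℝ)) (r := fun t => t) tendsto_id
    (by simpa using IsBigO.pow_mono hc.order_x (by norm_num : 1 ≤ 3)) (isBigO_refl _ _)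
    hc.order_z) (by norm_num : 5 ≤ 6)
  have h2 : (fun t => ε * X t ^ 4) =O[𝓝 0] fun t : ℝ => t ^ 5 :=
    (IsBigO.pow_mono ((hc.order_x.pow 4).congr_right fun t => by rw [← pow_mul])
      (by norm_num)).const_mul_left ε
  have h3 : (fun t => η * (X t ^ 2 * t ^ 2)) =O[𝓝 0] fun t : ℝ => t ^ 5 :=
    (IsBigO.pow_mono (((hc.order_x.pow 2).mul (isBigO_refl (fun t : ℝ => t ^ 2) _)).congr_right
      fun t => by rw [← pow_mul, ← pow_add]) (by norm_num)).const_mul_left η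
  refine ((h1.add h2).add h3).congr_left fun t => ?_
  rw [hf.quarticForm_eq]
  ring

/-- The numbers `x_{e,μ}` are the Taylor coefficients of even order of `f` along a critical curve, up
to factorials. -/
theorem exists_taylor_xe (hη : IsSign η) (hf : Normalized ε η f) (hσ : (σ : ℝ) = η)
    (hc : IsCritCurve f X Z) {m : ℕ} (hm : 2 ≤ m) :
    ∃ p : Polynomial ℝ, ((fun t => f (pt (X t) t (Z t)) - p.eval t) =O[𝓝 0]
      fun t : ℝ => t ^ (2 * m + 1)) ∧
      p.coeff (2 * m) = xe (xeCorrection n σ) f (m + 3) / (Nat.factorial (2 * m) : ℝ) := by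
  rcases hm.eq_or_lt with rfl | hm
  · refine ⟨Polynomial.C (f 0) + Polynomial.C (jet f 0 4 [] / 24) * Polynomial.X ^ 4,
      (hf.isBigO_critCurve_five hc).congr_left fun t => by simp, ?_⟩
    rw [Polynomial.coeff_add, Polynomial.coeff_C_mul_X_pow, Polynomial.coeff_C]
    simp [xe, xeCorrection_five, evalJet, Nat.factorial]
  · obtain ⟨p, hp, hpc⟩ := hf.exists_taylor_critCurve hη hσ hc hm
    refine ⟨p, hp, hpc.trans ?_⟩
    rw [xe, xeCorrection_add_three hm, show 2 * (m + 3) - 6 = 2 * m by omega]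

/-- The vanishing of the numbers `x_{e,μ}` in terms of `f` along a critical curve. -/
theorem isBigO_critCurve_iff (hη : IsSign η) (hf : Normalized ε η f) (hσ : (σ : ℝ) = η)
    (hc : IsCritCurve f X Z) {m : ℕ} (hm : 2 ≤ m) {a : ℝ} :
    (a ≠ 0 ∧ (fun t => f (pt (X t) t (Z t)) - f 0 - a * t ^ (2 * m)) =O[𝓝 0]
      fun t : ℝ => t ^ (2 * m + 1)) ↔
    XeCriterion (xe (xeCorrection n σ) f) (m + 3) ∧
      a = xe (xeCorrection n σ) f (m + 3) / (Nat.factorial (2 * m) : ℝ) := by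
  have hX := hc.smooth_x
  have hZ := hc.smooth_z
  have hfac : ∀ k : ℕ, (Nat.factorial k : ℝ) ≠ 0 := fun k => by positivity
  have h4 : (fun t => f (pt (X t) t (Z t)) - f 0) =O[𝓝 0] fun t : ℝ => t ^ 4 :=
    ((IsBigO.pow_mono (hf.isBigO_critCurve_five hc) (by norm_num)).add
      ((isBigO_refl (fun t : ℝ => t ^ 4) (𝓝 0)).const_mul_left (jet f 0 4 [] / 24))).congr_left
      fun t => by ring
  have hφ : ContDiff ℝ ∞ fun t => f (pt (X t) t (Z t)) :=
    hf.smooth.comp (ContDiff.pt hX contDiff_id hZ)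
  rw [leading_term_iff hφ (fun t => ?_) h4 (fun k hk => hf.exists_taylor_xe hη hσ hc hk) hm, XeCriterion]
  · constructor
    · rintro ⟨ha, h, rfl⟩
      refine ⟨⟨fun j h1 h2 => ?_, fun h0 => ha (by rw [h0, zero_div])⟩, rfl⟩
      obtain ⟨k, rfl⟩ : ∃ k, j = k + 3 := ⟨j - 3, by omega⟩
      exact (div_eq_zero_iff.1 (h k (by omega) (by omega))).resolve_right (hfac _)
    · rintro ⟨⟨h, h0⟩, rfl⟩
      exact ⟨div_ne_zero h0 (hfac _), fun k h1 h2 => by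
        rw [h (k + 3) (by omega) (by omega), zero_div], rfl⟩
  · rw [hc.odd_x, hc.odd_z, ← neg_pt, hf.even]

/-- Two polynomial approximations of `f` along the same critical curve are compared. -/
theorem xe_table (hη : IsSign η) (hf : Normalized ε η f) (hσ : (σ : ℝ) = η)
    (hc : IsCritCurve f X Z) :
    xe (xeCorrection n σ) f 5 = jet f 0 4 [] ∧ xe (xeCorrection n σ) f 6 = a06 f ∧
      xe (xeCorrection n σ) f 7 = a08 f - 7 * η / 10 * a15 f ^ 2 ∧
      xe (xeCorrection n σ) f 8 =
        a010 f - 3 * η * a15 f * a17 f + 21 / 16 * a15 f ^ 2 * a24 f := by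
  obtain ⟨A6, hA6⟩ : ∃ A, A = a06 f := ⟨_, rfl⟩
  obtain ⟨A8, hA8⟩ : ∃ A, A = a08 f - 7 * η / 10 * a15 f ^ 2 := ⟨_, rfl⟩
  obtain ⟨A10, hA10⟩ : ∃ A, A = a010 f - 3 * η * a15 f * a17 f + 21 / 16 * a15 f ^ 2 * a24 f :=
    ⟨_, rfl⟩
  have h := hf.isBigO_tabulated hη hc
  rw [← hA6, ← hA8, ← hA10] at h
  obtain ⟨q, hq⟩ : ∃ q : Polynomial ℝ, q = Polynomial.C (f 0) +
      Polynomial.C (jet f 0 4 [] / 24) * Polynomial.X ^ 4 +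
      Polynomial.C (A6 / 720) * Polynomial.X ^ 6 + Polynomial.C (A8 / 40320) * Polynomial.X ^ 8 +
      Polynomial.C (A10 / 3628800) * Polynomial.X ^ 10 := ⟨_, rfl⟩
  have hqO : (fun t => f (pt (X t) t (Z t)) - q.eval t) =O[𝓝 0] fun t : ℝ => t ^ 11 :=
    h.congr_left fun t => by simp [hq]
  have key : ∀ m, 2 ≤ m → m ≤ 5 → q.coeff (2 * m) =
      xe (xeCorrection n σ) f (m + 3) / (Nat.factorial (2 * m) : ℝ) := fun m h1 h2 => by
    obtain ⟨p, hp, hpc⟩ := hf.exists_taylor_xe hη hσ hc h1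
    rw [← hpc]
    exact coeff_eq_of_isBigO (IsBigO.pow_mono hqO (by omega)) hp (Nat.lt_succ_self _)
  have k3 := key 3 (by norm_num) (by norm_num)
  have k4 := key 4 (by norm_num) (by norm_num)
  have k5 := key 5 (by norm_num) (by norm_num)
  simp only [hq, Polynomial.coeff_add, Polynomial.coeff_C_mul_X_pow, Polynomial.coeff_C,
    Nat.reduceMul, Nat.reduceEqDiff, if_false, if_true, Nat.reduceAdd, Nat.factorial,
    Nat.succ_eq_add_one, Nat.cast_ofNat, OfNat.ofNat_ne_zero] at k3 k4 k5
  refine ⟨by simp [xe, xeCorrection_five, evalJet], ?_, ?_, ?_⟩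
  · linarith
  · linarith
  · linarith

/-- For `μ = 5` the normal form is scaled to a member of the class `X_{e,5}`. -/
theorem isClassXe_five (hε : IsSign ε) (hη : IsSign η) {a d : ℝ} {Q : QuadraticForm ℝ (Fin n → ℝ)}
    (hQ : Q.Nondegenerate) (ha : a ≠ 0) (ha' : 4 * ε * a ≠ 1)
    (h : OddGerm f (splitForm d (fun x y => ε * x ^ 4 + η * x ^ 2 * y ^ 2 + a * y ^ 4) Q)) :
    ∃ s t, IsClassXe 5 s t f := by
  obtain ⟨r, hr0, hr⟩ : ∃ r : ℝ, 0 < r ∧ r ^ 4 = |a| := by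
    refine ⟨√(√|a|), Real.sqrt_pos.2 (Real.sqrt_pos.2 (abs_pos.2 ha)), ?_⟩
    rw [show (4 : ℕ) = 2 * 2 by norm_num, pow_mul, Real.sq_sqrt (Real.sqrt_nonneg _),
      Real.sq_sqrt (abs_nonneg a)]
  obtain ⟨t, ht, hat⟩ : ∃ t : ℝ, IsSign t ∧ a = t * |a| := by
    rcases le_total 0 a with h0 | h0
    · exact ⟨1, Or.inl rfl, by rw [abs_of_nonneg h0, one_mul]⟩
    · exact ⟨-1, Or.inr rfl, by rw [abs_of_nonpos h0]; ring⟩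
  refine ⟨ε, t, hε, ht, d, Q, hQ, Or.inl ⟨rfl, η / r ^ 2, ?_, ?_⟩⟩
  · rintro rfl h4
    have hηη : η ^ 2 = 1 := by rcases hη with rfl | rfl <;> norm_num
    have hεε : ε * ε = 1 := by rcases hε with rfl | rfl <;> norm_num
    rw [div_pow, hηη, ← pow_mul, hr, div_eq_iff (abs_ne_zero.2 ha)] at h4
    refine ha' ?_
    rw [hat]
    linear_combination 4 * |a| * hεε - h4
  · have hM : (!![1, 0; 0, r] : Matrix (Fin 2) (Fin 2) ℝ).det ≠ 0 := by
      simpa [Matrix.det_fin_two] using hr0.ne'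
    have h1 := OddGerm.comp_planeChange (splitForm d (fun x y => ε * x ^ 4
      + η / r ^ 2 * x ^ 2 * y ^ 2 + t * y ^ 4) Q) hM
    refine (h.trans ?_).oddEquiv
    convert h1 using 1
    ext k
    simp only [Function.comp_apply, splitForm, planeChange, Matrix.of_apply, Matrix.cons_val',
      Matrix.cons_val_zero, Matrix.cons_val_one, Matrix.cons_val_fin_one, Matrix.cons_val_succ]
    rw [hat, ← hr]
    field_simp
    ring

end Normalized

/-! ### Classification -/

namespace Normalized

variable {n : ℕ} {ε η : ℝ} {f : Coord n → ℝ} {σ : ℚ}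

/-- The singularity class is read off from the numbers `x_{e,μ}`, which also give the normal form
and the modulus. -/
theorem classification (hε : IsSign ε) (hη : IsSign η) (hf : Normalized ε η f) (hσ : (σ : ℝ) = η)
    {m : ℕ} (hm : 2 ≤ m) :
    ((∃ s t : ℝ, IsClassXe (m + 3) s t f) ↔ XeCriterion (xe (xeCorrection n σ) f) (m + 3)) ∧
    (3 ≤ m → (IsClassXe (m + 3) ε η f ↔ XeCriterion (xe (xeCorrection n σ) f) (m + 3))) ∧
    (XeCriterion (xe (xeCorrection n σ) f) (m + 3) →
      (∃ (d : ℝ) (Q : QuadraticForm ℝ (Fin n → ℝ)), Q.Nondegenerate ∧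
        OddEquiv f (splitForm d (fun x y => ε * x ^ 4 + η * x ^ 2 * y ^ 2
          + xe (xeCorrection n σ) f (m + 3) / (Nat.factorial (2 * m) : ℝ) * y ^ (2 * m)) Q)) ∧
      (3 ≤ m → ∀ (a d : ℝ) (Q : QuadraticForm ℝ (Fin n → ℝ)), a ≠ 0 → Q.Nondegenerate →
        OddEquiv f (splitForm d (fun x y => ε * x ^ 4 + η * x ^ 2 * y ^ 2 + a * y ^ (2 * m)) Q) →
        a = xe (xeCorrection n σ) f (m + 3) / (Nat.factorial (2 * m) : ℝ))) := by
  obtain ⟨X, Z, hc, hnf⟩ := hf.exists_oddGerm hε hη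
  have hiff := fun a => hf.isBigO_critCurve_iff hη hσ hc hm (a := a)
  have hQ := hf.nondegenerate_hessForm
  have hx5 : xe (xeCorrection n σ) f 5 = jet f 0 4 [] := (hf.xe_table hη hσ hc).1
  -- the normal form
  obtain ⟨a₀, ha₀⟩ : ∃ a₀, a₀ = xe (xeCorrection n σ) f (m + 3) / (Nat.factorial (2 * m) : ℝ) :=
    ⟨_, rfl⟩
  have hεε : ε * ε = 1 := by rcases hε with rfl | rfl <;> norm_num
  have h5 : m = 2 → 4 * ε * a₀ ≠ 1 := by
    rintro rfl h1
    rw [show 2 + 3 = 5 from rfl, hx5] at ha₀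
    refine hf.d04 ?_
    norm_num [Nat.factorial] at ha₀
    rw [ha₀] at h1
    linear_combination 6 * ε * h1 - jet f 0 4 [] * hεε
  have hform : XeCriterion (xe (xeCorrection n σ) f) (m + 3) → a₀ ≠ 0 ∧
      OddGerm f (splitForm (f 0) (fun x y => ε * x ^ 4 + η * x ^ 2 * y ^ 2 + a₀ * y ^ (2 * m))
        (hessForm f)) := fun h => by
    obtain ⟨h0, hO⟩ := (hiff a₀).2 ⟨h, ha₀⟩
    obtain ⟨j, rfl⟩ : ∃ j, m = j + 2 := ⟨m - 2, by omega⟩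
    exact ⟨h0, hnf j a₀ h0 (fun hj => h5 (by omega)) hO⟩
  -- an equivalence with a normal form of the family `μ ≥ 6` determines the signs and the modulus
  have hconv : 3 ≤ m → ∀ (s t a d : ℝ) (Q : QuadraticForm ℝ (Fin n → ℝ)), IsSign s → IsSign t →
      a ≠ 0 → Q.Nondegenerate →
      OddEquiv f (splitForm d (fun x y => s * x ^ 4 + t * x ^ 2 * y ^ 2 + a * y ^ (2 * m)) Q) →
      XeCriterion (xe (xeCorrection n σ) f) (m + 3) ∧ a = a₀ := by
    intro hm3 s t a d Q hs ht ha hQ h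
    rw [ha₀]
    exact (hiff a).1 ⟨ha, (hf.isBigO_of_equiv hε hη hc hs ht hm3 hQ h).2.2⟩
  have hclass : ∀ s t : ℝ, IsClassXe (m + 3) s t f →
      XeCriterion (xe (xeCorrection n σ) f) (m + 3) := by
    rintro s t ⟨hs, ht, d, Q, hQ, ⟨hm5, a, ha, h⟩ | ⟨hm6, a, ha, h⟩⟩
    · obtain rfl : m = 2 := by omega
      refine ⟨fun j h1 h2 => by omega, ?_⟩
      rw [show 2 + 3 = 5 from rfl, hx5]
      have hG : (fun x y : ℝ => s * x ^ 4 + a * x ^ 2 * y ^ 2 + t * y ^ 4) =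
          fun x y => s * x ^ 4 + a * x ^ 2 * y ^ 2 + t * y ^ 4 + 0 * y ^ (2 * 3) := by
        ext x y; ring
      rw [hG] at h
      obtain ⟨Φ, Ψ, h⟩ := h.exists_isGermEquiv
      obtain ⟨α, β, γ, δ, hdet, hlin, -⟩ := h.exists_linear hf.toEvenCorankTwo le_rfl hQ
      have h1 := coeff_ne_zero_of_linear_change hs ht ha hdet fun x y => by
        rw [← hf.quarticForm_eq, hlin]
      exact fun h0 => h1 (by rw [h0, zero_div])
    · rw [show 2 * (m + 3) - 6 = 2 * m by omega] at h
      exact (hconv (by omega) s t a d Q hs ht ha hQ h).1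
  have hclass' : 3 ≤ m → XeCriterion (xe (xeCorrection n σ) f) (m + 3) →
      IsClassXe (m + 3) ε η f := fun hm3 h => by
    obtain ⟨h0, hg⟩ := hform h
    refine ⟨hε, hη, f 0, hessForm f, hQ, Or.inr ⟨by omega, a₀, h0, ?_⟩⟩
    rw [show 2 * (m + 3) - 6 = 2 * m by omega]
    exact hg.oddEquiv
  refine ⟨⟨fun ⟨s, t, h⟩ => hclass s t h, fun h => ?_⟩,
    fun hm3 => ⟨hclass ε η, hclass' hm3⟩, fun h => ⟨?_, ?_⟩⟩
  · rcases hm.eq_or_lt with rfl | hm3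
    · obtain ⟨h0, hg⟩ := hform h
      exact isClassXe_five hε hη hQ h0 (h5 rfl) hg
    · exact ⟨ε, η, hclass' hm3 h⟩
  · rw [← ha₀]
    exact ⟨f 0, hessForm f, hQ, (hform h).2.oddEquiv⟩
  · intro hm3 a d Q ha hQ h
    rw [← ha₀]
    exact (hconv hm3 ε η a d Q hε hη ha hQ h).2

end Normalized

end

theorem mainTheorem8 (n : ℕ) :
    -- the normalization can be achieved by a linear change of `k_1, k_2`
    (∀ f : Coord n → ℝ, EvenCorankTwo f →
      (∃ x y, quarticForm f x y ≠ 0) →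
      ¬ IsSquareUpToSign (quarticForm f) →
      ((∃ s t a : ℝ, IsSign s ∧ IsSign t ∧ a ≠ 0 ∧
          LinReduces (quarticForm f) (fun x y => s * x ^ 4 + a * x ^ 2 * y ^ 2 + t * y ^ 4)) ∨
        (∃ s t : ℝ, IsSign s ∧ IsSign t ∧
          LinReduces (quarticForm f) (fun x y => x ^ 2 * (s * x ^ 2 + t * y ^ 2)))) →
      ∃ ε η : ℝ, IsSign ε ∧ IsSign η ∧
        ∃ M : Matrix (Fin 2) (Fin 2) ℝ, M.det ≠ 0 ∧ Normalized ε η (f ∘ planeChange M)) ∧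
    -- the numbers `x_{e,μ}^{ε,η}`, given by universal correction polynomials
    (∀ ε η : ℝ, IsSign ε → IsSign η →
      ∃ P : ℕ → MvPolynomial (JetVar n) ℚ,
        (∀ μ, 5 ≤ μ → MvPolynomial.constantCoeff (P μ) = 0 ∧
          ∀ v ∈ (P μ).vars, JetVar.Allowed μ v) ∧
        ∀ f : Coord n → ℝ, Normalized ε η f →
          -- the tabulated values
          (xe P f 5 = jet f 0 4 [] ∧
            xe P f 6 = a06 f ∧
            xe P f 7 = a08 f - 7 * η / 10 * a15 f ^ 2 ∧
            xe P f 8 = a010 f - 3 * η * a15 f * a17 f + 21 / 16 * a15 f ^ 2 * a24 f) ∧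
          ∀ μ, 5 ≤ μ →
            -- the criterion
            ((∃ s t : ℝ, IsClassXe μ s t f) ↔ XeCriterion (xe P f) μ) ∧
            (6 ≤ μ → (IsClassXe μ ε η f ↔ XeCriterion (xe P f) μ)) ∧
            (XeCriterion (xe P f) μ →
              -- the normal form
              (∃ (d : ℝ) (Q : QuadraticForm ℝ (Fin n → ℝ)), Q.Nondegenerate ∧
                OddEquiv f (splitForm d (fun x y => ε * x ^ 4 + η * x ^ 2 * y ^ 2
                  + xe P f μ / (Nat.factorial (2 * μ - 6) : ℝ) * y ^ (2 * μ - 6)) Q)) ∧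
              -- its last coefficient is the even modulus, that is, it is determined by the class
              -- of `f` under odd changes of variables
              (6 ≤ μ → ∀ (a d : ℝ) (Q : QuadraticForm ℝ (Fin n → ℝ)), a ≠ 0 → Q.Nondegenerate →
                OddEquiv f (splitForm d (fun x y => ε * x ^ 4 + η * x ^ 2 * y ^ 2
                  + a * y ^ (2 * μ - 6)) Q) →
                a = xe P f μ / (Nat.factorial (2 * μ - 6) : ℝ)))) := by
  refine ⟨fun f hf _ hsq h => hf.exists_normalized hsq h, fun ε η hε hη => ?_⟩
  obtain ⟨σ, hσ⟩ : ∃ σ : ℚ, (σ : ℝ) = η := by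
    rcases hη with rfl | rfl
    · exact ⟨1, by simp⟩
    · exact ⟨-1, by simp⟩
  refine ⟨xeCorrection n σ, fun μ _ => ⟨constantCoeff_xeCorrection n σ μ,
    fun v hv => allowed_of_mem_vars_xeCorrection hv⟩, fun f hf => ⟨?_, fun μ hμ => ?_⟩⟩
  · obtain ⟨X, Z, hc, -⟩ := hf.exists_oddGerm hε hη
    exact hf.xe_table hη hσ hc
  · obtain ⟨m, rfl⟩ : ∃ m, μ = m + 3 := ⟨μ - 3, by omega⟩
    have hm : (6 ≤ m + 3) = (3 ≤ m) := by rw [eq_iff_iff]; omega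
    rw [show 2 * (m + 3) - 6 = 2 * m by omega, hm]
    exact hf.classification hε hη hσ (by omega)
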